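/- Setting. Let $X$ be a (real or complex) Hilbert space with orthonormal basis $\{e_k\}_{k\ge1}$, let $P_m$ be the orthogonal projection onto the span of $e_1,\dots,e_m$, and let $r>0$. The class $\mathcal H^r$ consists of the compact linear $A:X\to X$ with $\|A\|\le1$, $\|(I-P_m)A\|\le m^{-r}$ and $\|A(I-P_m)\|\le m^{-r}$ for all $m\ge1$. Put $|A|=(A^*A)^{1/2}$, $M_{\mu,\rho}(A)=\{|A|^\mu v:\|v\|\le\rho\}$ and $$A_n=\sum_{k=1}^{2n}(P_{2^k}-P_{2^{k-1}})AP_{2^{2n-k}}+P_1AP_{2^{2n}}.$$ Semiiterative method. Let $p_0,p_1,\dots$ be the monic orthogonal polynomials of a weight function on $[-1,1]$, with recursion $p_{k+1}(x)=(x-\alpha_k)p_k(x)-\beta_kp_{k-1}(x)$, and let $\omega_0=1/(1-\alpha_0)$, $\omega_k=1/(1-\alpha_k-\beta_k\omega_{k-1})$, $r_k(\lambda)=p_k(1-2\lambda)/p_k(1)$. The method has qualification $\mu_0$ with constants $\kappa_0\ge1$ and $\kappa_\nu>0$ ($0<\nu\le\mu_0$) if $|r_k(\lambda)|\le\kappa_0$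 and $|\lambda^{\nu/2}r_k(\lambda)|\le\kappa_\nu(k+1)^{-\nu}$ for all $\lambda\in[0,1]$, $k\ge1$, $0<\nu\le\mu_0$. For data $f_\delta$ its iterates at level $n$ are $x^\delta_{n,0}=0$, $x^\delta_{n,1}=2\omega_0A_n^*f_\delta$ and $$x^\delta_{n,k+1}=x^\delta_{n,k}+((1-\alpha_k)\omega_k-1)(x^\delta_{n,k}-x^\delta_{n,k-1})+2\omega_kA_n^*(f_\delta-A_nx^\delta_{n,k})\qquad(k\ge1).$$ Algorithm 1. Given $\delta,\rho>0$ and $f_\delta$, fix $\gamma>0$ and $\tau>\tau_0:=\kappa_0\bigl(1+\sqrt{\tfrac12+\kappa_2/\kappa_0}\,\gamma\bigr)$. Start at any level $n\ge1$ with $(1+2^{r+3})2^{-2rn}n<\gamma\delta/(2\rho)$. At level $n$, let $K_n$ be the maximal integer $k\ge1$ with $(1+2^{r+3})2^{-2rn}n<\gamma\delta/(2k\rho)$ ($K_n=0$ if there is none), and compute $x^\delta_{n,k}$ for $k=1,\dots,K_n$. Stop at the first $k=:K$ with $\|A_nx^\delta_{n,k}-P_{2^{2n}}f_\delta\|\le\tau\delta$;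 if there is none, replace $n$ by $n+1$ and repeat. Theorem 1. Let $A\in\mathcal H^r$, let the semiiterative method have qualification $\mu_0\ge2$, and let $0<\mu\le\mu_0-1$. Let $f\in\operatorname{Range}(A)$ be such that the minimal-norm solution $x^\dagger$ of $Ax=f$ lies in $M_{\mu,\rho}(A)$, and let $\|f-f_\delta\|\le\delta$. (a) If $0<\delta<\|f\|$, then Algorithm 1 terminates, with a uniquely determined final level $n$ and stopping index $K$ for each starting level, and it is order optimal: $$\|x^\dagger-x^\delta_{n,K}\|\le C\,\rho^{\frac1{\mu+1}}\delta^{\frac\mu{\mu+1}},\qquad C=\kappa_0^{\frac1{\mu+1}}(\tau+c_1)^{\frac\mu{\mu+1}}+2\kappa_0(1+\gamma)c_2,$$ $$c_1=\kappa_0+2+\Bigl(\sqrt{\kappa_0(\tfrac{\kappa_0}2+\kappa_2)}+\tfrac1{2n}\Bigr)\gamma,\qquad c_2=\max\Bigl\{\Bigl(\frac{\kappa_{\mu+1}}{\tau-\tau_0}\Bigr)^{\frac1{\mu+1}},1\Bigr\}.$$ (b) Algorithm 1 is a regularization method on $M_{\mu,\rho}(A)$: if $f\ne0$, then $x^\delta_{n,K}\to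 x^\dagger$ as $\delta\to0$, uniformly over all $f_\delta$ with $\|f-f_\delta\|\le\delta$ and all admissible starting levels. -/

import Mathlib

open Polynomial MeasureTheory

noncomputable section

namespace AdaptiveCross

/-! ### Semiiterative methods -/

/-- A weight function on `[-1, 1]`: nonnegative, integrable, and not almost everywhere zero. -/
structure IsWeight (w : ℝ → ℝ) : Prop where
  nonneg : ∀ x ∈ Set.Icc (-1 : ℝ) 1, 0 ≤ w x
  integrable : IntegrableOn w (Set.Icc (-1 : ℝ) 1)
  pos : 0 < ∫ x in Set.Icc (-1 : ℝ) 1, w x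

/-- The weighted integral `∫_{-1}^{1} p(x) w(x) dx` of a polynomial. -/
def wInt (w : ℝ → ℝ) (p : ℝ[X]) : ℝ := ∫ x in Set.Icc (-1 : ℝ) 1, p.eval x * w x

/-- `P 0, P 1, …` are the monic polynomials, `P k` of degree `k`, which are orthogonal with
respect to the weight `w`. -/
structure IsMonicOrthogonal (w : ℝ → ℝ) (P : ℕ → ℝ[X]) : Prop where
  monic : ∀ k, (P k).Monic
  natDegree_eq : ∀ k, (P k).natDegree = k
  orthogonal : ∀ i j, i ≠ j → wInt w (P i * P j) = 0

/-- The coefficient `α_k` of the recursion `P_{k+1} = (x - α_k) P_k - β_k P_{k-1}`. -/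
def alpha (w : ℝ → ℝ) (P : ℕ → ℝ[X]) (k : ℕ) : ℝ := wInt w (X * P k ^ 2) / wInt w (P k ^ 2)

/-- The coefficient `β_k` (for `k ≥ 1`) of the recursion
`P_{k+1} = (x - α_k) P_k - β_k P_{k-1}`. -/
def beta (w : ℝ → ℝ) (P : ℕ → ℝ[X]) (k : ℕ) : ℝ := wInt w (P k ^ 2) / wInt w (P (k - 1) ^ 2)

/-- The relaxation parameters: `ω_0 = 1 / (1 - α_0)` and
`ω_k = 1 / (1 - α_k - β_k ω_{k-1})` for `k ≥ 1`. -/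
def omega (w : ℝ → ℝ) (P : ℕ → ℝ[X]) : ℕ → ℝ
  | 0 => 1 / (1 - alpha w P 0)
  | k + 1 => 1 / (1 - alpha w P (k + 1) - beta w P (k + 1) * omega w P k)

/-- The residual polynomial `r_k(t) = P_k(1 - 2 t) / P_k(1)`, as a function on `ℝ`. -/
def residual (P : ℕ → ℝ[X]) (k : ℕ) (t : ℝ) : ℝ := (P k).eval (1 - 2 * t) / (P k).eval 1

/-- The semiiterative method with residual polynomials `residual P k` has qualification `μ₀`
with constants `κ ν`, `0 ≤ ν ≤ μ₀`. -/
structure HasQualification (P : ℕ → ℝ[X]) (μ₀ : ℝ) (κ : ℝ → ℝ) : Prop where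
  one_le : 1 ≤ κ 0
  pos : ∀ ν : ℝ, 0 < ν → ν ≤ μ₀ → 0 < κ ν
  bound_zero : ∀ k : ℕ, 1 ≤ k → ∀ t ∈ Set.Icc (0 : ℝ) 1, |residual P k t| ≤ κ 0
  bound : ∀ ν : ℝ, 0 < ν → ν ≤ μ₀ → ∀ k : ℕ, 1 ≤ k → ∀ t ∈ Set.Icc (0 : ℝ) 1,
    |t ^ (ν / 2) * residual P k t| ≤ κ ν / ((k : ℝ) + 1) ^ ν

section Hilbert

variable {𝕜 : Type*} [RCLike 𝕜] {X : Type*} [NormedAddCommGroup X] [InnerProductSpace 𝕜 X]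
  [CompleteSpace X]

/-- The iterates of the semiiterative method for the operator `B` and the right-hand side `g`,
indexed so that the `k`-th iterate is `g_k(B* B) B* g` with `1 - t g_k(t) = residual P k t`. -/
def iter (w : ℝ → ℝ) (P : ℕ → ℝ[X]) (B : X →L[𝕜] X) (g : X) : ℕ → X
  | 0 => 0
  | 1 => ((2 * omega w P 0 : ℝ) : 𝕜) • ContinuousLinearMap.adjoint B g
  | k + 2 =>
    iter w P B g (k + 1)
      + (((1 - alpha w P (k + 1)) * omega w P (k + 1) - 1 : ℝ) : 𝕜) •
          (iter w P B g (k + 1) - iter w P B g k)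
      + ((2 * omega w P (k + 1) : ℝ) : 𝕜) •
          ContinuousLinearMap.adjoint B (g - B (iter w P B g (k + 1)))

/-! ### Source sets -/

/-- `|A|^s v` for a compact operator `A` and `s > 0`, where `|A| = (A* A)^{1/2}`: the sum over all
`t > 0` of `t^s` times the orthogonal projection of `v` onto the eigenspace of `A* A` for the
eigenvalue `t²` (a trivial space unless `t` is a singular value of `A`). -/
def absPow (A : X →L[𝕜] X) (s : ℝ) (v : X) : X :=
  ∑' t : Set.Ioi (0 : ℝ), (((t : ℝ) ^ s : ℝ) : 𝕜) •
    (ContinuousLinearMap.adjoint A ∘L A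
      - (((t : ℝ) ^ 2 : ℝ) : 𝕜) • ContinuousLinearMap.id 𝕜 X).ker.starProjection v

/-- The set `M_{μ,ρ}(A) = {|A|^μ v : ‖v‖ ≤ ρ}`. -/
def sourceSet (A : X →L[𝕜] X) (μ ρ : ℝ) : Set X := {x | ∃ v : X, ‖v‖ ≤ ρ ∧ x = absPow A μ v}

/-- `x` is the solution of minimal norm of the equation `A x = f`. -/
def IsMinNormSol (A : X →L[𝕜] X) (f x : X) : Prop := A x = f ∧ ∀ y, A y = f → ‖x‖ ≤ ‖y‖

/-! ### The class of operators and the hyperbolic cross -/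

/-- The orthogonal projection `P_m` onto the span of the first `m` elements of the
orthonormal basis `e`. -/
def proj (e : HilbertBasis ℕ 𝕜 X) (m : ℕ) : X →L[𝕜] X :=
  ∑ i ∈ Finset.range m, InnerProductSpace.rankOne 𝕜 (e i) (e i)

/-- The class `H^r` of operators, with respect to the orthonormal basis `e`. -/
structure MemH (e : HilbertBasis ℕ 𝕜 X) (r : ℝ) (A : X →L[𝕜] X) : Prop where
  compact : IsCompactOperator A
  norm_le : ‖A‖ ≤ 1
  left : ∀ m : ℕ, 1 ≤ m → ‖(ContinuousLinearMap.id 𝕜 X - proj e m) ∘L A‖ ≤ (m : ℝ) ^ (-r)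
  right : ∀ m : ℕ, 1 ≤ m → ‖A ∘L (ContinuousLinearMap.id 𝕜 X - proj e m)‖ ≤ (m : ℝ) ^ (-r)

/-- The hyperbolic cross discretization `A_n` of `A`. -/
def cross (e : HilbertBasis ℕ 𝕜 X) (A : X →L[𝕜] X) (n : ℕ) : X →L[𝕜] X :=
  (∑ k ∈ Finset.Icc 1 (2 * n),
    (proj e (2 ^ k) - proj e (2 ^ (k - 1))) ∘L A ∘L proj e (2 ^ (2 * n - k)))
  + proj e 1 ∘L A ∘L proj e (2 ^ (2 * n))

/-! ### The adaptive algorithm with the discrepancy principle -/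

/-- The inequality `(1 + 2^{r+3}) 2^{-2rn} n < γ δ / (2 k ρ)`. -/
def LevelCond (r γ δ ρ : ℝ) (n k : ℕ) : Prop :=
  (1 + (2 : ℝ) ^ (r + 3)) * (2 : ℝ) ^ (-(2 * r * n)) * n < γ * δ / (2 * k * ρ)

/-- The number `K_n` of iterations permitted at level `n`: the maximal integer `k ≥ 1` that
satisfies `LevelCond`, and `0` (an empty loop) if there is none. -/
def maxIter (r γ δ ρ : ℝ) (n : ℕ) : ℕ := sSup {k : ℕ | 1 ≤ k ∧ LevelCond r γ δ ρ n k}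

/-- The `k`-th iterate `x_{n,k}^δ` at discretization level `n`, computed from the data `fδ`. -/
def approx (e : HilbertBasis ℕ 𝕜 X) (w : ℝ → ℝ) (P : ℕ → ℝ[X]) (A : X →L[𝕜] X) (fδ : X)
    (n k : ℕ) : X :=
  iter w P (cross e A n) fδ k

/-- The discrepancy `‖A_n x_{n,k}^δ - P_{2^{2n}} fδ‖`. -/
def discrepancy (e : HilbertBasis ℕ 𝕜 X) (w : ℝ → ℝ) (P : ℕ → ℝ[X]) (A : X →L[𝕜] X) (fδ : X)
    (n k : ℕ) : ℝ :=
  ‖cross e A n (approx e w P A fδ n k) - proj e (2 ^ (2 * n)) fδ‖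

/-- The levels at which the algorithm may be started. -/
def IsStartLevel (r γ δ ρ : ℝ) (n₀ : ℕ) : Prop := 1 ≤ n₀ ∧ LevelCond r γ δ ρ n₀ 1

/-- The algorithm, started at level `n₀`, stops at level `n` with stopping index `K`: no iterate
computed at an earlier level has passed the discrepancy test, and `K` is the first index in
`{1, …, K_n}` that passes it at level `n`. -/
structure StopsAt (e : HilbertBasis ℕ 𝕜 X) (r : ℝ) (w : ℝ → ℝ) (P : ℕ → ℝ[X]) (A : X →L[𝕜] X)
    (ρ γ τ δ : ℝ) (fδ : X) (n₀ n K : ℕ) : Prop where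
  le_level : n₀ ≤ n
  earlier_levels : ∀ m : ℕ, n₀ ≤ m → m < n → ∀ j : ℕ, 1 ≤ j → j ≤ maxIter r γ δ ρ m →
    τ * δ < discrepancy e w P A fδ m j
  one_le : 1 ≤ K
  le_maxIter : K ≤ maxIter r γ δ ρ n
  earlier_iterates : ∀ j : ℕ, 1 ≤ j → j < K → τ * δ < discrepancy e w P A fδ n j
  test : discrepancy e w P A fδ n K ≤ τ * δ

end Hilbert

/-! ### The constants -/

/-- The lower bound `κ_0 (1 + √(1/2 + κ_2/κ_0) γ)` for the control parameter `τ`. -/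
def tauMin (κ : ℝ → ℝ) (γ : ℝ) : ℝ := κ 0 * (1 + √(1 / 2 + κ 2 / κ 0) * γ)

/-- `c_1`, at the final discretization level `n`. -/
def c₁ (κ : ℝ → ℝ) (γ : ℝ) (n : ℕ) : ℝ :=
  κ 0 + 2 + (√(κ 0 * (κ 0 / 2 + κ 2)) + 1 / (2 * n)) * γ

/-- `c_2`. -/
def c₂ (κ : ℝ → ℝ) (γ τ μ : ℝ) : ℝ :=
  max ((κ (μ + 1) / (τ - tauMin κ γ)) ^ (1 / (μ + 1))) 1

/-- The constant `C` of the error estimate, at the final discretization level `n`. -/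
def errConst (κ : ℝ → ℝ) (γ τ μ : ℝ) (n : ℕ) : ℝ :=
  κ 0 ^ (1 / (μ + 1)) * (τ + c₁ κ γ n) ^ (μ / (μ + 1)) + 2 * κ 0 * (1 + γ) * c₂ κ γ τ μ

end AdaptiveCross

end

/-! Write B for `cross e A n`, Q for `proj e (2 ^ (2 * n))`, η for `crossErr r n` and g = γδ/(2ρ);
an iteration index k is permitted exactly when kη < g. The k-th iterate is g_k(B*B)B*fδ with t
g_k(t) = 1 - r_k(t), so the discrepancy equals ‖r_k(BB*)Q fδ‖ (`iter_eq`,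
`Approximates.norm_residual_eq`).

For A and exact data, the eigenvector expansion behind the source condition gives two facts
(`sourceSet_bounds`): ‖r_k(AA*)Ax‖ decays like k^(-(μ+1)), and Hölder's inequality bounds
‖r_k(A*A)x‖ by the power μ/(μ+1) of that residual. If the discrepancy and the exact residual differ
by at most τ₀δ plus a small tail, then passing the test makes the exact residual O(δ), while failure
at K - 1 gives K = O((ρ/δ)^(1/(μ+1))), which controls the propagated error of order Kδ. Both
together give the optimal order, and the failure bound also gives termination.

The comparison rests on three ideas. The quadratic forms of A and B differ only by O(η), since in
each dyadic row the size of the row multiplies the size of its truncated part (`Decay.cross_form`).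
A Markov inequality for operators, obtained from Schur's inequality used twice, bounds p(S) - p(T)
by n²‖S - T‖ (`norm_opEval_sub_le`). Applied to A x instead of an arbitrary vector, the factor k²
drops to k by a geometric mean with the estimate for t r_k(t), where qualification two compensates
the degree; the total is then of order kη < g, hence O(γδ)
(`Approximates.norm_opEval_sub_apply_sq_le`).

The last obstacle is that the spectrum of BB* may exceed 1, where r_k is not controlled by the
qualification. Chebyshev growth costs a factor depending on k²η < kg, so kg must stay bounded. This
follows from the failed tests: they forbid an interval of values of (k+1)g, which the steps of the
iteration are too short to jump over (`Approximates.mul_le_of_forall_threshold_lt`). The growth that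
remains is absorbed by the threshold τ₀δ (`Approximates.exists_bound`). -/

noncomputable section

namespace AdaptiveCross

/-! ### Schur's inequality and the growth of bounded polynomials -/

/-- The zeros of the Chebyshev polynomial `T_n`. -/
def chebZero (n i : ℕ) : ℝ := Real.cos ((2 * i + 1) * Real.pi / (2 * n))

lemma chebZero_angle_mem {n i : ℕ} (hi : i < n) :
    (2 * i + 1) * Real.pi / (2 * n) ∈ Set.Ioo 0 Real.pi := by
  have hn : (0 : ℝ) < n := by exact_mod_cast (Nat.zero_le i).trans_lt hi
  have h : (i : ℝ) + 1 ≤ n := by exact_mod_cast hi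
  refine ⟨by positivity, ?_⟩
  rw [div_lt_iff₀ (by positivity)]
  nlinarith [Real.pi_pos]

lemma chebZero_lt {n i j : ℕ} (hij : i < j) (hj : j < n) : chebZero n j < chebZero n i := by
  have hn : (0 : ℝ) < n := by exact_mod_cast (Nat.zero_le j).trans_lt hj
  have h : (i : ℝ) < j := by exact_mod_cast hij
  refine Real.strictAntiOn_cos (Set.Ioo_subset_Icc_self (chebZero_angle_mem (hij.trans hj)))
    (Set.Ioo_subset_Icc_self (chebZero_angle_mem hj)) ?_
  have := Real.pi_pos
  gcongr

lemma chebZero_injOn (n : ℕ) : Set.InjOn (chebZero n) (Finset.range n : Set ℕ) := by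
  intro i hi j hj h
  simp only [Finset.coe_range, Set.mem_Iio] at hi hj
  rcases lt_trichotomy i j with h1 | h1 | h1
  · exact absurd h (chebZero_lt h1 hj).ne'
  · exact h1
  · exact absurd h (chebZero_lt h1 hi).ne

lemma chebU_chebZero {n i : ℕ} (hi : i < n) :
    (-1) ^ i * (Chebyshev.U ℝ ((n : ℤ) - 1)).eval (chebZero n i) *
      Real.sin ((2 * i + 1) * Real.pi / (2 * n)) = 1 := by
  have hn : (n : ℝ) ≠ 0 := by
    exact_mod_cast ((Nat.zero_le i).trans_lt hi).ne'
  rw [mul_assoc, chebZero, Chebyshev.U_real_cos]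
  have : ((((n : ℤ) - 1 : ℤ) : ℝ) + 1) * ((2 * i + 1) * Real.pi / (2 * n))
      = Real.pi / 2 + i * Real.pi := by
    push_cast; field_simp; ring
  rw [this, Real.sin_add_nat_mul_pi, Real.sin_pi_div_two, mul_one, ← mul_pow]
  simp

lemma abs_chebU_le {n : ℕ} (hn : 1 ≤ n) {x : ℝ} (hx : |x| ≤ 1) :
    |(Chebyshev.U ℝ ((n : ℤ) - 1)).eval x| ≤ n := by
  have h := Chebyshev.abs_iterate_derivative_T_real_le (n : ℤ) 1 hx
  have hn' : (0 : ℝ) < n := by exact_mod_cast hn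
  simp only [Function.iterate_one, Chebyshev.T_derivative_eq_U, Polynomial.eval_mul,
    Chebyshev.U_eval_one] at h
  simp only [Int.cast_natCast, eval_natCast, abs_mul, Nat.abs_cast, Int.cast_sub,
    Int.cast_one] at h
  have h2 := le_of_mul_le_mul_left h hn'
  simpa [abs_of_pos hn'] using h2

lemma eval_lagrangeBasis {n i : ℕ} (x : ℝ) :
    (Lagrange.basis (Finset.range n) (chebZero n) i).eval x
      = ∏ j ∈ (Finset.range n).erase i,
          ((x - chebZero n j) / (chebZero n i - chebZero n j)) := by
  rw [Lagrange.basis, eval_prod]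
  refine Finset.prod_congr rfl fun j _ => ?_
  simp [Lagrange.basisDivisor, div_eq_inv_mul]

lemma lagrangeBasis_sign {n i : ℕ} (hi : i < n) {x : ℝ} (hx : chebZero n 0 ≤ x) :
    0 ≤ (-1) ^ i * (Lagrange.basis (Finset.range n) (chebZero n) i).eval x := by
  rw [eval_lagrangeBasis]
  have hle : ∀ j < n, chebZero n j ≤ x := fun j hj => by
    rcases Nat.eq_zero_or_pos j with h | h
    · rw [h]; exact hx
    · exact (chebZero_lt h hj).le.trans hx
  have union : (Finset.range n).erase i = (Finset.range i) ∪ Finset.Ioo i n := by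
    ext j; simp only [Finset.mem_erase, Finset.mem_range, Finset.mem_union, Finset.mem_Ioo]; omega
  have disj : Disjoint (Finset.range i) (Finset.Ioo i n) := by
    rw [Finset.disjoint_left]; intro j; simp only [Finset.mem_range, Finset.mem_Ioo]; omega
  rw [union, Finset.prod_union disj, ← mul_assoc]
  refine mul_nonneg ?_ (Finset.prod_nonneg fun j hj => ?_)
  · have : (-1 : ℝ) ^ i * ∏ j ∈ Finset.range i, ((x - chebZero n j) /
        (chebZero n i - chebZero n j)) =
        ∏ j ∈ Finset.range i, ((x - chebZero n j) / (chebZero n j - chebZero n i)) := by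
      rw [show (-1 : ℝ) ^ i = ∏ _j ∈ Finset.range i, (-1 : ℝ) by simp, ← Finset.prod_mul_distrib]
      refine Finset.prod_congr rfl fun j _ => ?_
      rw [← neg_sub (chebZero n i) (chebZero n j), div_neg, neg_one_mul]
    rw [this]
    refine Finset.prod_nonneg fun j hj => ?_
    rw [Finset.mem_range] at hj
    exact div_nonneg (sub_nonneg.2 (hle j (hj.trans hi))) (sub_nonneg.2 (chebZero_lt hj hi).le)
  · rw [Finset.mem_Ioo] at hj
    exact div_nonneg (sub_nonneg.2 (hle j hj.2)) (sub_nonneg.2 (chebZero_lt hj.1 hj.2).le)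

/-- Interpolate at the zeros of T_n. To the right of the largest zero the Lagrange basis polynomials
alternate in sign exactly as the values of U_{n-1} at the nodes do. Since M times the modulus of
such a value is the bound for q at the node, the estimates add up without cancellation to M
U_{n-1}(x), and U_{n-1} is at most n. -/
lemma schur_near_one {n : ℕ} (hn : 1 ≤ n) {q : ℝ[X]} (hq : q.degree < n) {M : ℝ}
    (hM : ∀ θ : ℝ, |Real.sin θ * q.eval (Real.cos θ)| ≤ M) {x : ℝ}
    (hx : chebZero n 0 ≤ x) (hx1 : |x| ≤ 1) : |q.eval x| ≤ n * M := by
  have hM0 : 0 ≤ M := (abs_nonneg _).trans (hM 0)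
  have interp : ∀ p : ℝ[X], p.degree < n → p.eval x = ∑ i ∈ Finset.range n,
      p.eval (chebZero n i) * (Lagrange.basis (Finset.range n) (chebZero n) i).eval x := by
    intro p hp
    have h := Lagrange.eq_interpolate (chebZero_injOn n) (f := p) (by simpa using hp)
    conv_lhs => rw [h]
    rw [Lagrange.interpolate_apply, eval_finsetSum]
    simp
  have hU : (Chebyshev.U ℝ ((n : ℤ) - 1)).degree < n := by
    have : ((n : ℤ) - 1) = ((n - 1 : ℕ) : ℤ) := by omega
    rw [this, Chebyshev.degree_U_natCast]
    exact_mod_cast Nat.sub_lt hn one_pos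
  calc |q.eval x| ≤ ∑ i ∈ Finset.range n, |q.eval (chebZero n i) *
        (Lagrange.basis (Finset.range n) (chebZero n) i).eval x| := by
        rw [interp q hq]; exact Finset.abs_sum_le_sum_abs _ _
    _ ≤ ∑ i ∈ Finset.range n, M * ((Chebyshev.U ℝ ((n : ℤ) - 1)).eval (chebZero n i) *
        (Lagrange.basis (Finset.range n) (chebZero n) i).eval x) := by
        refine Finset.sum_le_sum fun i hi => ?_
        rw [Finset.mem_range] at hi
        have hs := lagrangeBasis_sign hi hx
        set b := (Lagrange.basis (Finset.range n) (chebZero n) i).eval x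
        have hu := chebU_chebZero hi
        set u := (Chebyshev.U ℝ ((n : ℤ) - 1)).eval (chebZero n i)
        set σ := Real.sin ((2 * i + 1) * Real.pi / (2 * n))
        have hσ : 0 < σ := Real.sin_pos_of_mem_Ioo (chebZero_angle_mem hi)
        have h1 : σ * |q.eval (chebZero n i)| ≤ M := by
          have := hM ((2 * i + 1) * Real.pi / (2 * n))
          rwa [abs_mul, abs_of_pos hσ] at this
        have hpm : ((-1 : ℝ) ^ i) * (-1) ^ i = 1 := by rw [← mul_pow]; simp
        have hb : |b| = (-1) ^ i * b := by
          rw [← abs_of_nonneg hs, abs_mul, abs_neg_one_pow, one_mul]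
        rw [abs_mul, hb]
        have hu' : (-1) ^ i * u = 1 / σ := by field_simp; linarith
        have h2 : |q.eval (chebZero n i)| ≤ M * ((-1) ^ i * u) := by
          rw [hu', mul_one_div, le_div_iff₀ hσ]; linarith
        calc _ ≤ M * ((-1) ^ i * u) * ((-1) ^ i * b) := mul_le_mul_of_nonneg_right h2 hs
          _ = M * (u * b) * ((-1) ^ i * (-1) ^ i) := by ring
          _ = _ := by rw [hpm, mul_one]
    _ = M * (Chebyshev.U ℝ ((n : ℤ) - 1)).eval x := by
        rw [interp _ hU, Finset.mul_sum]
    _ ≤ M * n := mul_le_mul_of_nonneg_left ((le_abs_self _).trans (abs_chebU_le hn hx1)) hM0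
    _ = n * M := mul_comm _ _

/-- Schur's inequality. -/
theorem schur_inequality {n : ℕ} (hn : 1 ≤ n) {q : ℝ[X]} (hq : q.degree < n) {M : ℝ}
    (hM : ∀ θ : ℝ, |Real.sin θ * q.eval (Real.cos θ)| ≤ M) {x : ℝ} (hx : |x| ≤ 1) :
    |q.eval x| ≤ n * M := by
  have hn' : (0 : ℝ) < n := by exact_mod_cast hn
  by_cases h1 : chebZero n 0 ≤ x
  · exact schur_near_one hn hq hM h1 hx
  by_cases h2 : chebZero n 0 ≤ -x
  · have := schur_near_one (q := q.comp (-X)) (M := M) (x := -x) hn ?_ ?_ h2 (by rwa [abs_neg])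
    · simpa using this
    · rcases eq_or_ne q 0 with rfl | h0
      · simp
      · have hd : (q.comp (-X)).natDegree ≤ q.natDegree := by
          refine natDegree_comp_le.trans ?_
          simp
        refine (degree_le_of_natDegree_le hd).trans_lt ?_
        rwa [← degree_eq_natDegree h0]
    · intro θ
      have := hM (Real.pi - θ)
      simpa [Real.cos_pi_sub] using this
  -- Between the extreme zeros the weight √(1 - x²) is at least sin(π/(2n)), which is at least 1/n
  -- by Jordan's inequality.
  · push Not at h1 h2
    have hb := abs_le.1 hx
    have h3 := hM (Real.arccos x)
    rw [Real.cos_arccos hb.1 hb.2, abs_mul, Real.sin_arccos,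
      abs_of_nonneg (Real.sqrt_nonneg _)] at h3
    have hα := chebZero_angle_mem (show 0 < n by omega)
    have hα2 : (2 * (0 : ℕ) + 1) * Real.pi / (2 * n) ≤ Real.pi / 2 := by
      rw [div_le_div_iff₀ (by positivity) (by positivity)]
      have : (1 : ℝ) ≤ n := by exact_mod_cast hn
      push_cast
      nlinarith [Real.pi_pos]
    have hj := Real.mul_le_sin hα.1.le hα2
    have hj' : 1 / (n : ℝ) ≤ Real.sin ((2 * (0 : ℕ) + 1) * Real.pi / (2 * n)) := by
      refine le_trans (le_of_eq ?_) hj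
      have := Real.pi_pos
      field_simp
      push_cast; ring
    have hs : 1 / (n : ℝ) ≤ √(1 - x ^ 2) := by
      refine hj'.trans (Real.le_sqrt_of_sq_le ?_)
      have h4 : x ^ 2 ≤ chebZero n 0 ^ 2 := by
        rw [sq_le_sq]
        exact (abs_le.2 ⟨by linarith, h1.le⟩).trans (le_abs_self _)
      rw [Real.sin_sq]
      simp only [chebZero] at h4
      linarith
    have h5 : 1 / (n : ℝ) * |q.eval x| ≤ M :=
      (mul_le_mul_of_nonneg_right hs (abs_nonneg _)).trans h3
    rw [one_div, inv_mul_le_iff₀ hn'] at h5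
    exact h5

/-- The bound `1 + z / 2 + z ^ 2 / 20` for `cosh √z`. -/
def growth (z : ℝ) : ℝ := 1 + z / 2 + z ^ 2 / 20

lemma growth_mono {z z' : ℝ} (hz : 0 ≤ z) (h : z ≤ z') : growth z ≤ growth z' := by
  unfold growth; nlinarith

lemma one_le_growth {z : ℝ} (hz : 0 ≤ z) : 1 ≤ growth z := by
  unfold growth; nlinarith

lemma cosh_le_growth {w : ℝ} (hw : w ^ 2 ≤ 16 / 5) : Real.cosh w ≤ growth (w ^ 2) := by
  set z := w ^ 2 with hz
  have hz0 : 0 ≤ z := sq_nonneg w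
  have h1 := Real.hasSum_cosh w
  have h2 := (hasSum_nat_add_iff' 2).2 h1
  have hr : z / 30 < 1 := by linarith
  -- From the term z²/24 on, consecutive terms of the cosh series have ratio at most z/(6·5). The
  -- geometric majorant has sum at most z²/20 as long as z ≤ 5.
  have h3 := (hasSum_geometric_of_lt_one (by positivity) hr).mul_left (z ^ 2 / 24)
  have h4 := hasSum_le (fun n => ?_) h2 h3
  · simp only [Finset.sum_range_succ, Finset.sum_range_zero, mul_zero, pow_zero, Nat.factorial,
      Nat.cast_one, mul_one] at h4
    norm_num [Nat.factorial] at h4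
    have h5 : z ^ 2 / 24 * (1 - z / 30)⁻¹ ≤ z ^ 2 / 20 := by
      rw [← div_eq_mul_inv, div_le_iff₀ (by linarith)]
      nlinarith [sq_nonneg z]
    unfold growth
    rw [← hz] at h4
    linarith
  · induction n with
    | zero =>
      norm_num [Nat.factorial]
      rw [hz]; apply le_of_eq; ring
    | succ k ih =>
      have hfac : ((2 * (k + 1 + 2)).factorial : ℝ)
          = (2 * k + 6) * (2 * k + 5) * ((2 * (k + 2)).factorial : ℝ) := by
        rw [show 2 * (k + 1 + 2) = (2 * (k + 2)) + 1 + 1 by ring, Nat.factorial_succ,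
          Nat.factorial_succ]
        push_cast; ring
      have hp : (0 : ℝ) < ((2 * (k + 2)).factorial : ℝ) := by positivity
      have : w ^ (2 * (k + 1 + 2)) / ((2 * (k + 1 + 2)).factorial : ℝ)
          = w ^ (2 * (k + 2)) / ((2 * (k + 2)).factorial : ℝ)
            * (z / ((2 * k + 6) * (2 * k + 5))) := by
        rw [hfac, hz]; field_simp; ring
      rw [this, pow_succ (z / 30), ← mul_assoc]
      refine mul_le_mul ih ?_ (by positivity) (by positivity)
      have : (0 : ℝ) ≤ k := by positivity
      gcongr
      nlinarith

/-- A polynomial of degree at most `m` bounded by `M` on `[0, 1]` exceeds this bound on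
`[0, 1 + s]` at most by the factor `growth z`, if `4 m² s ≤ z`. -/
theorem abs_eval_le_growth {m : ℕ} {p : ℝ[X]} (hp : p.natDegree ≤ m) {M s z : ℝ}
    (hM : ∀ t ∈ Set.Icc (0 : ℝ) 1, |p.eval t| ≤ M)
    (hz : 4 * m ^ 2 * s ≤ z) (hz' : z ≤ 16 / 5) {t : ℝ} (ht0 : 0 ≤ t) (ht : t ≤ 1 + s)
    (hz0 : 0 ≤ z) : |p.eval t| ≤ M * growth z := by
  have hM0 : 0 ≤ M := (abs_nonneg _).trans (hM 0 (by simp))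
  rcases le_total t 1 with h1 | h1
  · refine (hM t ⟨ht0, h1⟩).trans ?_
    nlinarith [one_le_growth hz0]
  have hs : 0 ≤ s := by linarith
  -- The extremal property of the Chebyshev polynomials is applied to p / M, so M = 0 is treated
  -- apart; then p vanishes identically.
  rcases hM0.eq_or_lt with h0 | hMpos
  · have hpz : p = 0 := by
      refine Polynomial.eq_zero_of_infinite_isRoot p ((Set.Icc_infinite zero_lt_one).mono ?_)
      intro x hx
      have := hM x hx
      rw [← h0] at this
      exact abs_nonpos_iff.1 this
    simp [hpz, ← h0]
  -- With sinh² y = t - 1 one has 2t - 1 = cosh 2y, so T_m(2t - 1) = cosh(2my), and y ≤ sinh y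
  -- yields (2my)² ≤ 4m²s ≤ z.
  set y := Real.arsinh (√(t - 1)) with hy
  have hy0 : 0 ≤ y := Real.arsinh_nonneg_iff.2 (Real.sqrt_nonneg _)
  have hcosh : Real.cosh (2 * y) = 2 * t - 1 := by
    rw [Real.cosh_two_mul, Real.cosh_sq, hy, Real.sinh_arsinh, Real.sq_sqrt (by linarith)]
    ring
  have hyle : y ^ 2 ≤ t - 1 := by
    have h2 : y ≤ √(t - 1) := by
      calc y ≤ Real.sinh y := Real.self_le_sinh_iff.2 hy0
        _ = _ := by rw [hy, Real.sinh_arsinh]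
    calc y ^ 2 ≤ √(t - 1) ^ 2 := by gcongr
      _ = _ := Real.sq_sqrt (by linarith)
  have key : ∀ ε : ℝ, |ε| = 1 → ε * p.eval t ≤ M * Real.cosh ((m : ℤ) * (2 * y)) := by
    intro ε hε
    set P : ℝ[X] := C (ε / M) * p.comp (C (1 / 2) * X + C (1 / 2)) with hP
    have hdeg : P.degree ≤ m := by
      refine degree_le_of_natDegree_le ?_
      refine (natDegree_C_mul_le _ _).trans (natDegree_comp_le.trans ?_)
      calc _ ≤ p.natDegree * 1 := Nat.mul_le_mul_left _ natDegree_linear_le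
        _ ≤ m := by simpa using hp
    have hb : ∀ x ∈ Set.Icc (-1 : ℝ) 1, |P.eval x| ≤ 1 := by
      intro x hx
      simp only [hP, eval_mul, eval_C, eval_comp, eval_add, eval_X, abs_mul, abs_div, hε,
        abs_of_pos hMpos]
      rw [one_div_mul_eq_div, div_le_one hMpos]
      exact hM _ ⟨by linarith [hx.1], by linarith [hx.2]⟩
    have hx : (1 : ℝ) ≤ 2 * t - 1 := by linarith
    have h := Chebyshev.eval_iterate_derivative_le_of_forall_abs_le_one (k := 0) hx hdeg hb
    simp only [Function.iterate_zero, id_eq, hP, eval_mul, eval_C, eval_comp, eval_add,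
      eval_X] at h
    rw [← hcosh, Chebyshev.T_real_cosh, hcosh] at h
    rw [show 1 / 2 * (2 * t - 1) + 1 / 2 = t by ring, div_mul_eq_mul_div,
      div_le_iff₀ hMpos] at h
    linarith
  have hw : (((m : ℤ) : ℝ) * (2 * y)) ^ 2 ≤ z := by
    push_cast
    calc ((m : ℝ) * (2 * y)) ^ 2 = 4 * m ^ 2 * y ^ 2 := by ring
      _ ≤ 4 * m ^ 2 * s := by gcongr; linarith
      _ ≤ z := hz
  have hc : Real.cosh ((m : ℤ) * (2 * y)) ≤ growth z :=
    (cosh_le_growth (hw.trans hz')).trans (growth_mono (sq_nonneg _) hw)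
  rw [abs_le]
  have k1 := key 1 (by simp)
  have k2 := key (-1) (by simp)
  have := mul_le_mul_of_nonneg_left hc hM0
  constructor <;> linarith

section Operators

variable {𝕜 : Type*} [RCLike 𝕜] {X : Type*} [NormedAddCommGroup X] [InnerProductSpace 𝕜 X]

/-! ### Real polynomials of operators -/

/-- The evaluation of real polynomials at an operator. -/
def opEval (T : X →L[𝕜] X) : ℝ[X] →+* (X →L[𝕜] X) :=
  (aeval T : 𝕜[X] →ₐ[𝕜] (X →L[𝕜] X)).toRingHom.comp (mapRingHom (algebraMap ℝ 𝕜))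

lemma opEval_C (T : X →L[𝕜] X) (c : ℝ) : opEval T (C c) = (c : 𝕜) • (1 : X →L[𝕜] X) := by
  simp [opEval, Algebra.algebraMap_eq_smul_one]

lemma opEval_X (T : X →L[𝕜] X) : opEval T Polynomial.X = T := by simp [opEval]

lemma opEval_eq_sum (T : X →L[𝕜] X) (p : ℝ[X]) {n : ℕ} (hn : p.natDegree < n) (u : X) :
    opEval T p u = ∑ i ∈ Finset.range n, (p.coeff i : 𝕜) • (T ^ i) u := by
  conv_lhs => rw [p.as_sum_range' n hn]
  rw [map_sum, sum_apply]
  refine Finset.sum_congr rfl fun i _ => ?_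
  rw [← C_mul_X_pow_eq_monomial, map_mul, map_pow, opEval_C, opEval_X]
  simp

/-- `opEval` respects intertwining relations. -/
lemma comp_opEval {Y S T : X →L[𝕜] X} (h : Y * S = T * Y) (p : ℝ[X]) :
    Y * opEval S p = opEval T p * Y := by
  induction p using Polynomial.induction_on' with
  | add p q hp hq => simp only [map_add, mul_add, add_mul, hp, hq]
  | monomial n c =>
    have hpow : Y * S ^ n = T ^ n * Y := by
      induction n with
      | zero => simp
      | succ k ih => rw [pow_succ, ← mul_assoc, ih, mul_assoc, h, ← mul_assoc, ← pow_succ]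
    rw [← C_mul_X_pow_eq_monomial]
    simp only [map_mul, map_pow, opEval_C, opEval_X, smul_mul_assoc, one_mul, mul_smul_comm, hpow]

lemma continuous_opEval (p : ℝ[X]) : Continuous fun T : X →L[𝕜] X => opEval T p := by
  simp only [opEval, RingHom.coe_comp, Function.comp]
  exact Polynomial.continuous_aeval _

/-- `T` is symmetric and its numerical range is contained in `[a, b]`. -/
def FormIn (T : X →L[𝕜] X) (a b : ℝ) : Prop :=
  (∀ u v, inner 𝕜 (T u) v = inner 𝕜 u (T v)) ∧
    ∀ u, a * ‖u‖ ^ 2 ≤ RCLike.re (inner 𝕜 (T u) u) ∧ RCLike.re (inner 𝕜 (T u) u) ≤ b * ‖u‖ ^ 2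

lemma inner_opEval_left {T : X →L[𝕜] X} (hT : ∀ u v, inner 𝕜 (T u) v = inner 𝕜 u (T v))
    (p : ℝ[X]) (u v : X) : inner 𝕜 (opEval T p u) v = inner 𝕜 u (opEval T p v) := by
  have hpow : ∀ i u v, inner 𝕜 ((T ^ i) u) v = inner 𝕜 u ((T ^ i) v) := by
    intro i
    induction i with
    | zero => intro u v; simp
    | succ k ih =>
      intro u v
      rw [pow_succ, mul_apply_eq_comp, ih, hT, ← mul_apply_eq_comp,
        ← pow_succ', pow_succ]
  rw [opEval_eq_sum T p (Nat.lt_succ_self _), opEval_eq_sum T p (Nat.lt_succ_self _),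
    sum_inner, inner_sum]
  refine Finset.sum_congr rfl fun i _ => ?_
  rw [inner_smul_left, inner_smul_right, hpow, RCLike.conj_ofReal]

lemma norm_aeval_le_of_finiteDimensional {V : Type*} [NormedAddCommGroup V]
    [InnerProductSpace 𝕜 V] [FiniteDimensional 𝕜 V] {Y : V →ₗ[𝕜] V} (hY : Y.IsSymmetric)
    {a b M : ℝ} (hab : ∀ u, a * ‖u‖ ^ 2 ≤ RCLike.re (inner 𝕜 (Y u) u) ∧
      RCLike.re (inner 𝕜 (Y u) u) ≤ b * ‖u‖ ^ 2)
    {p : ℝ[X]} (hM : ∀ t ∈ Set.Icc a b, |p.eval t| ≤ M) (u : V) :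
    ‖aeval Y (p.map (algebraMap ℝ 𝕜)) u‖ ≤ M * ‖u‖ := by
  set β := hY.eigenvectorBasis rfl
  set ev := hY.eigenvalues rfl
  have hev : ∀ i, ev i ∈ Set.Icc a b := by
    intro i
    have h := hab (β i)
    rw [hY.apply_eigenvectorBasis rfl i, inner_smul_left, inner_self_eq_norm_sq_to_K,
      β.norm_eq_one] at h
    simpa using h
  set L := aeval Y (p.map (algebraMap ℝ 𝕜))
  have hL : ∀ i, L (β i) = ((p.eval (ev i) : ℝ) : 𝕜) • β i := by
    intro i
    have h := Module.End.aeval_apply_of_hasEigenvector (p := p.map (algebraMap ℝ 𝕜))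
      (hY.hasEigenvector_eigenvectorBasis rfl i)
    rw [h]
    congr 1
    rw [← RCLike.algebraMap_eq_ofReal, eval_map_apply]
  have hrep : ∀ i, inner 𝕜 (β i) (L u) = ((p.eval (ev i) : ℝ) : 𝕜) * inner 𝕜 (β i) u := by
    intro i
    conv_lhs => rw [← β.sum_repr' u, map_sum, inner_sum]
    simp only [map_smul, hL, inner_smul_right]
    rw [Finset.sum_eq_single i]
    · rw [inner_self_eq_norm_sq_to_K, β.norm_eq_one]; simp [mul_comm]
    · intro j _ hj
      rw [β.orthonormal.2 hj.symm]; simp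
    · simp
  by_cases hM0 : 0 ≤ M
  · refine le_of_sq_le_sq ?_ (by positivity)
    rw [mul_pow, ← β.sum_sq_norm_inner_right (L u), ← β.sum_sq_norm_inner_right u, Finset.mul_sum]
    refine Finset.sum_le_sum fun i _ => ?_
    rw [hrep, norm_mul, mul_pow, RCLike.norm_ofReal]
    gcongr
    exact hM _ (hev i)
  -- A negative M is possible only if [a, b] is empty, and then the space is trivial.
  · have hu : u = 0 := by
      by_contra hu
      have h := hab u
      have hn : 0 < ‖u‖ ^ 2 := by positivity
      have : a ≤ b := le_of_mul_le_mul_right (h.1.trans h.2) hn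
      exact hM0 ((abs_nonneg _).trans (hM a ⟨le_rfl, this⟩))
    simp [hu]

/-- The norm of a polynomial of a symmetric operator is bounded by the supremum of the polynomial
on an interval containing the numerical range. -/
theorem norm_opEval_apply_le {T : X →L[𝕜] X} {a b M : ℝ} (hT : FormIn T a b)
    {p : ℝ[X]} (hM : ∀ t ∈ Set.Icc a b, |p.eval t| ≤ M) (u : X) :
    ‖opEval T p u‖ ≤ M * ‖u‖ := by
  set m := p.natDegree
  -- Compress T to the Krylov space of u. The compression keeps the bounds on the numerical range,
  -- and polynomials of degree at most m act on u as they do for T, so the finite-dimensional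
  -- spectral theorem suffices.
  set V : Submodule 𝕜 X := Submodule.span 𝕜
    ((fun i : ℕ => (T ^ i) u) '' Set.Iic m) with hV
  have hfin : FiniteDimensional 𝕜 V :=
    FiniteDimensional.span_of_finite 𝕜 ((Set.finite_Iic m).image _)
  have hmem : ∀ i ≤ m, (T ^ i) u ∈ V := fun i hi => Submodule.subset_span ⟨i, hi, rfl⟩
  set Y : V →ₗ[𝕜] V :=
    (V.orthogonalProjectionOnto : X →L[𝕜] V).toLinearMap ∘ₗ T.toLinearMap ∘ₗ V.subtype with hYd
  have hYin : ∀ x y : V, inner 𝕜 (Y x) y = inner 𝕜 (T x) (y : X) := by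
    intro x y
    simp only [hYd, LinearMap.comp_apply, Submodule.subtype_apply,
      ContinuousLinearMap.coe_coe]
    rw [Submodule.coe_inner, ← Submodule.starProjection_apply,
      Submodule.inner_starProjection_left_eq_right,
      Submodule.starProjection_eq_self_iff.2 y.2]
  have hsymm : Y.IsSymmetric := by
    intro x y
    rw [hYin, hT.1, ← inner_conj_symm, ← hYin, inner_conj_symm]
  set u₀ : V := ⟨u, by simpa using hmem 0 (Nat.zero_le _)⟩
  have hpow : ∀ i ≤ m, (((Y ^ i) u₀ : V) : X) = (T ^ i) u := by
    intro i
    induction i with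
    | zero => intro _; simp [u₀]
    | succ k ih =>
      intro hk
      rw [pow_succ', Module.End.mul_apply]
      simp only [hYd, LinearMap.comp_apply, Submodule.subtype_apply,
        ContinuousLinearMap.coe_coe]
      rw [← hYd, ih (by omega), ← mul_apply_eq_comp, ← pow_succ',
        ← Submodule.starProjection_apply, Submodule.starProjection_eq_self_iff.2 (hmem _ hk)]
  have hev : ((aeval Y (p.map (algebraMap ℝ 𝕜)) u₀ : V) : X) = opEval T p u := by
    rw [opEval_eq_sum T p (Nat.lt_succ_self _), aeval_eq_sum_range'
      (n := m + 1) (by rw [natDegree_map]; exact Nat.lt_succ_self _), LinearMap.sum_apply,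
      AddSubmonoidClass.coe_finsetSum]
    refine Finset.sum_congr rfl fun i hi => ?_
    rw [Finset.mem_range] at hi
    simp [hpow i (by omega)]
  rw [← hev]
  refine norm_aeval_le_of_finiteDimensional hsymm (a := a) (b := b) ?_ hM u₀
  intro x
  rw [hYin]
  exact hT.2 x

end Operators

section Markov

variable {𝕜 : Type*} [RCLike 𝕜] {X : Type*} [NormedAddCommGroup X] [InnerProductSpace 𝕜 X]

/-! ### Markov's inequality for operators -/

variable (𝕜) in
/-- `F` is a vector-valued polynomial function of degree less than `m`. -/
def VectorPoly (m : ℕ) (F : ℝ → X) : Prop :=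
  ∃ c : ℕ → X, ∀ x, F x = ∑ i ∈ Finset.range m, ((x ^ i : ℝ) : 𝕜) • c i

namespace VectorPoly

lemma zero (m : ℕ) : VectorPoly 𝕜 m (fun _ => (0 : X)) := ⟨0, by simp⟩

lemma const (v : X) : VectorPoly 𝕜 1 (fun _ => v) := ⟨fun _ => v, by simp⟩

lemma add {m : ℕ} {F G : ℝ → X} (hF : VectorPoly 𝕜 m F) (hG : VectorPoly 𝕜 m G) :
    VectorPoly 𝕜 m (fun x => F x + G x) := by
  obtain ⟨c, hc⟩ := hF
  obtain ⟨d, hd⟩ := hG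
  exact ⟨c + d, fun x => by
    beta_reduce
    rw [hc, hd, ← Finset.sum_add_distrib]
    exact Finset.sum_congr rfl fun i _ => (smul_add _ _ _).symm⟩

lemma map {m : ℕ} {F : ℝ → X} (hF : VectorPoly 𝕜 m F) (L : X →L[𝕜] X) :
    VectorPoly 𝕜 m (fun x => L (F x)) := by
  obtain ⟨c, hc⟩ := hF
  exact ⟨fun i => L (c i), fun x => by beta_reduce; rw [hc, map_sum]; simp⟩

lemma mul_X {m : ℕ} {F : ℝ → X} (hF : VectorPoly 𝕜 m F) :
    VectorPoly 𝕜 (m + 1) (fun x => (x : 𝕜) • F x) := by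
  obtain ⟨c, hc⟩ := hF
  refine ⟨fun i => if i = 0 then 0 else c (i - 1), fun x => ?_⟩
  beta_reduce
  rw [hc, Finset.sum_range_succ', Finset.smul_sum]
  simp only [Nat.add_eq_zero_iff, one_ne_zero, and_false, if_false, Nat.add_sub_cancel,
    if_true, smul_zero, add_zero]
  refine Finset.sum_congr rfl fun i _ => ?_
  rw [smul_smul]; congr 1; push_cast; ring

lemma mono {m m' : ℕ} (h : m ≤ m') {F : ℝ → X} (hF : VectorPoly 𝕜 m F) : VectorPoly 𝕜 m' F := by
  obtain ⟨c, hc⟩ := hF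
  refine ⟨fun i => if i < m then c i else 0, fun x => ?_⟩
  rw [hc, ← Finset.sum_subset (Finset.range_mono h)]
  · exact Finset.sum_congr rfl fun i hi => by beta_reduce; rw [if_pos (Finset.mem_range.1 hi)]
  · intro i _ hi
    beta_reduce
    rw [if_neg (by simpa using hi), smul_zero]

lemma sum {ι : Type*} (s : Finset ι) {m : ℕ} {F : ι → ℝ → X}
    (hF : ∀ i ∈ s, VectorPoly 𝕜 m (F i)) : VectorPoly 𝕜 m (fun x => ∑ i ∈ s, F i x) := by
  classical
  induction s using Finset.induction_on with
  | empty => simpa using zero m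
  | insert a s ha ih =>
    simp only [Finset.sum_insert ha]
    exact (hF a (by simp)).add (ih fun i hi => hF i (by simp [hi]))

lemma neg_sq_mul {m : ℕ} {F : ℝ → X} (hF : VectorPoly 𝕜 m F) :
    VectorPoly 𝕜 (m + 2) (fun x => ((1 - x ^ 2 : ℝ) : 𝕜) • F x) := by
  have h := (hF.mono (Nat.le_add_right m 2)).add
    ((hF.mul_X.mul_X).map (-1 : X →L[𝕜] X))
  convert h using 2 with x
  simp only [neg_apply, one_apply_eq_self, smul_smul]
  rw [← neg_smul, ← one_smul 𝕜 (F x), smul_smul, smul_smul, ← add_smul]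
  congr 1; push_cast; ring

lemma exists_polynomial {m : ℕ} {F : ℝ → X} (hF : VectorPoly 𝕜 m F) (v : X) :
    ∃ q : ℝ[X], q.degree < m ∧ ∀ x, q.eval x = RCLike.re (inner 𝕜 v (F x)) := by
  obtain ⟨c, hc⟩ := hF
  refine ⟨∑ i ∈ Finset.range m, C (RCLike.re (inner 𝕜 v (c i))) * Polynomial.X ^ i, ?_, fun x => ?_⟩
  · rw [← mem_degreeLT]
    refine Submodule.sum_mem _ fun i hi => mem_degreeLT.2 ?_
    exact (degree_C_mul_X_pow_le _ _).trans_lt (by exact_mod_cast Finset.mem_range.1 hi)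
  · rw [hc, inner_sum, map_sum, eval_finsetSum]
    refine Finset.sum_congr rfl fun i _ => ?_
    rw [inner_smul_right, RCLike.re_ofReal_mul, eval_mul, eval_C, eval_pow, eval_X, mul_comm]

end VectorPoly

/-- The decomposition of `(x E + y F) ^ j` into an even and an odd part with respect to `y`, on
the circle `x ^ 2 + y ^ 2 = 1`. -/
lemma exists_even_odd_pow (E F : X →L[𝕜] X) (w : X) (j : ℕ) :
    ∃ α β : ℝ → X, VectorPoly 𝕜 (j + 1) α ∧ VectorPoly 𝕜 j β ∧ ∀ x y : ℝ, x ^ 2 + y ^ 2 = 1 →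
      (((x : 𝕜) • E + (y : 𝕜) • F) ^ j) w = α x + (y : 𝕜) • β x := by
  induction j with
  | zero => exact ⟨fun _ => w, fun _ => 0, VectorPoly.const w, VectorPoly.zero 0, by simp⟩
  | succ k ih =>
    obtain ⟨α, β, hα, hβ, h⟩ := ih
    refine ⟨fun x => (x : 𝕜) • E (α x) + ((1 - x ^ 2 : ℝ) : 𝕜) • F (β x),
      fun x => (x : 𝕜) • E (β x) + F (α x), ?_, ?_, ?_⟩
    · exact ((hα.map E).mul_X).add ((hβ.map F).neg_sq_mul)
    · exact ((hβ.map E).mul_X).add (hα.map F)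
    · intro x y hxy
      rw [pow_succ', mul_apply_eq_comp, h x y hxy]
      have : (1 - x ^ 2 : ℝ) = y * y := by linarith
      beta_reduce
      rw [this]
      simp only [add_apply, smul_apply, map_add, map_smul]
      push_cast
      module

lemma exists_even_odd_opEval (E F : X →L[𝕜] X) (w : X) {p : ℝ[X]} {n : ℕ} (hp : p.natDegree ≤ n) :
    ∃ α β : ℝ → X, VectorPoly 𝕜 n β ∧ ∀ x y : ℝ, x ^ 2 + y ^ 2 = 1 →
      opEval ((x : 𝕜) • E + (y : 𝕜) • F) p w = α x + (y : 𝕜) • β x := by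
  choose α β _ hβ h using exists_even_odd_pow E F w
  refine ⟨fun x => ∑ i ∈ Finset.range (n + 1), (p.coeff i : 𝕜) • α i x,
    fun x => ∑ i ∈ Finset.range (n + 1), (p.coeff i : 𝕜) • β i x, ?_, ?_⟩
  · refine VectorPoly.sum _ fun i hi => ?_
    have := ((hβ i).mono (Nat.lt_succ_iff.1 (Finset.mem_range.1 hi))).map
      ((p.coeff i : 𝕜) • (1 : X →L[𝕜] X))
    simpa using this
  · intro x y hxy
    rw [opEval_eq_sum _ p (Nat.lt_succ_of_le hp), Finset.smul_sum, ← Finset.sum_add_distrib]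
    refine Finset.sum_congr rfl fun i _ => ?_
    rw [h i x y hxy, smul_add, smul_comm]

/-- A bound for the odd part of `p (cos θ E + sin θ F)` that is uniform in `θ` improves by the
factor `n |sin θ|`. -/
lemma norm_odd_part_le (E F : X →L[𝕜] X) (w : X) {p : ℝ[X]} {n : ℕ} (hn : 1 ≤ n)
    (hp : p.natDegree ≤ n) {K : ℝ}
    (hK : ∀ θ : ℝ, ‖opEval ((Real.cos θ : 𝕜) • E + (Real.sin θ : 𝕜) • F) p w
      - opEval ((Real.cos θ : 𝕜) • E - (Real.sin θ : 𝕜) • F) p w‖ ≤ K) (θ : ℝ) :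
    ‖opEval ((Real.cos θ : 𝕜) • E + (Real.sin θ : 𝕜) • F) p w
      - opEval ((Real.cos θ : 𝕜) • E - (Real.sin θ : 𝕜) • F) p w‖ ≤ n * |Real.sin θ| * K := by
  obtain ⟨α, β, hβ, h⟩ := exists_even_odd_opEval E F w hp
  have hdiff : ∀ θ : ℝ, opEval ((Real.cos θ : 𝕜) • E + (Real.sin θ : 𝕜) • F) p w
      - opEval ((Real.cos θ : 𝕜) • E - (Real.sin θ : 𝕜) • F) p w
      = ((2 * Real.sin θ : ℝ) : 𝕜) • β (Real.cos θ) := by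
    intro θ
    have h2 := h (Real.cos θ) (-Real.sin θ) (by rw [neg_sq]; exact Real.cos_sq_add_sin_sq θ)
    rw [RCLike.ofReal_neg, neg_smul, ← sub_eq_add_neg] at h2
    rw [h _ _ (Real.cos_sq_add_sin_sq θ), h2]
    push_cast
    module
  rw [hdiff]
  -- Pairing the odd part with its own value at θ reduces the claim to Schur's inequality for one
  -- real polynomial of degree less than n.
  set v := β (Real.cos θ)
  obtain ⟨q, hq, hqe⟩ := hβ.exists_polynomial v
  have hM : ∀ φ : ℝ, |Real.sin φ * q.eval (Real.cos φ)| ≤ ‖v‖ * K / 2 := by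
    intro φ
    have h1 := hK φ
    rw [hdiff, norm_smul, RCLike.norm_ofReal, abs_mul, abs_two] at h1
    have h2 : |q.eval (Real.cos φ)| ≤ ‖v‖ * ‖β (Real.cos φ)‖ := by
      rw [hqe]
      exact (RCLike.abs_re_le_norm _).trans (norm_inner_le_norm _ _)
    rw [abs_mul]
    have h3 := mul_le_mul_of_nonneg_left h2 (abs_nonneg (Real.sin φ))
    have h4 := mul_le_mul_of_nonneg_left h1 (norm_nonneg v)
    linarith
  have h5 := schur_inequality hn hq hM (Real.abs_cos_le_one θ)
  have hself : RCLike.re (inner 𝕜 v v) = ‖v‖ ^ 2 := by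
    rw [inner_self_eq_norm_sq_to_K]; norm_cast
  rw [hqe, hself, abs_of_nonneg (sq_nonneg _)] at h5
  rw [norm_smul, RCLike.norm_ofReal, abs_mul, abs_two]
  rcases (norm_nonneg v).eq_or_lt with h0 | h0
  · rw [← h0, mul_zero]
    exact mul_nonneg (by positivity) ((norm_nonneg _).trans (hK θ))
  · have : ‖v‖ ≤ n * K / 2 := le_of_mul_le_mul_left (by linarith) h0
    nlinarith [mul_le_mul_of_nonneg_left this (abs_nonneg (Real.sin θ))]

namespace FormIn

lemma smul_add_smul {U V : X →L[𝕜] X} {α β x y c : ℝ} (hU : FormIn U (-α) α) (hV : FormIn V (-β) β)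
    (h : |x| * α + |y| * β ≤ c) : FormIn ((x : 𝕜) • U + (y : 𝕜) • V) (-c) c := by
  refine ⟨fun u v => ?_, fun u => ?_⟩
  · simp only [add_apply, smul_apply, inner_add_left, inner_add_right, inner_smul_left,
      inner_smul_right, hU.1, hV.1, RCLike.conj_ofReal]
  · simp only [add_apply, smul_apply, inner_add_left, inner_smul_left, RCLike.conj_ofReal,
      map_add, RCLike.re_ofReal_mul]
    rw [neg_mul, ← abs_le]
    have h1 : |RCLike.re (inner 𝕜 (U u) u)| ≤ α * ‖u‖ ^ 2 := by
      rw [abs_le, ← neg_mul]; exact hU.2 u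
    have h2 : |RCLike.re (inner 𝕜 (V u) u)| ≤ β * ‖u‖ ^ 2 := by
      rw [abs_le, ← neg_mul]; exact hV.2 u
    calc _ ≤ |x| * |RCLike.re (inner 𝕜 (U u) u)| + |y| * |RCLike.re (inner 𝕜 (V u) u)| := by
          rw [← abs_mul, ← abs_mul]; exact abs_add_le _ _
      _ ≤ |x| * (α * ‖u‖ ^ 2) + |y| * (β * ‖u‖ ^ 2) := by gcongr
      _ = (|x| * α + |y| * β) * ‖u‖ ^ 2 := by ring
      _ ≤ c * ‖u‖ ^ 2 := by gcongr

lemma mono {T : X →L[𝕜] X} {a b a' b' : ℝ} (hT : FormIn T a b) (ha : a' ≤ a) (hb : b ≤ b') :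
    FormIn T a' b' :=
  ⟨hT.1, fun u => ⟨(mul_le_mul_of_nonneg_right ha (sq_nonneg _)).trans (hT.2 u).1,
    (hT.2 u).2.trans (mul_le_mul_of_nonneg_right hb (sq_nonneg _))⟩⟩

lemma smul {T : X →L[𝕜] X} {c : ℝ} (hT : FormIn T (-c) c) (x : ℝ) :
    FormIn ((x : 𝕜) • T) (-(|x| * c)) (|x| * c) := by
  have := hT.smul_add_smul hT (x := x) (y := 0) (c := |x| * c) (by simp)
  simpa using this

lemma sub_of_norm_le {S T : X →L[𝕜] X} {a b a' b' d : ℝ} (hS : FormIn S a b) (hT : FormIn T a' b')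
    (h : ‖S - T‖ ≤ d) : FormIn (S - T) (-d) d := by
  refine ⟨fun u v => by simp [inner_sub_left, inner_sub_right, hS.1, hT.1], fun u => ?_⟩
  rw [neg_mul, ← abs_le]
  calc _ ≤ ‖(S - T) u‖ * ‖u‖ := (RCLike.abs_re_le_norm _).trans (norm_inner_le_norm _ _)
    _ ≤ d * ‖u‖ * ‖u‖ := by gcongr; exact ContinuousLinearMap.le_of_opNorm_le _ h u
    _ = _ := by ring

end FormIn

/-- Put β = sin²φ, U = cos²φ U', V = sin²φ V'. The family cos a cos b U' + sin a sin b V' has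
numerical range in [-1, 1] for all angles a, b. The difference under consideration is odd in either
angle, so `norm_odd_part_le` applies once in b and once in a; at a = b = φ each application gains n
sin φ, together n²β. -/
lemma norm_opEval_add_sub_opEval_sub_le {U V : X →L[𝕜] X} {α β M : ℝ} (hU : FormIn U (-α) α)
    (hV : FormIn V (-β) β) (hβ : 0 < β) (hβ1 : β < 1) (hαβ : α + β ≤ 1)
    {p : ℝ[X]} {n : ℕ} (hn : 1 ≤ n) (hp : p.natDegree ≤ n)
    (hM : ∀ t ∈ Set.Icc (-1 : ℝ) 1, |p.eval t| ≤ M) (w : X) :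
    ‖opEval (U + V) p w - opEval (U - V) p w‖ ≤ 2 * n ^ 2 * β * M * ‖w‖ := by
  set φ := Real.arcsin (√β) with hφ
  have hsqrt1 : √β ≤ 1 := Real.sqrt_le_one.2 hβ1.le
  have hsin : Real.sin φ = √β :=
    Real.sin_arcsin (by linarith [Real.sqrt_nonneg β]) hsqrt1
  have hss : Real.sin φ * Real.sin φ = β := by rw [hsin, Real.mul_self_sqrt hβ.le]
  have hcc : Real.cos φ * Real.cos φ = 1 - β := by
    have := Real.cos_sq_add_sin_sq φ
    nlinarith
  set U' : X →L[𝕜] X := (((1 - β)⁻¹ : ℝ) : 𝕜) • U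
  set V' : X →L[𝕜] X := ((β⁻¹ : ℝ) : 𝕜) • V
  have hU' : FormIn U' (-1) 1 := by
    have h1 : |(1 - β)⁻¹| * α ≤ 1 := by
      rw [abs_of_nonneg (by rw [inv_nonneg]; linarith), inv_mul_le_iff₀ (by linarith)]; linarith
    exact (hU.smul (1 - β)⁻¹).mono (by linarith) h1
  have hV' : FormIn V' (-1) 1 := by
    have h1 : |β⁻¹| * β ≤ 1 := by
      rw [abs_of_nonneg (by positivity), inv_mul_cancel₀ hβ.ne']
    exact (hV.smul β⁻¹).mono (by linarith) h1
  have hbound : ∀ x y : ℝ, |x| + |y| ≤ 1 → ‖opEval ((x : 𝕜) • U' + (y : 𝕜) • V') p w‖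
      ≤ M * ‖w‖ := fun x y hxy =>
    norm_opEval_apply_le (hU'.smul_add_smul hV' (by simpa using hxy)) hM w
  have hcs : ∀ a b : ℝ, |Real.cos a * Real.cos b| + |Real.sin a * Real.sin b| ≤ 1 := by
    intro a b
    rw [abs_mul, abs_mul]
    have h1 := Real.cos_sq_add_sin_sq a
    have h2 := Real.cos_sq_add_sin_sq b
    rw [← sq_abs (Real.cos _), ← sq_abs (Real.sin _)] at h1 h2
    nlinarith [sq_nonneg (|Real.cos a| - |Real.cos b|), sq_nonneg (|Real.sin a| - |Real.sin b|)]
  have step1 : ∀ a b : ℝ, ‖opEval (((Real.cos a * Real.cos b : ℝ) : 𝕜) • U'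
        + ((Real.sin a * Real.sin b : ℝ) : 𝕜) • V') p w
      - opEval (((Real.cos a * Real.cos b : ℝ) : 𝕜) • U'
        - ((Real.sin a * Real.sin b : ℝ) : 𝕜) • V') p w‖
      ≤ n * |Real.sin b| * (2 * M * ‖w‖) := by
    intro a b
    have h := norm_odd_part_le ((Real.cos a : 𝕜) • U') ((Real.sin a : 𝕜) • V') w hn hp
      (K := 2 * M * ‖w‖) ?_ b
    · simpa only [smul_smul, ← RCLike.ofReal_mul, mul_comm (Real.cos b), mul_comm (Real.sin b)]
        using h
    · intro θ
      have e1 := hbound (Real.cos a * Real.cos θ) (Real.sin a * Real.sin θ) (hcs a θ)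
      have e2 := hbound (Real.cos a * Real.cos θ) (-(Real.sin a * Real.sin θ))
        (by rw [abs_neg]; exact hcs a θ)
      rw [RCLike.ofReal_neg, neg_smul, ← sub_eq_add_neg] at e2
      simp only [smul_smul, ← RCLike.ofReal_mul, mul_comm (Real.cos θ), mul_comm (Real.sin θ)]
      calc _ ≤ _ := norm_sub_le _ _
        _ ≤ M * ‖w‖ + M * ‖w‖ := add_le_add e1 e2
        _ = _ := by ring
  have step2 := norm_odd_part_le ((Real.cos φ : 𝕜) • U') ((Real.sin φ : 𝕜) • V') w hn hp
      (K := n * |Real.sin φ| * (2 * M * ‖w‖)) (fun θ => by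
        simpa only [smul_smul, ← RCLike.ofReal_mul] using step1 θ φ) φ
  simp only [smul_smul, ← RCLike.ofReal_mul, hss, hcc] at step2
  have eU : ((1 - β : ℝ) : 𝕜) • U' = U := by
    simp only [U', smul_smul, ← RCLike.ofReal_mul]
    rw [mul_inv_cancel₀ (by linarith), RCLike.ofReal_one, one_smul]
  have eV : (β : 𝕜) • V' = V := by
    simp only [V', smul_smul, ← RCLike.ofReal_mul]
    rw [mul_inv_cancel₀ hβ.ne', RCLike.ofReal_one, one_smul]
  rw [eU, eV] at step2
  refine step2.trans (le_of_eq ?_)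
  have : |Real.sin φ| * |Real.sin φ| = β := by rw [abs_mul_abs_self, hss]
  linear_combination (2 * n ^ 2 * M * ‖w‖) * this

/-- The segment from T to S is cut into N short steps. Each is centred at a convex combination of S
and T and has half-length d/(2N) at most (1 - c)/2, so the symmetric estimate applies to it; the
bounds then telescope. -/
lemma norm_opEval_sub_le_of_lt {S T : X →L[𝕜] X} {c d M : ℝ} (hc0 : 0 ≤ c) (hc : c < 1)
    (hS : FormIn S (-c) c) (hT : FormIn T (-c) c) (hST : FormIn (S - T) (-d) d) (hd : 0 < d)
    {p : ℝ[X]} {n : ℕ} (hn : 1 ≤ n) (hp : p.natDegree ≤ n)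
    (hM : ∀ t ∈ Set.Icc (-1 : ℝ) 1, |p.eval t| ≤ M) (w : X) :
    ‖opEval S p w - opEval T p w‖ ≤ n ^ 2 * d * M * ‖w‖ := by
  obtain ⟨N, hN⟩ := exists_nat_gt (d / (1 - c))
  have hc1 : 0 < 1 - c := by linarith
  have hNpos : (0 : ℝ) < N := (div_pos hd hc1).trans hN
  rw [div_lt_iff₀ hc1] at hN
  set Z : ℕ → (X →L[𝕜] X) := fun i => T + ((i / N : ℝ) : 𝕜) • (S - T) with hZ
  have hstep : ∀ i < N, ‖opEval (Z (i + 1)) p w - opEval (Z i) p w‖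
      ≤ 2 * n ^ 2 * (d / (2 * N)) * M * ‖w‖ := by
    intro i hi
    have hi' : (i : ℝ) + 1 ≤ N := by exact_mod_cast hi
    set t : ℝ := (i + 1 / 2) / N with ht
    have ht0 : 0 ≤ t := by positivity
    have ht1 : t ≤ 1 := by rw [ht, div_le_one hNpos]; linarith
    have hU : FormIn (((t : ℝ) : 𝕜) • S + ((1 - t : ℝ) : 𝕜) • T) (-c) c :=
      hS.smul_add_smul hT (by
        rw [abs_of_nonneg ht0, abs_of_nonneg (by linarith)]; apply le_of_eq; ring)
    have hV : FormIn (((1 / (2 * N) : ℝ) : 𝕜) • (S - T)) (-(d / (2 * N))) (d / (2 * N)) := by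
      have := hST.smul (1 / (2 * N))
      rwa [abs_of_nonneg (by positivity), one_div_mul_eq_div] at this
    have hdN : d / (2 * N) ≤ (1 - c) / 2 := by
      rw [div_le_div_iff₀ (by positivity) two_pos]; nlinarith
    have h := norm_opEval_add_sub_opEval_sub_le hU hV (by positivity) (by linarith)
      (by linarith) hn hp hM w
    have e1 : ((t : ℝ) : 𝕜) • S + ((1 - t : ℝ) : 𝕜) • T
        + ((1 / (2 * N) : ℝ) : 𝕜) • (S - T) = Z (i + 1) := by
      have : (((i + 1 : ℕ) : ℝ) / N) = t + 1 / (2 * N) := by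
        rw [ht]; push_cast; field_simp; ring
      simp only [hZ, this]
      push_cast; module
    have e2 : ((t : ℝ) : 𝕜) • S + ((1 - t : ℝ) : 𝕜) • T
        - ((1 / (2 * N) : ℝ) : 𝕜) • (S - T) = Z i := by
      have : ((i : ℝ) / N) = t - 1 / (2 * N) := by
        rw [ht]; field_simp; ring
      simp only [hZ, this]
      push_cast; module
    rwa [e1, e2] at h
  have hZN : Z N = S := by
    simp only [hZ, div_self hNpos.ne', RCLike.ofReal_one, one_smul]
    abel
  have hZ0 : Z 0 = T := by simp [hZ]
  have hsum := Finset.sum_range_sub (fun i => opEval (Z i) p w) N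
  simp only [hZN, hZ0] at hsum
  rw [← hsum]
  calc _ ≤ ∑ i ∈ Finset.range N, 2 * n ^ 2 * (d / (2 * N)) * M * ‖w‖ :=
        norm_sum_le_of_le _ fun i hi => hstep i (Finset.mem_range.1 hi)
    _ = _ := by
        rw [Finset.sum_const, Finset.card_range, nsmul_eq_mul]; field_simp

/-- Shrinking both operators by 1 - ε makes room for the subdivision. Replacing d by d + ε keeps the
distance bound positive, and ε tends to 0. -/
lemma norm_opEval_sub_le_of_symmetric {S T : X →L[𝕜] X} {d M : ℝ}
    (hS : FormIn S (-1) 1) (hT : FormIn T (-1) 1) (hST : ‖S - T‖ ≤ d)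
    {p : ℝ[X]} {n : ℕ} (hn : 1 ≤ n) (hp : p.natDegree ≤ n)
    (hM : ∀ t ∈ Set.Icc (-1 : ℝ) 1, |p.eval t| ≤ M) (w : X) :
    ‖opEval S p w - opEval T p w‖ ≤ n ^ 2 * d * M * ‖w‖ := by
  have hd0 : 0 ≤ d := (norm_nonneg _).trans hST
  have hlim : Filter.Tendsto (fun ε : ℝ => ‖opEval (((1 - ε : ℝ) : 𝕜) • S) p w
      - opEval (((1 - ε : ℝ) : 𝕜) • T) p w‖) (nhdsWithin 0 (Set.Ioi 0))
      (nhds ‖opEval S p w - opEval T p w‖) := by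
    have hc : Continuous (fun ε : ℝ => ‖opEval (((1 - ε : ℝ) : 𝕜) • S) p w
      - opEval (((1 - ε : ℝ) : 𝕜) • T) p w‖) := by
      have h1 : ∀ Z : X →L[𝕜] X, Continuous fun ε : ℝ => opEval (((1 - ε : ℝ) : 𝕜) • Z) p w := by
        intro Z
        have h3 : Continuous fun ε : ℝ => ((1 - ε : ℝ) : 𝕜) :=
          RCLike.continuous_ofReal.comp (continuous_const.sub continuous_id)
        have h2 : Continuous fun ε : ℝ => ((1 - ε : ℝ) : 𝕜) • Z := h3.smul continuous_const
        exact ((continuous_opEval p).comp h2).clm_apply continuous_const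
      exact ((h1 S).sub (h1 T)).norm
    have := hc.tendsto 0
    simp only [sub_zero, RCLike.ofReal_one, one_smul] at this
    exact this.mono_left nhdsWithin_le_nhds
  have hlim2 : Filter.Tendsto (fun ε : ℝ => n ^ 2 * (d + ε) * M * ‖w‖) (nhdsWithin 0 (Set.Ioi 0))
      (nhds (n ^ 2 * d * M * ‖w‖)) := by
    have hc : Continuous (fun ε : ℝ => n ^ 2 * (d + ε) * M * ‖w‖) := by fun_prop
    have := hc.tendsto 0
    simp only [add_zero] at this
    exact this.mono_left nhdsWithin_le_nhds
  refine le_of_tendsto_of_tendsto hlim hlim2 ?_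
  filter_upwards [Ioo_mem_nhdsGT (show (0 : ℝ) < 1 by norm_num)] with ε hε
  have h1 : |1 - ε| = 1 - ε := abs_of_pos (by linarith [hε.2])
  have hS' := hS.smul (1 - ε)
  have hT' := hT.smul (1 - ε)
  rw [h1, mul_one] at hS' hT'
  refine norm_opEval_sub_le_of_lt (c := 1 - ε) (by linarith [hε.2]) (by linarith [hε.1])
    hS' hT' (hS'.sub_of_norm_le hT' ?_) (by linarith [hε.1]) hn hp hM w
  rw [← smul_sub, norm_smul, RCLike.norm_ofReal, h1]
  nlinarith [hε.1, hε.2, norm_nonneg (S - T)]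

/-- Markov's inequality for operators: a polynomial of degree at most `n` that is bounded by `M`
on `[0, b]` is Lipschitz continuous on the symmetric operators with numerical range in `[0, b]`,
with the constant `2 n² M / b`. -/
theorem norm_opEval_sub_le {S T : X →L[𝕜] X} {b d M : ℝ} (hb : 0 < b)
    (hS : FormIn S 0 b) (hT : FormIn T 0 b) (hST : ‖S - T‖ ≤ d)
    {p : ℝ[X]} {n : ℕ} (hn : 1 ≤ n) (hp : p.natDegree ≤ n)
    (hM : ∀ t ∈ Set.Icc (0 : ℝ) b, |p.eval t| ≤ M) (w : X) :
    ‖opEval S p w - opEval T p w‖ ≤ 2 * n ^ 2 * M / b * d * ‖w‖ := by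
  set ℓ : ℝ[X] := C (b / 2) * Polynomial.X + C (b / 2) with hℓ
  set A : (X →L[𝕜] X) → (X →L[𝕜] X) := fun Z => ((2 / b : ℝ) : 𝕜) • Z - 1 with hA
  have hAe : ∀ Z, ∀ q : ℝ[X], opEval Z q = opEval (A Z) (q.comp ℓ) := by
    intro Z q
    have h1 : opEval (A Z) ℓ = Z := by
      rw [hℓ, map_add, map_mul, opEval_C, opEval_X, hA, smul_mul_assoc, one_mul, smul_sub,
        smul_smul, ← RCLike.ofReal_mul, show b / 2 * (2 / b) = 1 by field_simp]
      simp
    induction q using Polynomial.induction_on' with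
    | add p q hp hq => rw [map_add, hp, hq, add_comp, map_add]
    | monomial k c =>
      rw [← C_mul_X_pow_eq_monomial]
      simp [opEval_C, opEval_X, h1]
  have hAF : ∀ Z, FormIn Z 0 b → FormIn (A Z) (-1) 1 := by
    intro Z hZ
    refine ⟨fun u v => ?_, fun u => ?_⟩
    · simp only [hA, sub_apply, smul_apply, one_apply_eq_self, inner_sub_left,
        inner_sub_right, inner_smul_left, inner_smul_right, RCLike.conj_ofReal, hZ.1]
    · have h := hZ.2 u
      have hu : RCLike.re (inner 𝕜 u u) = ‖u‖ ^ 2 := by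
        rw [inner_self_eq_norm_sq_to_K]; norm_cast
      simp only [hA, sub_apply, smul_apply, one_apply_eq_self, inner_sub_left,
        inner_smul_left, RCLike.conj_ofReal, map_sub, RCLike.re_ofReal_mul, hu]
      have h1 : 0 ≤ 2 / b * RCLike.re (inner 𝕜 (Z u) u) :=
        mul_nonneg (by positivity) (by linarith [h.1])
      have h2 : 2 / b * RCLike.re (inner 𝕜 (Z u) u) ≤ 2 / b * (b * ‖u‖ ^ 2) :=
        mul_le_mul_of_nonneg_left h.2 (by positivity)
      rw [← mul_assoc, div_mul_cancel₀ _ hb.ne'] at h2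
      constructor <;> linarith
  rw [hAe S, hAe T]
  have hsub : A S - A T = ((2 / b : ℝ) : 𝕜) • (S - T) := by simp [hA, smul_sub]
  have h := norm_opEval_sub_le_of_symmetric (hAF S hS) (hAF T hT) (d := 2 / b * d) (p := p.comp ℓ)
    (M := M) ?_ hn ?_ ?_ w
  · refine h.trans (le_of_eq ?_)
    ring
  · rw [hsub, norm_smul, RCLike.norm_ofReal, abs_of_pos (by positivity)]
    gcongr
  · refine natDegree_comp_le.trans ?_
    calc _ ≤ p.natDegree * 1 := Nat.mul_le_mul_left _ natDegree_linear_le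
      _ ≤ n := by simpa using hp
  · intro t ht
    simp only [hℓ, eval_comp, eval_add, eval_mul, eval_C, eval_X]
    exact hM _ ⟨by nlinarith [ht.1], by nlinarith [ht.2]⟩

end Markov

/-! ### Orthogonal polynomials -/

section OrthogonalPolynomials

variable {w : ℝ → ℝ} {P : ℕ → ℝ[X]}

namespace IsWeight

lemma integrableOn_eval_mul (hw : IsWeight w) (p : ℝ[X]) :
    IntegrableOn (fun x => p.eval x * w x) (Set.Icc (-1 : ℝ) 1) :=
  hw.integrable.continuousOn_mul p.continuous.continuousOn isCompact_Icc

lemma wInt_add (hw : IsWeight w) (p q : ℝ[X]) : wInt w (p + q) = wInt w p + wInt w q := by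
  simp only [wInt, eval_add, add_mul]
  exact integral_add (hw.integrableOn_eval_mul p) (hw.integrableOn_eval_mul q)

lemma wInt_C_mul (c : ℝ) (p : ℝ[X]) : wInt w (C c * p) = c * wInt w p := by
  simp only [wInt, eval_mul, eval_C, mul_assoc]
  exact integral_const_mul _ _

lemma wInt_neg (p : ℝ[X]) : wInt w (-p) = -wInt w p := by
  simp only [wInt, eval_neg, neg_mul]
  exact integral_neg _

lemma wInt_sub (hw : IsWeight w) (p q : ℝ[X]) : wInt w (p - q) = wInt w p - wInt w q := by
  rw [sub_eq_add_neg, hw.wInt_add, wInt_neg, sub_eq_add_neg]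

lemma wInt_pos (hw : IsWeight w) {p : ℝ[X]} (hp : p ≠ 0)
    (h : ∀ x ∈ Set.Icc (-1 : ℝ) 1, 0 ≤ p.eval x) : 0 < wInt w p := by
  have hnn : 0 ≤ᵐ[volume.restrict (Set.Icc (-1 : ℝ) 1)] fun x => p.eval x * w x :=
    (ae_restrict_iff' measurableSet_Icc).2 (.of_forall fun x hx =>
      mul_nonneg (h x hx) (hw.nonneg x hx))
  refine lt_of_le_of_ne (integral_nonneg_of_ae hnn) fun h0 => ?_
  have h1 := (integral_eq_zero_iff_of_nonneg_ae hnn (hw.integrableOn_eval_mul p)).1 h0.symm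
  have hroots : ∀ᵐ x ∂(volume.restrict (Set.Icc (-1 : ℝ) 1)), p.eval x ≠ 0 := by
    refine ae_restrict_of_ae ?_
    rw [ae_iff]
    refine Set.Finite.measure_zero ?_ _
    refine (p.roots.toFinset.finite_toSet).subset fun x hx => ?_
    simpa [hp] using hx
  have h2 : ∀ᵐ x ∂(volume.restrict (Set.Icc (-1 : ℝ) 1)), w x = 0 := by
    filter_upwards [h1, hroots] with x hx hx'
    exact (mul_eq_zero.1 hx).resolve_left hx'
  have h3 : ∫ x in Set.Icc (-1 : ℝ) 1, w x = 0 := by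
    rw [integral_congr_ae h2]; simp
  exact hw.pos.ne' h3

end IsWeight

namespace IsMonicOrthogonal

lemma degree_eq (hP : IsMonicOrthogonal w P) (k : ℕ) : (P k).degree = k := by
  rw [degree_eq_natDegree (hP.monic k).ne_zero, hP.natDegree_eq]

lemma coeff_self (hP : IsMonicOrthogonal w P) (k : ℕ) : (P k).coeff k = 1 := by
  have := hP.monic k
  rwa [Monic, leadingCoeff, hP.natDegree_eq] at this

lemma degree_sub_lt (hP : IsMonicOrthogonal w P) {k : ℕ} {q : ℝ[X]} (hq : q.degree < (k + 1 : ℕ)) :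
    (q - C (q.coeff k) * P k).degree < k := by
  rw [← mem_degreeLT, mem_degreeLT, degree_lt_iff_coeff_zero]
  intro m hm
  rw [coeff_sub, coeff_C_mul]
  rcases hm.eq_or_lt with rfl | h
  · rw [hP.coeff_self]; ring
  · rw [(degree_lt_iff_coeff_zero _ _).1 hq m h,
      coeff_eq_zero_of_natDegree_lt (p := P k) (by rw [hP.natDegree_eq]; exact h)]
    ring

lemma wInt_mul_eq_zero (hw : IsWeight w) (hP : IsMonicOrthogonal w P) {R : ℝ[X]} {m : ℕ}
    (hR : ∀ j < m, wInt w (R * P j) = 0) {q : ℝ[X]} (hq : q.degree < m) :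
    wInt w (R * q) = 0 := by
  induction m generalizing q with
  | zero =>
    have : q = 0 := by
      rw [← degree_eq_bot]
      exact Nat.WithBot.lt_zero_iff.1 (by exact_mod_cast hq)
    simp [this, wInt]
  | succ k ih =>
    have h1 := ih (fun j hj => hR j (hj.trans (Nat.lt_succ_self k))) (hP.degree_sub_lt hq)
    have h2 : R * q = R * (q - C (q.coeff k) * P k) + C (q.coeff k) * (R * P k) := by ring
    rw [h2, hw.wInt_add, h1, IsWeight.wInt_C_mul, hR k (Nat.lt_succ_self k)]
    ring

lemma wInt_mul_eq_zero_of_degree_lt (hw : IsWeight w) (hP : IsMonicOrthogonal w P) {k : ℕ}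
    {q : ℝ[X]} (hq : q.degree < k) : wInt w (P k * q) = 0 :=
  hP.wInt_mul_eq_zero hw (fun j hj => hP.orthogonal k j hj.ne') hq

lemma wInt_sq_pos (hw : IsWeight w) (hP : IsMonicOrthogonal w P) (k : ℕ) :
    0 < wInt w (P k ^ 2) :=
  hw.wInt_pos (pow_ne_zero 2 (hP.monic k).ne_zero) fun x _ => by rw [eval_pow]; positivity

/-- Such an R is a combination of the first m orthogonal polynomials, hence orthogonal to itself.
The recurrence is proved by applying this to the difference of its two sides. -/
lemma eq_zero_of_orthogonal (hw : IsWeight w) (hP : IsMonicOrthogonal w P) {R : ℝ[X]} {m : ℕ}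
    (hdeg : R.degree < m) (hR : ∀ j < m, wInt w (R * P j) = 0) : R = 0 := by
  by_contra h0
  have h1 := hP.wInt_mul_eq_zero hw hR hdeg
  have h2 := hw.wInt_pos (mul_ne_zero h0 h0) fun x _ => by
    rw [eval_mul]; exact mul_self_nonneg _
  exact h2.ne' h1

lemma zero_eq_one (hP : IsMonicOrthogonal w P) : P 0 = 1 :=
  (hP.monic 0).natDegree_eq_zero.1 (hP.natDegree_eq 0)

lemma degree_X_mul_lt (hP : IsMonicOrthogonal w P) (k : ℕ) :
    (P (k + 1) - Polynomial.X * P k).degree < ((k + 1 : ℕ) : WithBot ℕ) := by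
  rw [degree_lt_iff_coeff_zero]
  intro m hm
  obtain ⟨j, rfl⟩ : ∃ j, m = j + 1 := ⟨m - 1, by omega⟩
  rw [coeff_sub, coeff_X_mul]
  rcases hm.eq_or_lt with h | h
  · have : j = k := by omega
    subst this
    rw [hP.coeff_self, hP.coeff_self, sub_self]
  · rw [coeff_eq_zero_of_natDegree_lt (by rw [hP.natDegree_eq]; exact h),
      coeff_eq_zero_of_natDegree_lt (by rw [hP.natDegree_eq]; omega), sub_self]

lemma one_eq (hw : IsWeight w) (hP : IsMonicOrthogonal w P) :
    P 1 = Polynomial.X - C (alpha w P 0) := by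
  rw [← sub_eq_zero]
  refine hP.eq_zero_of_orthogonal hw (m := 1) ?_ fun j hj => ?_
  · have h : P 1 - (Polynomial.X - C (alpha w P 0)) =
        (P (0 + 1) - Polynomial.X * P 0) + C (alpha w P 0) := by
      rw [hP.zero_eq_one]; ring
    rw [h]
    exact (degree_add_le _ _).trans_lt (max_lt (hP.degree_X_mul_lt 0)
      (degree_C_le.trans_lt (by norm_num)))
  · have hj0 : j = 0 := by omega
    subst hj0
    have h : (P 1 - (Polynomial.X - C (alpha w P 0))) * P 0
        = P 1 * P 0 - Polynomial.X * P 0 ^ 2 + C (alpha w P 0) * P 0 ^ 2 := by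
      rw [hP.zero_eq_one]; ring
    rw [h, hw.wInt_add, hw.wInt_sub, IsWeight.wInt_C_mul, hP.orthogonal 1 0 one_ne_zero, alpha,
      div_mul_cancel₀ _ (hP.wInt_sq_pos hw 0).ne']
    ring

/-- The three-term recurrence of the monic orthogonal polynomials. -/
theorem recurrence (hw : IsWeight w) (hP : IsMonicOrthogonal w P) (k : ℕ) :
    P (k + 2) = (Polynomial.X - C (alpha w P (k + 1))) * P (k + 1)
      - C (beta w P (k + 1)) * P k := by
  set a := alpha w P (k + 1) with ha
  set b := beta w P (k + 1) with hb
  rw [← sub_eq_zero]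
  refine hP.eq_zero_of_orthogonal hw (m := k + 2) ?_ fun j hj => ?_
  · have h : P (k + 2) - ((Polynomial.X - C a) * P (k + 1) - C b * P k)
        = (P (k + 1 + 1) - Polynomial.X * P (k + 1)) + (C a * P (k + 1) + C b * P k) := by ring
    rw [h]
    refine (degree_add_le _ _).trans_lt (max_lt (hP.degree_X_mul_lt (k + 1)) ?_)
    refine (degree_add_le _ _).trans_lt (max_lt ?_ ?_)
    · rw [← smul_eq_C_mul]
      refine (degree_smul_le _ _).trans_lt ?_
      rw [hP.degree_eq]; exact_mod_cast Nat.lt_succ_self _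
    · rw [← smul_eq_C_mul]
      refine (degree_smul_le _ _).trans_lt ?_
      rw [hP.degree_eq]; exact_mod_cast (by omega : k < k + 2)
  · have h : (P (k + 2) - ((Polynomial.X - C a) * P (k + 1) - C b * P k)) * P j
        = P (k + 2) * P j - P (k + 1) * (Polynomial.X * P j)
          + C a * (P (k + 1) * P j) + C b * (P k * P j) := by ring
    rw [h, hw.wInt_add, hw.wInt_add, hw.wInt_sub, IsWeight.wInt_C_mul, IsWeight.wInt_C_mul,
      hP.orthogonal (k + 2) j hj.ne']
    rcases lt_trichotomy j (k + 1) with h1 | h1 | h1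
    · rw [hP.orthogonal (k + 1) j h1.ne']
      rcases (Nat.lt_succ_iff.1 h1).eq_or_lt with h2 | h2
      · subst h2
        have h3 : P (j + 1) * (Polynomial.X * P j) = P (j + 1) ^ 2
            - P (j + 1) * (P (j + 1) - Polynomial.X * P j) := by ring
        rw [h3, hw.wInt_sub, hP.wInt_mul_eq_zero_of_degree_lt hw (hP.degree_X_mul_lt j), hb, beta,
          Nat.add_sub_cancel, ← pow_two, div_mul_cancel₀ _ (hP.wInt_sq_pos hw j).ne']
        ring
      · rw [hP.orthogonal k j h2.ne', hP.wInt_mul_eq_zero_of_degree_lt hw]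
        · ring
        · rw [degree_mul, degree_X, hP.degree_eq]
          have : 1 + j < k + 1 := by omega
          exact_mod_cast this
    · subst h1
      have h3 : P (k + 1) * (Polynomial.X * P (k + 1)) = Polynomial.X * P (k + 1) ^ 2 := by ring
      rw [h3, hP.orthogonal k (k + 1) (by omega), ← pow_two, ha, alpha,
        div_mul_cancel₀ _ (hP.wInt_sq_pos hw (k + 1)).ne']
      ring
    · omega

/-- If P_k = (X - 1) q, then orthogonality to q contradicts the positivity of the weighted integral
of (1 - x) q². This makes the normalization of the residual polynomials meaningful. -/
lemma eval_one_ne_zero (hw : IsWeight w) (hP : IsMonicOrthogonal w P) (k : ℕ) :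
    (P k).eval 1 ≠ 0 := by
  intro h0
  obtain ⟨q, hq⟩ := dvd_iff_isRoot.2 h0
  have hq0 : q ≠ 0 := by
    rintro rfl
    exact (hP.monic k).ne_zero (by rw [hq, mul_zero])
  have hdeg : q.degree < k := by
    rw [← hP.degree_eq k, hq, degree_mul, degree_X_sub_C, degree_eq_natDegree hq0]
    exact_mod_cast (by omega : q.natDegree < 1 + q.natDegree)
  have h1 := hP.wInt_mul_eq_zero_of_degree_lt hw hdeg
  have h2 : P k * q = -((1 - Polynomial.X) * q ^ 2) := by
    rw [hq, C_1]; ring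
  rw [h2, IsWeight.wInt_neg, neg_eq_zero] at h1
  refine (hw.wInt_pos (mul_ne_zero ?_ (pow_ne_zero 2 hq0)) fun x hx => ?_).ne' h1
  · intro h3
    have := congrArg (eval 0) h3
    simp at this
  · simp only [eval_mul, eval_sub, eval_one, eval_X, eval_pow]
    exact mul_nonneg (by linarith [hx.2]) (sq_nonneg _)

/-- Evaluating the recurrence at 1 shows that these quotients satisfy the recursion for ω. Hence the
recursion for the iterates is the three-term recurrence divided by P_k(1). -/
lemma omega_eq (hw : IsWeight w) (hP : IsMonicOrthogonal w P) (k : ℕ) :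
    omega w P k = (P k).eval 1 / (P (k + 1)).eval 1 := by
  induction k with
  | zero =>
    rw [omega, hP.one_eq hw, hP.zero_eq_one]
    simp
  | succ k ih =>
    have h1 := hP.eval_one_ne_zero hw (k + 1)
    have h2 := hP.eval_one_ne_zero hw (k + 2)
    have h3 := congrArg (eval 1) (hP.recurrence hw k)
    simp only [eval_sub, eval_mul, eval_X, eval_C] at h3
    rw [omega, ih]
    have h4 : 1 - alpha w P (k + 1) - beta w P (k + 1) * ((P k).eval 1 / (P (k + 1)).eval 1)
        = (P (k + 2)).eval 1 / (P (k + 1)).eval 1 := by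
      rw [h3]; field_simp
    rw [h4, one_div_div]

end IsMonicOrthogonal

/-! ### Residual polynomials and iterates -/

/-- The residual polynomial `r_k(t) = P_k(1 - 2 t) / P_k(1)`. -/
def resPoly (P : ℕ → ℝ[X]) (k : ℕ) : ℝ[X] :=
  C ((P k).eval 1)⁻¹ * (P k).comp (1 - C 2 * Polynomial.X)

/-- The polynomial `g_k(t) = (1 - r_k(t)) / t`. -/
def solPoly (P : ℕ → ℝ[X]) (k : ℕ) : ℝ[X] := (1 - resPoly P k).divX

lemma eval_resPoly (P : ℕ → ℝ[X]) (k : ℕ) (t : ℝ) : (resPoly P k).eval t = residual P k t := by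
  simp [resPoly, residual, div_eq_inv_mul]

namespace IsMonicOrthogonal

lemma natDegree_resPoly_le (hP : IsMonicOrthogonal w P) (k : ℕ) : (resPoly P k).natDegree ≤ k := by
  refine (natDegree_C_mul_le _ _).trans (natDegree_comp_le.trans ?_)
  rw [hP.natDegree_eq]
  refine (Nat.mul_le_mul_left k (?_ : _ ≤ 1)).trans (by simp)
  rw [sub_eq_add_neg, add_comm, ← C_1, ← neg_mul, ← C_neg]
  exact natDegree_linear_le

lemma resPoly_zero (hP : IsMonicOrthogonal w P) : resPoly P 0 = 1 := by
  simp [resPoly, hP.zero_eq_one]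

lemma X_mul_solPoly (hw : IsWeight w) (hP : IsMonicOrthogonal w P) (k : ℕ) :
    Polynomial.X * solPoly P k = 1 - resPoly P k := by
  have h := divX_mul_X_add (1 - resPoly P k)
  have h0 : (1 - resPoly P k).coeff 0 = 0 := by
    rw [coeff_zero_eq_eval_zero, eval_sub, eval_resPoly]
    simp [residual, hP.eval_one_ne_zero hw k]
  rw [h0, C_0, add_zero] at h
  rw [mul_comm]
  exact h

lemma resPoly_one (hw : IsWeight w) (hP : IsMonicOrthogonal w P) :
    resPoly P 1 = 1 - C (2 * omega w P 0) * Polynomial.X := by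
  have h1 := hP.eval_one_ne_zero hw 1
  have h2 := hP.omega_eq hw 0
  refine Polynomial.funext fun t => ?_
  rw [eval_resPoly, residual]
  have h3 := hP.one_eq hw
  rw [hP.zero_eq_one, zero_add] at h2
  rw [h2]
  rw [h3] at h1 ⊢
  simp only [eval_sub, eval_X, eval_C, eval_one, eval_mul] at h1 ⊢
  field_simp
  ring

lemma resPoly_add_two (hw : IsWeight w) (hP : IsMonicOrthogonal w P) (k : ℕ) :
    resPoly P (k + 2) = resPoly P (k + 1)
      + C ((1 - alpha w P (k + 1)) * omega w P (k + 1) - 1) * (resPoly P (k + 1) - resPoly P k)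
      - C (2 * omega w P (k + 1)) * (Polynomial.X * resPoly P (k + 1)) := by
  have h0 := hP.eval_one_ne_zero hw k
  have h1 := hP.eval_one_ne_zero hw (k + 1)
  have h2 := hP.eval_one_ne_zero hw (k + 2)
  have h3 := congrArg (eval 1) (hP.recurrence hw k)
  refine Polynomial.funext fun t => ?_
  have h4 := congrArg (eval (1 - 2 * t)) (hP.recurrence hw k)
  simp only [eval_sub, eval_mul, eval_X, eval_C] at h3 h4
  simp only [eval_sub, eval_add, eval_mul, eval_X, eval_C, eval_resPoly, residual]
  rw [hP.omega_eq hw (k + 1), h4]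
  have h5 : beta w P (k + 1) = ((1 - alpha w P (k + 1)) * (P (k + 1)).eval 1
      - (P (k + 2)).eval 1) / (P k).eval 1 := by
    rw [h3]; field_simp; ring
  rw [h5]
  field_simp
  ring

lemma solPoly_zero (hP : IsMonicOrthogonal w P) : solPoly P 0 = 0 := by
  simp [solPoly, hP.resPoly_zero]

lemma solPoly_one (hw : IsWeight w) (hP : IsMonicOrthogonal w P) :
    solPoly P 1 = C (2 * omega w P 0) := by
  refine mul_left_cancel₀ (X_ne_zero (R := ℝ)) ?_
  rw [hP.X_mul_solPoly hw, hP.resPoly_one hw]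
  ring

lemma solPoly_add_two (hw : IsWeight w) (hP : IsMonicOrthogonal w P) (k : ℕ) :
    solPoly P (k + 2) = solPoly P (k + 1)
      + C ((1 - alpha w P (k + 1)) * omega w P (k + 1) - 1) * (solPoly P (k + 1) - solPoly P k)
      + C (2 * omega w P (k + 1)) * resPoly P (k + 1) := by
  refine mul_left_cancel₀ (X_ne_zero (R := ℝ)) ?_
  rw [hP.X_mul_solPoly hw, hP.resPoly_add_two hw]
  have h1 := hP.X_mul_solPoly hw (k + 1)
  have h0 := hP.X_mul_solPoly hw k
  linear_combination (-1 - C ((1 - alpha w P (k + 1)) * omega w P (k + 1) - 1)) * h1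
    + C ((1 - alpha w P (k + 1)) * omega w P (k + 1) - 1) * h0

end IsMonicOrthogonal

variable {𝕜 : Type*} [RCLike 𝕜] {X : Type*} [NormedAddCommGroup X] [InnerProductSpace 𝕜 X]
  [CompleteSpace X]

omit [CompleteSpace X] in
lemma opEval_solPoly_mul (hw : IsWeight w) (hP : IsMonicOrthogonal w P) (T : X →L[𝕜] X) (k : ℕ) :
    T * opEval T (solPoly P k) = 1 - opEval T (resPoly P k) := by
  have h := congrArg (opEval T) (hP.X_mul_solPoly hw k)
  rwa [map_mul, opEval_X, map_sub, map_one] at h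

/-- The iterates of the semiiterative method in closed form. -/
theorem iter_eq (hw : IsWeight w) (hP : IsMonicOrthogonal w P) (B : X →L[𝕜] X) (g : X) (k : ℕ) :
    iter w P B g k = opEval (ContinuousLinearMap.adjoint B * B) (solPoly P k)
      (ContinuousLinearMap.adjoint B g) := by
  induction k using Nat.strong_induction_on with
  | _ k ih =>
    match k with
    | 0 => simp [iter, hP.solPoly_zero]
    | 1 => rw [iter, hP.solPoly_one hw, opEval_C]; simp
    | k + 2 =>
      rw [iter, ih (k + 1) (by omega), ih k (by omega), hP.solPoly_add_two hw]
      set T := ContinuousLinearMap.adjoint B * B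
      set y := ContinuousLinearMap.adjoint B g
      have h1 : ContinuousLinearMap.adjoint B (g - B (opEval T (solPoly P (k + 1)) y))
          = opEval T (resPoly P (k + 1)) y := by
        have h2 := congrArg (fun Z : X →L[𝕜] X => Z y) (opEval_solPoly_mul hw hP T (k + 1))
        simp only [mul_apply_eq_comp, sub_apply, one_apply_eq_self] at h2
        rw [map_sub]
        change y - T _ = _
        rw [h2]; abel
      rw [h1]
      generalize (1 - alpha w P (k + 1)) * omega w P (k + 1) - 1 = a
      generalize 2 * omega w P (k + 1) = b
      simp only [map_add, map_mul, map_sub, opEval_C, add_apply, mul_apply_eq_comp, sub_apply,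
        smul_apply, one_apply_eq_self, smul_sub]

end OrthogonalPolynomials

section Cross

variable {𝕜 : Type*} [RCLike 𝕜] {X : Type*} [NormedAddCommGroup X] [InnerProductSpace 𝕜 X]
  [CompleteSpace X]

/-! ### Orthogonal projections -/

lemma inner_star_left (Z : X →L[𝕜] X) (x y : X) : inner 𝕜 (star Z x) y = inner 𝕜 x (Z y) := by
  rw [ContinuousLinearMap.star_eq_adjoint, ContinuousLinearMap.adjoint_inner_left]

lemma inner_star_right (Z : X →L[𝕜] X) (x y : X) : inner 𝕜 x (star Z y) = inner 𝕜 (Z x) y := by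
  rw [ContinuousLinearMap.star_eq_adjoint, ContinuousLinearMap.adjoint_inner_right]

lemma opNorm_star (Z : X →L[𝕜] X) : ‖star Z‖ = ‖Z‖ :=
  LinearIsometryEquiv.norm_map ContinuousLinearMap.adjoint Z

lemma re_inner_star_mul_self (Z : X →L[𝕜] X) (x : X) :
    RCLike.re (inner 𝕜 ((star Z * Z) x) x) = ‖Z x‖ ^ 2 := by
  rw [mul_apply_eq_comp, inner_star_left, inner_self_eq_norm_sq_to_K]
  norm_cast

lemma norm_sq_eq_of_isStarProjection {p : X →L[𝕜] X} (hp : IsStarProjection p) (x : X) :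
    ‖x‖ ^ 2 = ‖p x‖ ^ 2 + ‖x - p x‖ ^ 2 := by
  have h1 : inner 𝕜 (p x) (x - p x) = 0 := by
    have h0 := inner_star_left p x (x - p x)
    rw [hp.isSelfAdjoint.star_eq] at h0
    rw [h0, map_sub, ← mul_apply_eq_comp, hp.isIdempotentElem.eq, sub_self, inner_zero_right]
  have h2 := norm_add_sq_eq_norm_sq_add_norm_sq_of_inner_eq_zero (p x) (x - p x) h1
  rw [add_sub_cancel] at h2
  rw [pow_two, pow_two, pow_two, h2]

lemma norm_sq_eq_re_inner_of_isStarProjection {p : X →L[𝕜] X} (hp : IsStarProjection p) (x : X) :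
    ‖p x‖ ^ 2 = RCLike.re (inner 𝕜 (p x) x) := by
  rw [← re_inner_star_mul_self, hp.isSelfAdjoint.star_eq, hp.isIdempotentElem.eq]

lemma norm_le_one_of_isStarProjection {p : X →L[𝕜] X} (hp : IsStarProjection p) : ‖p‖ ≤ 1 := by
  refine ContinuousLinearMap.opNorm_le_bound _ zero_le_one fun x => ?_
  rw [one_mul]
  refine le_of_sq_le_sq ?_ (norm_nonneg x)
  rw [norm_sq_eq_of_isStarProjection hp x]
  linarith [sq_nonneg ‖x - p x‖]

/-- The two forms differ by a product of a and b, not by b alone: the truncated part only sees x - p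
x, of size b‖x - p x‖, and it is multiplied by vectors of size a‖x‖ or a‖p x‖. This product is what
makes the hyperbolic cross efficient. -/
lemma norm_proj_apply_sub (p Z : X →L[𝕜] X) {a b : ℝ} (hp : IsStarProjection p)
    (ha : ‖Z‖ ≤ a) (hb : ‖Z * (1 - p)‖ ≤ b) (x : X) :
    ‖(Z * p) x‖ ^ 2 - ‖Z x‖ ^ 2 ≤ a * b * ‖x‖ ^ 2 ∧
      ‖Z x‖ ^ 2 - ‖(Z * p) x‖ ^ 2 ≤ 13 / 10 * (a * b) * ‖x‖ ^ 2 := by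
  have hpyth := norm_sq_eq_of_isStarProjection hp x
  have ha0 := (norm_nonneg _).trans ha
  have hb0 := (norm_nonneg _).trans hb
  have h1 : ‖(Z * p) x‖ ≤ a * ‖p x‖ := ContinuousLinearMap.le_of_opNorm_le _ ha _
  have h2 : ‖(Z * (1 - p)) x‖ ≤ b * ‖x - p x‖ := by
    have : (Z * (1 - p)) x = (Z * (1 - p)) (x - p x) := by
      simp only [mul_apply_eq_comp, sub_apply, one_apply_eq_self, map_sub]
      rw [← mul_apply_eq_comp p p, hp.isIdempotentElem.eq]
      simp
    rw [this]
    exact ContinuousLinearMap.le_of_opNorm_le _ hb _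
  have h3 : ‖Z x‖ ≤ a * ‖x‖ := ContinuousLinearMap.le_of_opNorm_le _ ha _
  have hdec : Z x = (Z * p) x + (Z * (1 - p)) x := by
    rw [← add_apply, ← mul_add, add_sub_cancel, mul_one]
  have h4 : ‖Z x‖ ≤ ‖(Z * p) x‖ + ‖(Z * (1 - p)) x‖ := by rw [hdec]; exact norm_add_le _ _
  have h5 : ‖(Z * p) x‖ ≤ ‖Z x‖ + ‖(Z * (1 - p)) x‖ := by
    have : (Z * p) x = Z x - (Z * (1 - p)) x := by rw [hdec]; abel
    rw [this]; exact norm_sub_le _ _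
  have hq := norm_nonneg ((Z * p) x)
  have ht := norm_nonneg ((Z * (1 - p)) x)
  generalize ‖(Z * p) x‖ = q at *
  generalize ‖(Z * (1 - p)) x‖ = t at *
  have hZ0 := norm_nonneg (Z x)
  generalize ‖Z x‖ = z at *
  have hc0 := norm_nonneg (p x)
  have hy0 := norm_nonneg (x - p x)
  have hN0 := norm_nonneg x
  generalize ‖x - p x‖ = y at *
  generalize ‖p x‖ = c at *
  generalize ‖x‖ = N at *
  have hq0 : 0 ≤ a * c := by positivity
  have ht0 : 0 ≤ b * y := by positivity
  constructor
  · rcases le_total q z with h | h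
    · have : 0 ≤ a * b * N ^ 2 := by positivity
      nlinarith
    · have h6 : q ^ 2 - z ^ 2 ≤ 2 * q * t := by
        rcases le_total q t with h7 | h7
        · nlinarith
        · nlinarith [mul_le_mul (sub_le_iff_le_add.2 h5) (sub_le_iff_le_add.2 h5) (by linarith) hZ0]
      have h7 : q * t ≤ (a * c) * (b * y) :=
        mul_le_mul h1 h2 (by linarith) hq0
      have h8 : (a * b) * (2 * c * y) ≤ (a * b) * N ^ 2 :=
        mul_le_mul_of_nonneg_left (by nlinarith [sq_nonneg (c - y)]) (by positivity)
      nlinarith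
  · rcases le_total z q with h | h
    · have : 0 ≤ a * b * N ^ 2 := by positivity
      nlinarith
    · have h6 : z ^ 2 - q ^ 2 ≤ (b * y) * (a * N + a * c) := by
        have : (z - q) * (z + q) ≤ (b * y) * (a * N + a * c) :=
          mul_le_mul (by linarith) (by linarith) (by nlinarith) ht0
        nlinarith
      -- With c² + y² = N² the maximum of y(N + c) is (3√3/4) N², slightly below 13/10 N².
      have h7 : y * (N + c) ≤ 13 / 10 * N ^ 2 := by
        nlinarith [sq_nonneg (y * (7 / 4) - (N + c)), sq_nonneg (c - N / 2)]
      have h8 := mul_le_mul_of_nonneg_left h7 (mul_nonneg ha0 hb0)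
      nlinarith

/-! ### Bounds for the hyperbolic cross -/

omit [CompleteSpace X] in
lemma proj_apply (e : HilbertBasis ℕ 𝕜 X) (m : ℕ) (x : X) :
    proj e m x = ∑ i ∈ Finset.range m, inner 𝕜 (e i) x • e i := by
  simp [proj, sum_apply]

omit [CompleteSpace X] in
lemma proj_mul_proj (e : HilbertBasis ℕ 𝕜 X) (m m' : ℕ) :
    proj e m * proj e m' = proj e (min m m') := by
  ext x
  rw [mul_apply_eq_comp, proj_apply e m, proj_apply e m', proj_apply]
  have hin : ∀ i, inner 𝕜 (e i) (∑ j ∈ Finset.range m', inner 𝕜 (e j) x • e j)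
      = if i ∈ Finset.range m' then inner 𝕜 (e i) x else 0 := by
    intro i
    rw [inner_sum]
    simp only [inner_smul_right, orthonormal_iff_ite.1 e.orthonormal, mul_ite, mul_one, mul_zero]
    rw [Finset.sum_ite_eq]
  simp only [hin, ite_smul, zero_smul]
  rw [← Finset.sum_filter]
  refine Finset.sum_congr ?_ fun _ _ => rfl
  ext i; simp

lemma star_proj (e : HilbertBasis ℕ 𝕜 X) (m : ℕ) : star (proj e m) = proj e m := by
  rw [proj, star_sum]
  refine Finset.sum_congr rfl fun i _ => ?_
  rw [ContinuousLinearMap.star_eq_adjoint, InnerProductSpace.adjoint_rankOne]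

lemma isStarProjection_proj (e : HilbertBasis ℕ 𝕜 X) (m : ℕ) : IsStarProjection (proj e m) :=
  ⟨by rw [IsIdempotentElem, proj_mul_proj, min_self], star_proj e m⟩

/-- The dyadic blocks `P_1` and `P_{2^k} - P_{2^{k-1}}`, `k ≥ 1`. -/
def block (e : HilbertBasis ℕ 𝕜 X) : ℕ → (X →L[𝕜] X)
  | 0 => proj e 1
  | k + 1 => proj e (2 ^ (k + 1)) - proj e (2 ^ k)

lemma star_block (e : HilbertBasis ℕ 𝕜 X) (k : ℕ) : star (block e k) = block e k := by
  cases k with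
  | zero => exact star_proj e 1
  | succ k => rw [block, star_sub, star_proj, star_proj]

omit [CompleteSpace X] in
lemma sum_block (e : HilbertBasis ℕ 𝕜 X) (N : ℕ) :
    ∑ k ∈ Finset.range (N + 1), block e k = proj e (2 ^ N) := by
  induction N with
  | zero => simp [block]
  | succ N ih => rw [Finset.sum_range_succ, ih, block]; abel

omit [CompleteSpace X] in
lemma block_mul_proj_of_le (e : HilbertBasis ℕ 𝕜 X) {k N : ℕ} (h : k ≤ N) :
    block e k * proj e (2 ^ N) = block e k := by
  cases k with
  | zero => rw [block, proj_mul_proj, min_eq_left Nat.one_le_two_pow]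
  | succ k =>
    rw [block, sub_mul, proj_mul_proj, proj_mul_proj,
      min_eq_left (Nat.pow_le_pow_right two_pos h),
      min_eq_left (Nat.pow_le_pow_right two_pos (by omega))]

omit [CompleteSpace X] in
lemma block_mul_proj_of_lt (e : HilbertBasis ℕ 𝕜 X) {k N : ℕ} (h : N < k) :
    block e k * proj e (2 ^ N) = 0 := by
  cases k with
  | zero => omega
  | succ k =>
    rw [block, sub_mul, proj_mul_proj, proj_mul_proj,
      min_eq_right (Nat.pow_le_pow_right two_pos (by omega)),
      min_eq_right (Nat.pow_le_pow_right two_pos (by omega)), sub_self]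

omit [CompleteSpace X] in
lemma block_mul_block (e : HilbertBasis ℕ 𝕜 X) (k l : ℕ) :
    block e k * block e l = if k = l then block e k else 0 := by
  have hcases : ∀ l : ℕ, block e l = proj e (2 ^ l) - if l = 0 then 0 else proj e (2 ^ (l - 1)) := by
    intro l
    cases l with
    | zero => simp [block]
    | succ l => simp [block]
  conv_lhs => rw [hcases l]
  rw [mul_sub]
  rcases lt_trichotomy k l with h | h | h
  · rw [if_neg h.ne, if_neg (by omega), block_mul_proj_of_le e h.le,
      block_mul_proj_of_le e (by omega), sub_self]
  · subst h
    rw [if_pos rfl, block_mul_proj_of_le e le_rfl]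
    split_ifs with h0
    · simp
    · rw [block_mul_proj_of_lt e (by omega), sub_zero]
  · rw [if_neg h.ne', block_mul_proj_of_lt e h]
    split_ifs with h0
    · simp
    · rw [block_mul_proj_of_lt e (by omega), sub_zero]

lemma isStarProjection_block (e : HilbertBasis ℕ 𝕜 X) (k : ℕ) : IsStarProjection (block e k) :=
  ⟨by rw [IsIdempotentElem, block_mul_block, if_pos rfl], star_block e k⟩

lemma norm_proj_sq_eq_sum (e : HilbertBasis ℕ 𝕜 X) (N : ℕ) (y : X) :
    ‖proj e (2 ^ N) y‖ ^ 2 = ∑ k ∈ Finset.range (N + 1), ‖block e k y‖ ^ 2 := by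
  rw [norm_sq_eq_re_inner_of_isStarProjection (isStarProjection_proj e _), ← sum_block,
    sum_apply, sum_inner, map_sum]
  exact Finset.sum_congr rfl fun k _ =>
    (norm_sq_eq_re_inner_of_isStarProjection (isStarProjection_block e k) y).symm

omit [CompleteSpace X] in
lemma cross_eq_sum (e : HilbertBasis ℕ 𝕜 X) (A : X →L[𝕜] X) (n : ℕ) :
    cross e A n = ∑ k ∈ Finset.range (2 * n + 1), block e k * A * proj e (2 ^ (2 * n - k)) := by
  rw [Finset.sum_range_succ', cross]
  congr 1
  rw [Finset.range_eq_Ico, Finset.sum_Ico_add' (fun k => block e k * A * proj e (2 ^ (2 * n - k)))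
    0 (2 * n) 1]
  refine Finset.sum_congr (by ext; simp) fun k hk => ?_
  rw [Finset.mem_Ico] at hk
  obtain ⟨j, rfl⟩ : ∃ j, k = j + 1 := ⟨k - 1, by omega⟩
  rfl

/-- The cross consists of the pairs of blocks (k, l) with k + l ≤ 2n, a set symmetric in k and l.
Estimates for B*B therefore carry over to BB*. -/
lemma star_cross (e : HilbertBasis ℕ 𝕜 X) (A : X →L[𝕜] X) (n : ℕ) :
    star (cross e A n) = cross e (star A) n := by
  rw [cross_eq_sum, cross_eq_sum, star_sum]
  simp only [star_mul, star_proj, star_block]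
  simp only [← sum_block, Finset.sum_mul, Finset.mul_sum]
  rw [Finset.sum_comm' (t' := Finset.range (2 * n + 1))
    (s' := fun l => Finset.range (2 * n - l + 1))]
  · exact Finset.sum_congr rfl fun l _ => Finset.sum_congr rfl fun k _ => (mul_assoc _ _ _).symm
  · intro x y; simp only [Finset.mem_range]; omega

omit [CompleteSpace X] in
lemma block_mul_cross (e : HilbertBasis ℕ 𝕜 X) (A : X →L[𝕜] X) {n k : ℕ} (hk : k < 2 * n + 1) :
    block e k * cross e A n = block e k * A * proj e (2 ^ (2 * n - k)) := by
  rw [cross_eq_sum, Finset.mul_sum, Finset.sum_eq_single k]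
  · rw [← mul_assoc, ← mul_assoc, block_mul_block, if_pos rfl]
  · intro l _ hl
    rw [← mul_assoc, ← mul_assoc, block_mul_block, if_neg hl.symm, zero_mul, zero_mul]
  · intro h; exact absurd (Finset.mem_range.2 hk) h

omit [CompleteSpace X] in
lemma proj_mul_cross (e : HilbertBasis ℕ 𝕜 X) (A : X →L[𝕜] X) (n : ℕ) :
    proj e (2 ^ (2 * n)) * cross e A n = cross e A n := by
  conv_lhs => rw [← sum_block, Finset.sum_mul]
  rw [cross_eq_sum]
  refine Finset.sum_congr rfl fun k hk => ?_
  rw [← cross_eq_sum, block_mul_cross e A (Finset.mem_range.1 hk)]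

/-- The conditions on the decay of an operator along a basis in the definition of `MemH`, without
compactness. -/
structure Decay (e : HilbertBasis ℕ 𝕜 X) (r : ℝ) (A : X →L[𝕜] X) : Prop where
  norm_le : ‖A‖ ≤ 1
  left : ∀ m : ℕ, 1 ≤ m → ‖(1 - proj e m) * A‖ ≤ (m : ℝ) ^ (-r)
  right : ∀ m : ℕ, 1 ≤ m → ‖A * (1 - proj e m)‖ ≤ (m : ℝ) ^ (-r)

omit [CompleteSpace X] in
lemma MemH.decay {e : HilbertBasis ℕ 𝕜 X} {r : ℝ} {A : X →L[𝕜] X} (hA : MemH e r A) :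
    Decay e r A := ⟨hA.norm_le, hA.left, hA.right⟩

namespace Decay

variable {e : HilbertBasis ℕ 𝕜 X} {r : ℝ} {A : X →L[𝕜] X}

lemma star_right (hA : Decay e r A) : Decay e r (star A) := by
  refine ⟨by rw [opNorm_star]; exact hA.norm_le, fun m hm => ?_, fun m hm => ?_⟩
  · rw [← opNorm_star, star_mul, star_star, star_sub, star_one, star_proj]
    exact hA.right m hm
  · rw [← opNorm_star, star_mul, star_star, star_sub, star_one, star_proj]
    exact hA.left m hm

lemma two_pow_rpow (r : ℝ) (j : ℕ) : (((2 ^ j : ℕ) : ℝ)) ^ (-r) = ((2 : ℝ) ^ (-r)) ^ j := by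
  rw [Nat.cast_pow, Nat.cast_ofNat, ← Real.rpow_natCast, ← Real.rpow_natCast, ← Real.rpow_mul
    zero_le_two, ← Real.rpow_mul zero_le_two, mul_comm]

lemma norm_block_succ_mul_le (hA : Decay e r A) (k : ℕ) :
    ‖block e (k + 1) * A‖ ≤ ((2 : ℝ) ^ (-r)) ^ k := by
  have h : block e (k + 1) = block e (k + 1) * (1 - proj e (2 ^ k)) := by
    rw [mul_sub, mul_one, block_mul_proj_of_lt e (Nat.lt_succ_self k), sub_zero]
  rw [h, mul_assoc]
  calc _ ≤ ‖block e (k + 1)‖ * ‖(1 - proj e (2 ^ k)) * A‖ := norm_mul_le _ _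
    _ ≤ 1 * ((2 : ℝ) ^ (-r)) ^ k := by
        refine mul_le_mul (norm_le_one_of_isStarProjection (isStarProjection_block e _)) ?_
          (norm_nonneg _) zero_le_one
        rw [← two_pow_rpow]
        exact hA.left _ Nat.one_le_two_pow
    _ = _ := one_mul _

lemma norm_block_mul_mul_le (hA : Decay e r A) (k j : ℕ) :
    ‖block e k * A * (1 - proj e (2 ^ j))‖ ≤ ((2 : ℝ) ^ (-r)) ^ j := by
  rw [mul_assoc]
  calc _ ≤ ‖block e k‖ * ‖A * (1 - proj e (2 ^ j))‖ := norm_mul_le _ _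
    _ ≤ 1 * ((2 : ℝ) ^ (-r)) ^ j := by
        refine mul_le_mul (norm_le_one_of_isStarProjection (isStarProjection_block e _)) ?_
          (norm_nonneg _) zero_le_one
        rw [← two_pow_rpow]
        exact hA.right _ Nat.one_le_two_pow
    _ = _ := one_mul _

/-- Bounds for the norms of the rows of `A`, and for the parts of them that are truncated in the
hyperbolic cross. -/
lemma exists_block_bounds (hA : Decay e r A) (hr : 0 < r) (n : ℕ) :
    ∃ a b : ℕ → ℝ, (∀ k < 2 * n + 1, ‖block e k * A‖ ≤ a k ∧
        ‖block e k * A * (1 - proj e (2 ^ (2 * n - k)))‖ ≤ b k) ∧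
      ∑ k ∈ Finset.range (2 * n + 1), a k * b k
        ≤ (n * ((2 : ℝ) ^ r + 1) + 1) * ((2 : ℝ) ^ (-r)) ^ (2 * n) := by
  set t := (2 : ℝ) ^ (-r) with ht
  have ht0 : 0 < t := by positivity
  have ht1 : t ≤ 1 := Real.rpow_le_one_of_one_le_of_nonpos one_le_two (by linarith)
  have hRt : (2 : ℝ) ^ r * t = 1 := by
    rw [ht, ← Real.rpow_add two_pos]; simp
  set a : ℕ → ℝ := fun k => if k = 0 then 1 else t ^ (k - 1)
  -- Rows up to n use the column decay of A, later rows the decay of the row itself. Each product a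
  -- k * b k is then at most 2^r t^(2n) for 1 ≤ k ≤ n and at most t^(2n) otherwise, although b k
  -- alone is only of order t^n near k = n.
  set b : ℕ → ℝ := fun k => if k ≤ n then t ^ (2 * n - k) else t ^ (k - 1)
  refine ⟨a, b, fun k hk => ?_, ?_⟩
  · have ha : ‖block e k * A‖ ≤ a k := by
      cases k with
      | zero =>
        simp only [a, if_pos rfl]
        calc _ ≤ ‖block e 0‖ * ‖A‖ := norm_mul_le _ _
          _ ≤ 1 * 1 := mul_le_mul (norm_le_one_of_isStarProjection (isStarProjection_block e 0))
              hA.norm_le (norm_nonneg _) zero_le_one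
          _ = 1 := one_mul 1
      | succ k => simpa [a] using hA.norm_block_succ_mul_le k
    refine ⟨ha, ?_⟩
    by_cases h : k ≤ n
    · simp only [b, if_pos h]
      exact hA.norm_block_mul_mul_le k _
    · simp only [b, if_neg h]
      simp only [a, if_neg (by omega : ¬ k = 0)] at ha
      calc _ ≤ ‖block e k * A‖ * ‖1 - proj e (2 ^ (2 * n - k))‖ := norm_mul_le _ _
        _ ≤ t ^ (k - 1) * 1 := mul_le_mul ha (norm_le_one_of_isStarProjection
            (isStarProjection_proj e _).one_sub) (norm_nonneg _) (by positivity)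
        _ = _ := mul_one _
  · rw [Finset.sum_range_succ', two_mul, Finset.sum_range_add]
    have h1 : ∀ k ∈ Finset.range n, a (k + 1) * b (k + 1) ≤ (2 : ℝ) ^ r * t ^ (n + n) := by
      intro k hk
      rw [Finset.mem_range] at hk
      simp only [a, b, if_neg (Nat.succ_ne_zero k), if_pos (Nat.succ_le_of_lt hk),
        Nat.add_sub_cancel]
      rw [← pow_add]
      have h2 : t ^ (n + n) = t ^ (k + (2 * n - (k + 1))) * t := by
        rw [← pow_succ]; congr 1; omega
      rw [h2]
      apply le_of_eq
      linear_combination (-(t ^ (k + (2 * n - (k + 1))))) * hRt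
    have h2 : ∀ k ∈ Finset.range n, a (n + k + 1) * b (n + k + 1) ≤ t ^ (n + n) := by
      intro k hk
      simp only [a, b, if_neg (Nat.succ_ne_zero (n + k)),
        if_neg (by omega : ¬ n + k + 1 ≤ n), Nat.add_sub_cancel]
      rw [← pow_add]
      exact pow_le_pow_of_le_one ht0.le ht1 (by omega)
    have h3 : a 0 * b 0 = t ^ (n + n) := by simp [a, b, two_mul]
    have s1 := Finset.sum_le_sum h1
    have s2 := Finset.sum_le_sum h2
    rw [Finset.sum_const, Finset.card_range, nsmul_eq_mul] at s1 s2
    rw [h3]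
    linarith

omit [CompleteSpace X] in
lemma norm_sub_proj_mul_le (hA : Decay e r A) (n : ℕ) :
    ‖(1 - proj e (2 ^ (2 * n))) * A‖ ≤ ((2 : ℝ) ^ (-r)) ^ (2 * n) := by
  rw [← two_pow_rpow]
  exact hA.left _ Nat.one_le_two_pow

/-- By Pythagoras over the row blocks both squared norms split into rows, where
`norm_proj_apply_sub` applies. The rows of A beyond 2^(2n) contribute the term u² to the second
bound. -/
lemma cross_form (hA : Decay e r A) (hr : 0 < r) (n : ℕ) {σ u : ℝ}
    (hσ : (n * ((2 : ℝ) ^ r + 1) + 1) * ((2 : ℝ) ^ (-r)) ^ (2 * n) ≤ σ)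
    (hu : ((2 : ℝ) ^ (-r)) ^ (2 * n) ≤ u) (x : X) :
    ‖cross e A n x‖ ^ 2 - ‖A x‖ ^ 2 ≤ σ * ‖x‖ ^ 2 ∧
      ‖A x‖ ^ 2 - ‖cross e A n x‖ ^ 2 ≤ (13 / 10 * σ + u ^ 2) * ‖x‖ ^ 2 := by
  obtain ⟨a, b, hab, hsum⟩ := hA.exists_block_bounds hr n
  replace hsum := hsum.trans hσ
  have hcross : ‖cross e A n x‖ ^ 2 = ∑ k ∈ Finset.range (2 * n + 1),
      ‖(block e k * A * proj e (2 ^ (2 * n - k))) x‖ ^ 2 := by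
    have h := norm_proj_sq_eq_sum e (2 * n) (cross e A n x)
    rw [← mul_apply_eq_comp, proj_mul_cross] at h
    rw [h]
    refine Finset.sum_congr rfl fun k hk => ?_
    rw [← mul_apply_eq_comp, block_mul_cross e A (Finset.mem_range.1 hk)]
  have hAx : ‖A x‖ ^ 2 = ∑ k ∈ Finset.range (2 * n + 1), ‖(block e k * A) x‖ ^ 2
      + ‖((1 - proj e (2 ^ (2 * n))) * A) x‖ ^ 2 := by
    rw [norm_sq_eq_of_isStarProjection (isStarProjection_proj e (2 ^ (2 * n))) (A x),
      norm_proj_sq_eq_sum]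
    simp [sub_mul]
  have htail : ‖((1 - proj e (2 ^ (2 * n))) * A) x‖ ^ 2 ≤ u ^ 2 * ‖x‖ ^ 2 := by
    rw [← mul_pow]
    exact pow_le_pow_left₀ (norm_nonneg _)
      (ContinuousLinearMap.le_of_opNorm_le _ ((hA.norm_sub_proj_mul_le n).trans hu) x) 2
  have hblock := fun k (hk : k ∈ Finset.range (2 * n + 1)) =>
    norm_proj_apply_sub (proj e (2 ^ (2 * n - k))) (block e k * A) (isStarProjection_proj e _)
      (hab k (Finset.mem_range.1 hk)).1 (hab k (Finset.mem_range.1 hk)).2 x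
  have h1 := Finset.sum_le_sum fun k hk => (hblock k hk).1
  have h2 := Finset.sum_le_sum fun k hk => (hblock k hk).2
  rw [Finset.sum_sub_distrib, ← Finset.sum_mul] at h1 h2
  rw [← Finset.mul_sum] at h2
  have hx := sq_nonneg ‖x‖
  have h3 := mul_le_mul_of_nonneg_right hsum hx
  rw [hcross, hAx]
  constructor
  · nlinarith [sq_nonneg ‖((1 - proj e (2 ^ (2 * n))) * A) x‖]
  · nlinarith

/-- Different row blocks do not interact, so B*(B - A) is a sum over rows of a retained part times a
truncated part, of norm at most a k * b k. -/
lemma norm_star_cross_mul_sub_le (hA : Decay e r A) (hr : 0 < r) (n : ℕ) {σ : ℝ}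
    (hσ : (n * ((2 : ℝ) ^ r + 1) + 1) * ((2 : ℝ) ^ (-r)) ^ (2 * n) ≤ σ) :
    ‖star (cross e A n) * (cross e A n - A)‖ ≤ σ := by
  obtain ⟨a, b, hab, hsum⟩ := hA.exists_block_bounds hr n
  set B := cross e A n with hB
  have h1 : star B * (B - A) = ∑ k ∈ Finset.range (2 * n + 1),
      star (block e k * A * proj e (2 ^ (2 * n - k)))
        * (-(block e k * A * (1 - proj e (2 ^ (2 * n - k))))) := by
    have h2 : star B = star B * proj e (2 ^ (2 * n)) := by
      conv_lhs => rw [hB, ← proj_mul_cross, star_mul, star_proj]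
    rw [h2, ← sum_block, Finset.mul_sum, Finset.sum_mul]
    refine Finset.sum_congr rfl fun k hk => ?_
    have hk' := Finset.mem_range.1 hk
    have h3 : star B * block e k
        = star (block e k * A * proj e (2 ^ (2 * n - k))) * block e k := by
      rw [← block_mul_cross e A hk', star_mul, star_block, mul_assoc, block_mul_block, if_pos rfl]
    rw [h3, mul_assoc]
    congr 1
    rw [mul_sub, block_mul_cross e A hk', mul_sub, mul_one]
    abel
  rw [h1]
  refine (norm_sum_le _ _).trans ((Finset.sum_le_sum fun k hk => ?_).trans (hsum.trans hσ))
  have hk' := hab k (Finset.mem_range.1 hk)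
  refine (norm_mul_le _ _).trans ?_
  rw [opNorm_star, norm_neg]
  refine mul_le_mul ?_ hk'.2 (norm_nonneg _) ((norm_nonneg _).trans hk'.1)
  calc _ ≤ ‖block e k * A‖ * ‖proj e (2 ^ (2 * n - k))‖ := norm_mul_le _ _
    _ ≤ a k * 1 := mul_le_mul hk'.1 (norm_le_one_of_isStarProjection (isStarProjection_proj e _))
        (norm_nonneg _) ((norm_nonneg _).trans hk'.1)
    _ = a k := mul_one _

end Decay

end Cross

section Approximation

variable {𝕜 : Type*} [RCLike 𝕜] {X : Type*} [NormedAddCommGroup X] [InnerProductSpace 𝕜 X]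
  [CompleteSpace X]

/-! ### Functional calculus for approximating operators -/

/-- An operator and its adjoint have the same norm; the form with squares avoids square roots of the
constant. -/
lemma norm_apply_sq_le_of_star {Z : X →L[𝕜] X} {c : ℝ} (h : ∀ v, ‖star Z v‖ ^ 2 ≤ c * ‖v‖ ^ 2)
    (x : X) : ‖Z x‖ ^ 2 ≤ c * ‖x‖ ^ 2 := by
  have h1 : ‖Z x‖ ^ 2 ≤ ‖star Z (Z x)‖ * ‖x‖ := by
    rw [← re_inner_star_mul_self, mul_apply_eq_comp]
    exact (RCLike.re_le_norm _).trans (norm_inner_le_norm _ _)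
  have h2 := h (Z x)
  rcases (norm_nonneg (Z x)).eq_or_lt with h0 | h0
  · have h3 := h x
    have hc : 0 ≤ c * ‖x‖ ^ 2 := (sq_nonneg _).trans h3
    rw [← h0]; simpa using hc
  · have h3 : (‖Z x‖ ^ 2) ^ 2 ≤ ‖Z x‖ ^ 2 * (c * ‖x‖ ^ 2) := by
      calc _ ≤ (‖star Z (Z x)‖ * ‖x‖) ^ 2 := pow_le_pow_left₀ (sq_nonneg _) h1 2
        _ = ‖star Z (Z x)‖ ^ 2 * ‖x‖ ^ 2 := mul_pow _ _ _
        _ ≤ (c * ‖Z x‖ ^ 2) * ‖x‖ ^ 2 := by gcongr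
        _ = _ := by ring
    rw [sq (‖Z x‖ ^ 2)] at h3
    exact le_of_mul_le_mul_left h3 (by positivity)

omit [CompleteSpace X] in
lemma opEval_X_mul_apply (T : X →L[𝕜] X) (p : ℝ[X]) (v : X) :
    opEval T (Polynomial.X * p) v = T (opEval T p v) := by
  rw [map_mul, opEval_X, mul_apply_eq_comp]

omit [CompleteSpace X] in
lemma FormIn.norm_le {T : X →L[𝕜] X} {d : ℝ} (hd : 0 ≤ d) (hT : FormIn T (-d) d) : ‖T‖ ≤ d := by
  refine ContinuousLinearMap.opNorm_le_bound _ hd fun u => ?_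
  have h := norm_opEval_apply_le hT (p := Polynomial.X) (M := d)
    (fun t ht => by rw [eval_X]; exact abs_le.2 ht) u
  rwa [opEval_X] at h

lemma formIn_star_mul_self {Z : X →L[𝕜] X} {c : ℝ} (h : ∀ x, ‖Z x‖ ^ 2 ≤ c * ‖x‖ ^ 2) :
    FormIn (star Z * Z) 0 c := by
  refine ⟨fun u v => ?_, fun u => ?_⟩
  · rw [mul_apply_eq_comp, mul_apply_eq_comp, inner_star_left, inner_star_right]
  · rw [re_inner_star_mul_self, zero_mul]
    exact ⟨sq_nonneg _, h u⟩

lemma formIn_mul_star_self {Z : X →L[𝕜] X} {c : ℝ} (h : ∀ x, ‖star Z x‖ ^ 2 ≤ c * ‖x‖ ^ 2) :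
    FormIn (Z * star Z) 0 c := by
  have := formIn_star_mul_self h
  rwa [star_star] at this

lemma norm_star_mul_self_sub_le {Y Z : X →L[𝕜] X} {d : ℝ} (hd : 0 ≤ d)
    (h : ∀ x, ‖Y x‖ ^ 2 - ‖Z x‖ ^ 2 ≤ d * ‖x‖ ^ 2 ∧ ‖Z x‖ ^ 2 - ‖Y x‖ ^ 2 ≤ d * ‖x‖ ^ 2) :
    ‖star Y * Y - star Z * Z‖ ≤ d := by
  refine FormIn.norm_le hd ⟨fun u v => ?_, fun u => ?_⟩
  · simp only [sub_apply, inner_sub_left, inner_sub_right, mul_apply_eq_comp, inner_star_left,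
      inner_star_right]
  · rw [sub_apply, inner_sub_left, map_sub, re_inner_star_mul_self, re_inner_star_mul_self]
    exact ⟨by linarith [(h u).2], (h u).1⟩

lemma star_opEval {T : X →L[𝕜] X} {a b : ℝ} (hT : FormIn T a b) (p : ℝ[X]) :
    star (opEval T p) = opEval T p := by
  rw [ContinuousLinearMap.star_eq_adjoint, eq_comm, ContinuousLinearMap.eq_adjoint_iff]
  exact inner_opEval_left hT.1 p

/-- `B` approximates the contraction `A` in such a way that `B* B` and `B B*` are close to `A* A`
and `A A*`. -/
structure Approximates (A B Q : X →L[𝕜] X) (s d u : ℝ) : Prop where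
  nonneg : 0 ≤ s
  norm_le : ‖A‖ ≤ 1
  isStarProjection : IsStarProjection Q
  mul_eq : Q * B = B
  left_sq : ∀ x, ‖star B x‖ ^ 2 ≤ (1 + s) * ‖x‖ ^ 2
  right_sq : ∀ x, ‖B x‖ ^ 2 ≤ (1 + s) * ‖x‖ ^ 2
  left_dist : ‖B * star B - A * star A‖ ≤ d
  right_dist : ‖star B * B - star A * A‖ ≤ d
  defect : ‖star B * (B - A)‖ ≤ s
  tail : ‖(1 - Q) * A‖ ≤ u

lemma Decay.approximates {e : HilbertBasis ℕ 𝕜 X} {r : ℝ} {A : X →L[𝕜] X} (hA : Decay e r A)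
    (hr : 0 < r) (n : ℕ) {s d u : ℝ}
    (hs : (n * ((2 : ℝ) ^ r + 1) + 1) * ((2 : ℝ) ^ (-r)) ^ (2 * n) ≤ s)
    (hu : ((2 : ℝ) ^ (-r)) ^ (2 * n) ≤ u) (hd : 13 / 10 * s + u ^ 2 ≤ d) :
    Approximates A (cross e A n) (proj e (2 ^ (2 * n))) s d u := by
  have hs0 : 0 ≤ s := le_trans (by positivity) hs
  have hd0 : 0 ≤ d := le_trans (by positivity) hd
  have hcontr : ∀ {Z : X →L[𝕜] X}, ‖Z‖ ≤ 1 → ∀ x, ‖Z x‖ ^ 2 ≤ ‖x‖ ^ 2 := fun hZ x =>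
    pow_le_pow_left₀ (norm_nonneg _) ((ContinuousLinearMap.le_of_opNorm_le _ hZ x).trans_eq
      (one_mul _)) 2
  have hform := fun {Z : X →L[𝕜] X} (hZ : Decay e r Z) (x : X) => hZ.cross_form hr n hs hu x
  have hsd : ∀ x : X, s * ‖x‖ ^ 2 ≤ d * ‖x‖ ^ 2 := fun x =>
    mul_le_mul_of_nonneg_right (by nlinarith [sq_nonneg u]) (sq_nonneg _)
  have hdd : ∀ x : X, (13 / 10 * s + u ^ 2) * ‖x‖ ^ 2 ≤ d * ‖x‖ ^ 2 := fun x =>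
    mul_le_mul_of_nonneg_right hd (sq_nonneg _)
  have hsq : ∀ {Z : X →L[𝕜] X}, Decay e r Z → ∀ x, ‖cross e Z n x‖ ^ 2 ≤ (1 + s) * ‖x‖ ^ 2 :=
    fun hZ x => by linarith [(hform hZ x).1, hcontr hZ.norm_le x]
  have hdist : ∀ {Z : X →L[𝕜] X}, Decay e r Z →
      ‖star (cross e Z n) * cross e Z n - star Z * Z‖ ≤ d := fun hZ =>
    norm_star_mul_self_sub_le hd0 fun x =>
      ⟨(hform hZ x).1.trans (hsd x), (hform hZ x).2.trans (hdd x)⟩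
  refine ⟨hs0, hA.norm_le, isStarProjection_proj e _, proj_mul_cross e A n, ?_, hsq hA, ?_,
    hdist hA, hA.norm_star_cross_mul_sub_le hr n hs, (hA.norm_sub_proj_mul_le n).trans hu⟩
  · rw [star_cross]; exact hsq hA.star_right
  · have h := hdist hA.star_right
    rwa [← star_cross, star_star, star_star] at h

namespace Approximates

variable {A B Q : X →L[𝕜] X} {s d u : ℝ}

lemma formIn_left (h : Approximates A B Q s d u) : FormIn (B * star B) 0 (1 + s) :=
  formIn_mul_star_self h.left_sq

lemma formIn_right (h : Approximates A B Q s d u) : FormIn (star B * B) 0 (1 + s) :=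
  formIn_star_mul_self h.right_sq

lemma formIn_limit_right (h : Approximates A B Q s d u) : FormIn (star A * A) 0 (1 + s) := by
  refine formIn_star_mul_self fun x => ?_
  calc ‖A x‖ ^ 2 ≤ (1 * ‖x‖) ^ 2 :=
        pow_le_pow_left₀ (norm_nonneg _) (ContinuousLinearMap.le_of_opNorm_le _ h.norm_le x) 2
    _ ≤ _ := by nlinarith [h.nonneg, sq_nonneg ‖x‖]

lemma formIn_limit_left (h : Approximates A B Q s d u) : FormIn (A * star A) 0 (1 + s) := by
  refine formIn_mul_star_self fun x => ?_
  calc ‖star A x‖ ^ 2 ≤ (1 * ‖x‖) ^ 2 :=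
        pow_le_pow_left₀ (norm_nonneg _) (ContinuousLinearMap.le_of_opNorm_le _
          ((opNorm_star A).trans_le h.norm_le) x) 2
    _ ≤ _ := by nlinarith [h.nonneg, sq_nonneg ‖x‖]

lemma dist_nonneg (h : Approximates A B Q s d u) : 0 ≤ d := (norm_nonneg _).trans h.left_dist

lemma norm_opEval_sub_le (h : Approximates A B Q s d u) {S T : X →L[𝕜] X}
    (hS : FormIn S 0 (1 + s)) (hT : FormIn T 0 (1 + s)) (hST : ‖S - T‖ ≤ d) {p : ℝ[X]} {k : ℕ}
    (hk : 1 ≤ k) (hp : p.natDegree ≤ k) {M : ℝ}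
    (hM : ∀ t ∈ Set.Icc (0 : ℝ) (1 + s), |p.eval t| ≤ M) (v : X) :
    ‖opEval S p v - opEval T p v‖ ≤ 2 * k ^ 2 * M * d * ‖v‖ := by
  have hs := h.nonneg
  have hM0 : 0 ≤ M := (abs_nonneg _).trans (hM 0 ⟨le_rfl, by linarith⟩)
  refine (AdaptiveCross.norm_opEval_sub_le (by linarith) hS hT hST hk hp hM v).trans ?_
  have := h.dist_nonneg
  gcongr
  exact div_le_self (by positivity) (by linarith)

/-- The residual polynomials of `B B*` and `A A*` are close on the range of `A`. -/
lemma norm_opEval_sub_apply_sq_le (h : Approximates A B Q s d u) {p : ℝ[X]} {k : ℕ}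
    (hk : 1 ≤ k) (hp : p.natDegree ≤ k) {M M' : ℝ}
    (hM : ∀ t ∈ Set.Icc (0 : ℝ) (1 + s), |p.eval t| ≤ M)
    (hM' : ∀ t ∈ Set.Icc (0 : ℝ) (1 + s), |t * p.eval t| ≤ M') (x : X) :
    ‖opEval (B * star B) p (A x) - opEval (A * star A) p (A x)‖ ^ 2
      ≤ (2 * k ^ 2 * M * d) * ((2 * (k + 1) ^ 2 * M' + M) * d) * ‖x‖ ^ 2 := by
  set S := B * star B
  set T := A * star A
  set D := opEval S p - opEval T p with hD
  have hs := h.nonneg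
  have hd0 := h.dist_nonneg
  have hM0 : 0 ≤ M := (abs_nonneg _).trans (hM 0 ⟨le_rfl, by linarith⟩)
  have hDv : ∀ v, ‖D v‖ ≤ 2 * k ^ 2 * M * d * ‖v‖ :=
    h.norm_opEval_sub_le h.formIn_left h.formIn_limit_left h.left_dist hk hp hM
  -- T D equals S p(S) - T p(T) minus (S - T) p(S). Markov's inequality for X p has the bound M',
  -- which for residual polynomials is of order (k + 1)^(-2) and cancels the squared degree.
  have hTDv : ∀ v, ‖T (D v)‖ ≤ (2 * (k + 1) ^ 2 * M' + M) * d * ‖v‖ := by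
    intro v
    have h1 : T (D v) = (opEval S (Polynomial.X * p) v - opEval T (Polynomial.X * p) v)
        - (S - T) (opEval S p v) := by
      rw [opEval_X_mul_apply, opEval_X_mul_apply, hD, sub_apply, sub_apply, map_sub]
      abel
    have h2 := h.norm_opEval_sub_le h.formIn_left h.formIn_limit_left h.left_dist
      (p := Polynomial.X * p) (k := k + 1) (by omega)
      (natDegree_mul_le.trans (by rw [natDegree_X]; omega)) (M := M')
      (fun t ht => by rw [eval_mul, eval_X]; exact hM' t ht) v
    have h3 : ‖(S - T) (opEval S p v)‖ ≤ d * (M * ‖v‖) :=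
      (ContinuousLinearMap.le_of_opNorm_le _ h.left_dist _).trans
        (mul_le_mul_of_nonneg_left (norm_opEval_apply_le h.formIn_left hM v) hd0)
    rw [h1]
    refine (norm_sub_le _ _).trans ?_
    push_cast at h2
    linarith
  have hstar : star (D * A) = star A * D := by
    rw [star_mul, hD, star_sub, star_opEval h.formIn_left, star_opEval h.formIn_limit_left]
  refine norm_apply_sq_le_of_star (Z := D * A) (fun v => ?_) x
  -- The adjoint of D A is A* D, and ‖A* D v‖² = ⟨T D v, D v⟩ is bounded by the product of the
  -- bounds for T D and D. The square root of this product carries k instead of k².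
  rw [hstar, mul_apply_eq_comp, ← re_inner_star_mul_self, star_star]
  calc _ ≤ ‖T (D v)‖ * ‖D v‖ := (RCLike.re_le_norm _).trans (norm_inner_le_norm _ _)
    _ ≤ ((2 * (k + 1) ^ 2 * M' + M) * d * ‖v‖) * (2 * k ^ 2 * M * d * ‖v‖) :=
        mul_le_mul (hTDv v) (hDv v) (norm_nonneg _) ((norm_nonneg _).trans (hTDv v))
    _ = _ := by ring

/-- The same passage to the adjoint: ‖A* p(S) v‖² = ⟨A A* p(S) v, p(S) v⟩, where A A* is replaced by
S at the cost d. -/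
lemma norm_opEval_apply_sq_le (h : Approximates A B Q s d u) {p : ℝ[X]} {M M' : ℝ}
    (hM : ∀ t ∈ Set.Icc (0 : ℝ) (1 + s), |p.eval t| ≤ M)
    (hM' : ∀ t ∈ Set.Icc (0 : ℝ) (1 + s), |t * p.eval t| ≤ M') (x : X) :
    ‖opEval (B * star B) p (A x)‖ ^ 2 ≤ (M * M' + M ^ 2 * d) * ‖x‖ ^ 2 := by
  set S := B * star B
  set T := A * star A
  have hs := h.nonneg
  have hd0 := h.dist_nonneg
  have hM0 : 0 ≤ M := (abs_nonneg _).trans (hM 0 ⟨le_rfl, by linarith⟩)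
  refine norm_apply_sq_le_of_star (Z := opEval S p * A) (fun v => ?_) x
  rw [star_mul, star_opEval h.formIn_left, mul_apply_eq_comp, ← re_inner_star_mul_self, star_star]
  have h1 : ‖opEval S p v‖ ≤ M * ‖v‖ := norm_opEval_apply_le h.formIn_left hM v
  have h2 : ‖opEval S (Polynomial.X * p) v‖ ≤ M' * ‖v‖ := norm_opEval_apply_le h.formIn_left
    (fun t ht => by rw [eval_mul, eval_X]; exact hM' t ht) v
  have h3 : (A * star A) (opEval S p v)
      = opEval S (Polynomial.X * p) v - (S - T) (opEval S p v) := by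
    rw [opEval_X_mul_apply, sub_apply]
    abel
  have h4 : ‖(A * star A) (opEval S p v)‖ ≤ M' * ‖v‖ + d * (M * ‖v‖) := by
    rw [h3]
    refine (norm_sub_le _ _).trans (add_le_add h2 ?_)
    exact (ContinuousLinearMap.le_of_opNorm_le _ h.left_dist _).trans
      (mul_le_mul_of_nonneg_left h1 hd0)
  calc _ ≤ ‖(A * star A) (opEval S p v)‖ * ‖opEval S p v‖ :=
        (RCLike.re_le_norm _).trans (norm_inner_le_norm _ _)
    _ ≤ (M' * ‖v‖ + d * (M * ‖v‖)) * (M * ‖v‖) :=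
        mul_le_mul h4 h1 (norm_nonneg _) ((norm_nonneg _).trans h4)
    _ = _ := by ring

lemma star_mul_eq (h : Approximates A B Q s d u) : star B * Q = star B := by
  conv_rhs => rw [← h.mul_eq, star_mul, h.isStarProjection.isSelfAdjoint.star_eq]

lemma proj_mul_opEval (h : Approximates A B Q s d u) (p : ℝ[X]) :
    Q * opEval (B * star B) p = opEval (B * star B) p * Q :=
  comp_opEval (by rw [← mul_assoc, h.mul_eq, mul_assoc, h.star_mul_eq]) p

lemma norm_proj_apply_le (h : Approximates A B Q s d u) (v : X) : ‖Q v‖ ≤ ‖v‖ :=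
  (ContinuousLinearMap.le_of_opNorm_le _
    (norm_le_one_of_isStarProjection h.isStarProjection) v).trans_eq (one_mul _)

lemma norm_opEval_proj_le (h : Approximates A B Q s d u) {p : ℝ[X]} {M : ℝ}
    (hM : ∀ t ∈ Set.Icc (0 : ℝ) (1 + s), |p.eval t| ≤ M) (f g : X) :
    ‖opEval (B * star B) p (Q g)‖ ≤ M * ‖f - g‖ + ‖opEval (B * star B) p f‖ := by
  set S := B * star B
  have h1 : opEval S p (Q g) = Q (opEval S p f) - opEval S p (Q (f - g)) := by
    rw [← mul_apply_eq_comp Q, h.proj_mul_opEval, mul_apply_eq_comp, ← map_sub, ← map_sub,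
      sub_sub_cancel]
  have hs := h.nonneg
  have hM0 : 0 ≤ M := (abs_nonneg _).trans (hM 0 ⟨le_rfl, by linarith⟩)
  rw [h1]
  refine (norm_sub_le _ _).trans ?_
  rw [add_comm]
  exact add_le_add ((norm_opEval_apply_le h.formIn_left hM _).trans
    (mul_le_mul_of_nonneg_left (h.norm_proj_apply_le _) hM0)) (h.norm_proj_apply_le _)

/-- Since p(0) = 1 and S vanishes on the range of 1 - Q, p(S) is the identity there. The part of A x
missed by Q is thus not damped and costs u‖x‖. The converse estimate `norm_opEval_proj_le` has no
such term because Q commutes with p(S) and is a contraction. -/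
lemma norm_opEval_le_add (h : Approximates A B Q s d u) {p : ℝ[X]} {M : ℝ} (hp : p.eval 0 = 1)
    (hM : ∀ t ∈ Set.Icc (0 : ℝ) (1 + s), |p.eval t| ≤ M) (x g : X) :
    ‖opEval (B * star B) p (A x)‖
      ≤ ‖opEval (B * star B) p (Q g)‖ + M * ‖A x - g‖ + u * ‖x‖ := by
  set S := B * star B with hS
  have hs := h.nonneg
  have hM0 : 0 ≤ M := (abs_nonneg _).trans (hM 0 ⟨le_rfl, by linarith⟩)
  have hker : opEval S p * (1 - Q) = 1 - Q := by
    have h0 : S * (1 - Q) = 0 := by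
      rw [hS, mul_assoc, mul_sub, mul_one, h.star_mul_eq, sub_self, mul_zero]
    have h2 := congrArg (opEval S) (divX_mul_X_add p)
    rw [map_add, map_mul, opEval_X, coeff_zero_eq_eval_zero, hp, map_one, map_one] at h2
    rw [← h2, add_mul, mul_assoc, h0, mul_zero, zero_add, one_mul]
  have h1 : opEval S p (A x) = opEval S p (Q g) + opEval S p (Q (A x - g))
      + ((1 - Q) * A) x := by
    have h2 : ((1 - Q) * A) x = opEval S p (A x - Q (A x)) := by
      have h3 := congrArg (fun Z : X →L[𝕜] X => Z (A x)) hker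
      simp only [mul_apply_eq_comp, sub_apply, one_apply_eq_self] at h3 ⊢
      rw [h3]
    rw [h2, ← map_add, ← map_add, map_sub Q]
    congr 1
    abel
  rw [h1]
  refine (norm_add_le _ _).trans (add_le_add ((norm_add_le _ _).trans (add_le_add le_rfl ?_))
    (ContinuousLinearMap.le_of_opNorm_le _ h.tail x))
  exact (norm_opEval_apply_le h.formIn_left hM _).trans
    (mul_le_mul_of_nonneg_left (h.norm_proj_apply_le _) hM0)

end Approximates

end Approximation

/-! ### Bounds for the residual polynomials -/

lemma opEval_real_apply (p : ℝ[X]) (t v : ℝ) :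
    opEval (𝕜 := ℝ) (X := ℝ) (t • (1 : ℝ →L[ℝ] ℝ)) p v = p.eval t * v := by
  rw [opEval_eq_sum _ p (Nat.lt_succ_self _), eval_eq_sum_range, Finset.sum_mul]
  refine Finset.sum_congr rfl fun i _ => ?_
  rw [_root_.smul_pow, one_pow]
  simp [mul_assoc]

/-- This is the operator Markov inequality on the one-dimensional space ℝ, for multiplication by t
and by 0. -/
lemma abs_eval_sub_eval_zero_le {p : ℝ[X]} {n : ℕ} (hn : 1 ≤ n) (hp : p.natDegree ≤ n) {M : ℝ}
    (hM : ∀ t ∈ Set.Icc (0 : ℝ) 1, |p.eval t| ≤ M) {t : ℝ} (ht : t ∈ Set.Icc (0 : ℝ) 1) :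
    |p.eval t - p.eval 0| ≤ 2 * n ^ 2 * M * t := by
  have hform : ∀ y ∈ Set.Icc (0 : ℝ) 1, FormIn (y • (1 : ℝ →L[ℝ] ℝ)) 0 1 := by
    intro y hy
    refine ⟨fun u v => by simp; ring, fun u => ?_⟩
    have h0 : y * (u * u) ≤ 1 * (u * u) := mul_le_mul_of_nonneg_right hy.2 (mul_self_nonneg u)
    have h1 := mul_nonneg hy.1 (mul_self_nonneg u)
    simp
    constructor <;> nlinarith
  have h := norm_opEval_sub_le (𝕜 := ℝ) (X := ℝ) one_pos (hform t ht)
    (hform 0 ⟨le_rfl, zero_le_one⟩) (d := t) (by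
      rw [← sub_smul, sub_zero, norm_smul, Real.norm_of_nonneg ht.1]
      exact (mul_le_mul_of_nonneg_left (ContinuousLinearMap.norm_id_le) ht.1).trans_eq (mul_one t))
    hn hp hM 1
  rw [opEval_real_apply, opEval_real_apply] at h
  simpa using h

section Residual

variable {w : ℝ → ℝ} {P : ℕ → ℝ[X]} {μ₀ : ℝ} {κ : ℝ → ℝ}

lemma IsMonicOrthogonal.eval_zero_resPoly (hw : IsWeight w) (hP : IsMonicOrthogonal w P) (k : ℕ) :
    (resPoly P k).eval 0 = 1 := by
  rw [eval_resPoly]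
  simp [residual, hP.eval_one_ne_zero hw k]

lemma IsMonicOrthogonal.mul_eval_solPoly (hw : IsWeight w) (hP : IsMonicOrthogonal w P) (k : ℕ)
    (t : ℝ) : t * (solPoly P k).eval t = 1 - (resPoly P k).eval t := by
  have h := congrArg (eval t) (hP.X_mul_solPoly hw k)
  simpa using h

lemma IsMonicOrthogonal.abs_eval_solPoly_le (hw : IsWeight w) (hP : IsMonicOrthogonal w P) {k : ℕ}
    (hk : 1 ≤ k) {M : ℝ} (hM : ∀ t ∈ Set.Icc (0 : ℝ) 1, |(resPoly P k).eval t| ≤ M)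
    {t : ℝ} (ht : t ∈ Set.Icc (0 : ℝ) 1) : |(solPoly P k).eval t| ≤ 2 * k ^ 2 * M := by
  have hclosed : IsClosed {t : ℝ | |(solPoly P k).eval t| ≤ 2 * k ^ 2 * M} :=
    isClosed_le (by fun_prop) continuous_const
  -- Dividing by t excludes t = 0, which is recovered by closedness.
  have hsub : Set.Ioc (0 : ℝ) 1 ⊆ {t : ℝ | |(solPoly P k).eval t| ≤ 2 * k ^ 2 * M} := by
    intro t ht
    have h := abs_eval_sub_eval_zero_le hk (hP.natDegree_resPoly_le k) hM (Set.Ioc_subset_Icc_self ht)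
    rw [hP.eval_zero_resPoly hw, abs_sub_comm, ← hP.mul_eval_solPoly hw, abs_mul,
      abs_of_pos ht.1, mul_comm] at h
    exact le_of_mul_le_mul_right h ht.1
  have h := closure_minimal hsub hclosed
  rw [closure_Ioc (zero_ne_one)] at h
  exact h ht

namespace HasQualification

lemma abs_resPoly_le (hκ : HasQualification P μ₀ κ) {k : ℕ} (hk : 1 ≤ k) :
    ∀ t ∈ Set.Icc (0 : ℝ) 1, |(resPoly P k).eval t| ≤ κ 0 := fun t ht => by
  rw [eval_resPoly]; exact hκ.bound_zero k hk t ht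

lemma abs_mul_resPoly_le (hκ : HasQualification P μ₀ κ) (hμ₀ : 2 ≤ μ₀) {k : ℕ} (hk : 1 ≤ k) :
    ∀ t ∈ Set.Icc (0 : ℝ) 1, |(Polynomial.X * resPoly P k).eval t| ≤ κ 2 / ((k : ℝ) + 1) ^ 2 :=
  fun t ht => by
    have h := hκ.bound 2 two_pos hμ₀ k hk t ht
    rw [div_self two_ne_zero, Real.rpow_one] at h
    rw [eval_mul, eval_X, eval_resPoly]
    exact_mod_cast h

lemma abs_resPoly_le_growth (hκ : HasQualification P μ₀ κ) (hP : IsMonicOrthogonal w P) {k : ℕ}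
    (hk : 1 ≤ k) {s z : ℝ} (hs : 0 ≤ s) (hz : 4 * (k : ℝ) ^ 2 * s ≤ z) (hz' : z ≤ 16 / 5) :
    ∀ t ∈ Set.Icc (0 : ℝ) (1 + s), |(resPoly P k).eval t| ≤ κ 0 * growth z := fun _ ht =>
  abs_eval_le_growth (hP.natDegree_resPoly_le k) (hκ.abs_resPoly_le hk) hz hz' ht.1 ht.2
    (le_trans (by positivity) hz)

lemma abs_mul_resPoly_le_growth (hκ : HasQualification P μ₀ κ) (hμ₀ : 2 ≤ μ₀)
    (hP : IsMonicOrthogonal w P) {k : ℕ} (hk : 1 ≤ k) {s z : ℝ} (hs : 0 ≤ s)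
    (hz : 4 * ((k : ℝ) + 1) ^ 2 * s ≤ z) (hz' : z ≤ 16 / 5) :
    ∀ t ∈ Set.Icc (0 : ℝ) (1 + s),
      |t * (resPoly P k).eval t| ≤ κ 2 / ((k : ℝ) + 1) ^ 2 * growth z := fun t ht => by
  have h := abs_eval_le_growth (m := k + 1) (p := Polynomial.X * resPoly P k) (s := s) (z := z)
    (natDegree_mul_le.trans (by rw [natDegree_X]; have := hP.natDegree_resPoly_le k; omega))
    (hκ.abs_mul_resPoly_le hμ₀ hk) (by push_cast; exact hz) hz' ht.1 ht.2
    (le_trans (by positivity) hz)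
  rwa [eval_mul, eval_X] at h

/-- Beyond 1 one has |r_k(t)| ≤ |t r_k(t)|, so the bound for t r_k can replace the growth bound for
r_k. No growth beyond κ 0 remains once (k + 1)² dominates κ 2 / κ 0. -/
lemma abs_resPoly_le_max (hκ : HasQualification P μ₀ κ) (hμ₀ : 2 ≤ μ₀)
    (hP : IsMonicOrthogonal w P) {k : ℕ} (hk : 1 ≤ k) {s z : ℝ} (hs : 0 ≤ s)
    (hz : 4 * ((k : ℝ) + 1) ^ 2 * s ≤ z) (hz' : z ≤ 16 / 5) :
    ∀ t ∈ Set.Icc (0 : ℝ) (1 + s),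
      |(resPoly P k).eval t| ≤ max (κ 0) (κ 2 / ((k : ℝ) + 1) ^ 2 * growth z) := fun t ht => by
  rcases le_total t 1 with h | h
  · exact (hκ.abs_resPoly_le hk t ⟨ht.1, h⟩).trans (le_max_left _ _)
  · refine le_trans ?_ ((hκ.abs_mul_resPoly_le_growth hμ₀ hP hk hs hz hz' t ht).trans
      (le_max_right _ _))
    rw [abs_mul, abs_of_nonneg ht.1]
    exact le_mul_of_one_le_left (abs_nonneg _) h

lemma abs_one_sub_le (hκ : HasQualification P μ₀ κ) (hμ₀ : 2 ≤ μ₀) (hw : IsWeight w)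
    (hP : IsMonicOrthogonal w P) :
    |1 - 2 * omega w P 0| ≤ κ 0 * min 1 (κ 2 / κ 0 / 4) := by
  have h1 := hκ.abs_resPoly_le le_rfl 1 ⟨zero_le_one, le_rfl⟩
  have h2 := hκ.abs_mul_resPoly_le hμ₀ le_rfl 1 ⟨zero_le_one, le_rfl⟩
  rw [hP.resPoly_one hw] at h1 h2
  simp only [eval_mul, eval_sub, eval_one, eval_C, eval_X, mul_one, one_mul, Nat.cast_one] at h1 h2
  have h0 : 0 < κ 0 := zero_lt_one.trans_le hκ.one_le
  rw [mul_min_of_nonneg _ _ h0.le, mul_one]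
  refine le_min h1 (h2.trans_eq ?_)
  field_simp
  norm_num

/-- The polynomial r_1 is linear, r_1(t) = (1 - 2ω_0) t - (t - 1), and both qualification bounds at
t = 1 restrict 1 - 2ω_0. This is sharper than the general growth estimate and needs no smallness of
s. -/
lemma abs_resPoly_one_le (hκ : HasQualification P μ₀ κ) (hμ₀ : 2 ≤ μ₀) (hw : IsWeight w)
    (hP : IsMonicOrthogonal w P) {s : ℝ} (hs : 0 ≤ s) :
    ∀ t ∈ Set.Icc (0 : ℝ) (1 + s), |(resPoly P 1).eval t| ≤ κ 0 * (1 +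
      max 0 (min 1 (κ 2 / κ 0 / 4) - 1 + (min 1 (κ 2 / κ 0 / 4) + 1) * s)) := fun t ht => by
  have h1 := hκ.abs_one_sub_le hμ₀ hw hP
  set m := min 1 (κ 2 / κ 0 / 4)
  set h := max 0 (m - 1 + (m + 1) * s)
  have h0 := hκ.one_le
  have hh0 : 0 ≤ h := le_max_left _ _
  have hh1 : m - 1 + (m + 1) * s ≤ h := le_max_right _ _
  rcases le_total t 1 with h2 | h2
  · refine (hκ.abs_resPoly_le le_rfl t ⟨ht.1, h2⟩).trans ?_
    nlinarith
  · rw [hP.resPoly_one hw]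
    simp only [eval_mul, eval_sub, eval_one, eval_C, eval_X]
    have h3 : 1 - 2 * omega w P 0 * t = (1 - 2 * omega w P 0) * t - (t - 1) := by ring
    rw [h3]
    have h4 : |(1 - 2 * omega w P 0) * t| ≤ κ 0 * m * (1 + s) := by
      rw [abs_mul, abs_of_nonneg ht.1]
      exact mul_le_mul h1 ht.2 ht.1 ((abs_nonneg _).trans h1)
    have h5 := abs_sub ((1 - 2 * omega w P 0) * t) (t - 1)
    rw [abs_of_nonneg (by linarith : 0 ≤ t - 1)] at h5
    have h6 := mul_le_mul_of_nonneg_left hh1 (by linarith : 0 ≤ κ 0)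
    nlinarith [ht.2]

end HasQualification

end Residual

section Iterates

variable {𝕜 : Type*} [RCLike 𝕜] {X : Type*} [NormedAddCommGroup X] [InnerProductSpace 𝕜 X]
  [CompleteSpace X] {w : ℝ → ℝ} {P : ℕ → ℝ[X]} {A B Q : X →L[𝕜] X} {s d u : ℝ}

/-! ### Residuals and errors of the iterates -/

namespace Approximates

lemma norm_residual_eq (h : Approximates A B Q s d u) (hw : IsWeight w)
    (hP : IsMonicOrthogonal w P) (g : X) (k : ℕ) :
    ‖B (iter w P B g k) - Q g‖ = ‖opEval (B * star B) (resPoly P k) (Q g)‖ := by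
  have h1 : B * opEval (star B * B) (solPoly P k) = opEval (B * star B) (solPoly P k) * B :=
    comp_opEval (mul_assoc _ _ _).symm _
  have h2 : B (iter w P B g k) = Q g - opEval (B * star B) (resPoly P k) (Q g) := by
    have h0 : star B g = star B (Q g) := by rw [← mul_apply_eq_comp, h.star_mul_eq]
    rw [iter_eq hw hP, ← ContinuousLinearMap.star_eq_adjoint, ← mul_apply_eq_comp, h1, h0]
    simp only [mul_apply_eq_comp]
    have h3 := congrArg (opEval (B * star B)) (hP.X_mul_solPoly hw k)
    rw [mul_comm, map_mul, opEval_X, map_sub, map_one] at h3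
    have h4 := congrArg (fun Z : X →L[𝕜] X => Z (Q g)) h3
    simpa only [mul_apply_eq_comp, sub_apply, one_apply_eq_self] using h4
  rw [h2, sub_sub_cancel_left, norm_neg]

/-- The product of p(B*B) B* with its adjoint, in the order adjoint first, corresponds under
intertwining to t p(t)²; it is computed here through the adjoint B p(B*B), so that only functions of
B*B occur. -/
lemma norm_opEval_star_apply_le (h : Approximates A B Q s d u) {p : ℝ[X]} {c : ℝ} (hc : 0 ≤ c)
    (hp : ∀ t ∈ Set.Icc (0 : ℝ) (1 + s), t * p.eval t ^ 2 ≤ c ^ 2) (v : X) :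
    ‖opEval (star B * B) p (star B v)‖ ≤ c * ‖v‖ := by
  refine le_of_sq_le_sq ?_ (by positivity)
  rw [mul_pow]
  refine norm_apply_sq_le_of_star (Z := opEval (star B * B) p * star B) (fun v => ?_) v
  rw [star_mul, star_star, star_opEval h.formIn_right, mul_apply_eq_comp,
    ← re_inner_star_mul_self]
  have h1 : inner 𝕜 ((star B * B) (opEval (star B * B) p v)) (opEval (star B * B) p v)
      = inner 𝕜 (opEval (star B * B) (p * (Polynomial.X * p)) v) v := by
    rw [← opEval_X_mul_apply, ← inner_opEval_left h.formIn_right.1, ← mul_apply_eq_comp, ← map_mul]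
  rw [h1]
  refine (RCLike.re_le_norm _).trans ((norm_inner_le_norm _ _).trans ?_)
  rw [sq ‖v‖, ← mul_assoc (c ^ 2)]
  refine mul_le_mul_of_nonneg_right ?_ (norm_nonneg _)
  refine norm_opEval_apply_le h.formIn_right (fun t ht => ?_) v
  rw [eval_mul, eval_mul, eval_X, show eval t p * (t * eval t p) = t * eval t p ^ 2 by ring,
    abs_of_nonneg (mul_nonneg ht.1 (sq_nonneg _))]
  exact hp t ht

/-- The error splits into the exact residual r_k(A*A)x, the change of r_k from A*A to B*B, the
consistency error g_k(B*B)B*(B - A)x and the propagated noise. The third part uses that B*(B - A),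
in contrast to B - A, has a bound of the order of s. -/
lemma norm_sub_iter_le (h : Approximates A B Q s d u) (hw : IsWeight w)
    (hP : IsMonicOrthogonal w P) (k : ℕ) {a c E : ℝ} (hc : 0 ≤ c)
    (ha : ∀ t ∈ Set.Icc (0 : ℝ) (1 + s), |(solPoly P k).eval t| ≤ a)
    (hac : ∀ t ∈ Set.Icc (0 : ℝ) (1 + s), t * (solPoly P k).eval t ^ 2 ≤ c ^ 2)
    (x g : X) (hE : ‖opEval (star B * B) (resPoly P k) x - opEval (star A * A) (resPoly P k) x‖ ≤ E) :
    ‖x - iter w P B g k‖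
      ≤ ‖opEval (star A * A) (resPoly P k) x‖ + E + a * (s * ‖x‖) + c * ‖A x - g‖ := by
  have hs := h.nonneg
  have ha0 : 0 ≤ a := (abs_nonneg _).trans (ha 0 ⟨le_rfl, by linarith⟩)
  set S := star B * B with hS
  set G := opEval S (solPoly P k) with hG
  have h1 : G (S x) = x - opEval S (resPoly P k) x := by
    have h3 := congrArg (opEval S) (hP.X_mul_solPoly hw k)
    rw [mul_comm, map_mul, opEval_X, map_sub, map_one] at h3
    have h4 := congrArg (fun Z : X →L[𝕜] X => Z x) h3
    simpa only [mul_apply_eq_comp, sub_apply, one_apply_eq_self] using h4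
  have h2 : x - iter w P B g k = opEval (star A * A) (resPoly P k) x
      + (opEval S (resPoly P k) x - opEval (star A * A) (resPoly P k) x)
      + G ((star B * (B - A)) x) + G (star B (A x - g)) := by
    have h5 : (star B * (B - A)) x = S x - star B (A x) := by
      rw [mul_sub, sub_apply, mul_apply_eq_comp (star B) A]
    rw [iter_eq hw hP, ← ContinuousLinearMap.star_eq_adjoint, h5, map_sub G, map_sub (star B),
      map_sub G, h1]
    abel
  rw [h2]
  refine (norm_add_le _ _).trans (add_le_add ((norm_add_le _ _).trans (add_le_add
    ((norm_add_le _ _).trans (add_le_add le_rfl hE)) ?_)) ?_)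
  · exact (norm_opEval_apply_le h.formIn_right ha _).trans
      (mul_le_mul_of_nonneg_left (ContinuousLinearMap.le_of_opNorm_le _ h.defect x) ha0)
  · exact h.norm_opEval_star_apply_le hc hac _

end Approximates

end Iterates

section Source

variable {𝕜 : Type*} [RCLike 𝕜] {X : Type*} [NormedAddCommGroup X] [InnerProductSpace 𝕜 X]

/-! ### Source conditions -/

lemma opEval_apply_of_eigenvector {T : X →L[𝕜] X} {y : X} {c : ℝ} (h : T y = (c : 𝕜) • y)
    (p : ℝ[X]) : opEval T p y = ((p.eval c : ℝ) : 𝕜) • y := by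
  have hpow : ∀ i : ℕ, (T ^ i) y = ((c ^ i : ℝ) : 𝕜) • y := by
    intro i
    induction i with
    | zero => simp
    | succ i ih =>
      rw [pow_succ, mul_apply_eq_comp, h, map_smul, ih, smul_smul, pow_succ]
      push_cast
      rw [mul_comm]
  rw [opEval_eq_sum T p (Nat.lt_succ_self _), eval_eq_sum_range, RCLike.ofReal_sum, Finset.sum_smul]
  refine Finset.sum_congr rfl fun i _ => ?_
  rw [hpow, smul_smul, RCLike.ofReal_mul]

variable {ι : Type*} {y : ι → X}

lemma hasSum_re_inner (hy : ∀ i j, i ≠ j → inner 𝕜 (y i) (y j) = 0) {a b : ι → ℝ} {u v : X}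
    (hu : HasSum (fun i => ((a i : ℝ) : 𝕜) • y i) u) (hv : HasSum (fun i => ((b i : ℝ) : 𝕜) • y i) v) :
    HasSum (fun i => a i * b i * ‖y i‖ ^ 2) (RCLike.re (inner 𝕜 u v)) := by
  have h1 : ∀ i, RCLike.re (inner 𝕜 (((a i : ℝ) : 𝕜) • y i) v) = a i * b i * ‖y i‖ ^ 2 := by
    intro i
    have h2 := (hv.mapL (innerSL 𝕜 (((a i : ℝ) : 𝕜) • y i))).mapL (RCLike.reCLM (K := 𝕜))
    simp only [innerSL_apply_apply, RCLike.reCLM_apply] at h2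
    have h3 := hasSum_single (f := fun j => RCLike.re (inner 𝕜 (((a i : ℝ) : 𝕜) • y i)
      (((b j : ℝ) : 𝕜) • y j))) i (fun j hj => by
        rw [inner_smul_left, inner_smul_right, hy i j hj.symm]; simp)
    rw [h2.unique h3, inner_smul_left, inner_smul_right, inner_self_eq_norm_sq_to_K,
      RCLike.conj_ofReal]
    norm_cast
    rw [mul_assoc]
  have h4 := (hu.mapL ((innerSL 𝕜).flip v)).mapL (RCLike.reCLM (K := 𝕜))
  simp only [ContinuousLinearMap.flip_apply, innerSL_apply_apply, RCLike.reCLM_apply, h1] at h4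
  exact h4

lemma hasSum_norm_sq (hy : ∀ i j, i ≠ j → inner 𝕜 (y i) (y j) = 0) {a : ι → ℝ} {u : X}
    (hu : HasSum (fun i => ((a i : ℝ) : 𝕜) • y i) u) :
    HasSum (fun i => a i ^ 2 * ‖y i‖ ^ 2) (‖u‖ ^ 2) := by
  have h := hasSum_re_inner hy hu hu
  rw [inner_self_eq_norm_sq_to_K] at h
  norm_cast at h
  simpa only [sq (a _)] using h

/-- Bessel's inequality; the hypothesis `hv` expresses that the y i are orthogonal projections of v.
-/
lemma sum_norm_sq_le (hy : ∀ i j, i ≠ j → inner 𝕜 (y i) (y j) = 0) {v : X}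
    (hv : ∀ i, ‖y i‖ ^ 2 = RCLike.re (inner 𝕜 (y i) v)) (F : Finset ι) :
    ∑ i ∈ F, ‖y i‖ ^ 2 ≤ ‖v‖ ^ 2 := by
  have h1 : ‖∑ i ∈ F, y i‖ ^ 2 = ∑ i ∈ F, ‖y i‖ ^ 2 := by
    have h2 := inner_self_eq_norm_sq_to_K (𝕜 := 𝕜) (∑ i ∈ F, y i)
    have h3 : inner 𝕜 (∑ i ∈ F, y i) (∑ i ∈ F, y i) = ∑ i ∈ F, ((‖y i‖ ^ 2 : ℝ) : 𝕜) := by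
      rw [sum_inner]
      refine Finset.sum_congr rfl fun i hi => ?_
      rw [inner_sum, Finset.sum_eq_single i (fun j _ hj => hy i j hj.symm)
        (fun h => absurd hi h), inner_self_eq_norm_sq_to_K]
      norm_cast
    rw [h3] at h2
    exact_mod_cast h2.symm
  have h4 : ∑ i ∈ F, ‖y i‖ ^ 2 ≤ ‖∑ i ∈ F, y i‖ * ‖v‖ := by
    refine le_trans (le_of_eq ?_) ((RCLike.re_le_norm (K := 𝕜) _).trans
      (norm_inner_le_norm _ _))
    rw [sum_inner, map_sum]
    exact Finset.sum_congr rfl fun i _ => hv i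
  rw [← h1] at h4 ⊢
  nlinarith [norm_nonneg (∑ i ∈ F, y i), norm_nonneg v, sq_nonneg (‖∑ i ∈ F, y i‖ - ‖v‖)]

/-- Hölder's inequality with the conjugate exponents μ + 1 and (μ + 1)/μ. -/
lemma tsum_rpow_interpolation {t b : ι → ℝ} {μ : ℝ} (hμ : 0 < μ) (ht : ∀ i, 0 < t i)
    (hb : ∀ i, 0 ≤ b i) (hb_sum : Summable b)
    (htb : Summable fun i => t i ^ (2 * (μ + 1)) * b i) :
    ∑' i, t i ^ (2 * μ) * b i
      ≤ (∑' i, b i) ^ (1 / (μ + 1)) * (∑' i, t i ^ (2 * (μ + 1)) * b i) ^ (μ / (μ + 1)) := by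
  have hμ1 : 0 < μ + 1 := by linarith
  have hpq : (μ + 1).HolderConjugate ((μ + 1) / μ) := by
    rw [Real.holderConjugate_iff]
    refine ⟨by linarith, ?_⟩
    field_simp
    ring
  have hf : ∀ i, (b i ^ (1 / (μ + 1))) ^ (μ + 1) = b i := fun i => by
    rw [← Real.rpow_mul (hb i), one_div, inv_mul_cancel₀ hμ1.ne', Real.rpow_one]
  have hg : ∀ i, ((t i ^ (2 * (μ + 1)) * b i) ^ (μ / (μ + 1))) ^ ((μ + 1) / μ)
      = t i ^ (2 * (μ + 1)) * b i := fun i => by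
    rw [← Real.rpow_mul (mul_nonneg (Real.rpow_nonneg (ht i).le _) (hb i)),
      div_mul_div_cancel₀ hμ1.ne', div_self hμ.ne', Real.rpow_one]
  have h := Real.inner_le_Lp_mul_Lq_tsum_of_nonneg hpq (f := fun i => b i ^ (1 / (μ + 1)))
    (g := fun i => (t i ^ (2 * (μ + 1)) * b i) ^ (μ / (μ + 1)))
    (fun i => Real.rpow_nonneg (hb i) _)
    (fun i => Real.rpow_nonneg (mul_nonneg (Real.rpow_nonneg (ht i).le _) (hb i)) _)
    (by simpa only [hf] using hb_sum) (by simpa only [hg] using htb)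
  simp only [hf, hg] at h
  rw [one_div_div] at h
  refine le_trans (le_of_eq (tsum_congr fun i => ?_)) h
  rw [Real.mul_rpow (Real.rpow_nonneg (ht i).le _) (hb i), ← Real.rpow_mul (ht i).le,
    mul_left_comm, ← Real.rpow_add_of_nonneg (hb i) (by positivity) (by positivity)]
  rw [← add_div, add_comm 1 μ, div_self hμ1.ne', Real.rpow_one]
  congr 2
  field_simp

variable [CompleteSpace X]

/-- Interpolation and decay of the residuals for exact data under a source condition. -/
theorem sourceSet_bounds {A : X →L[𝕜] X} (hA : ‖A‖ ≤ 1) {μ ρ : ℝ} (hμ : 0 < μ) (hρ : 0 < ρ) {x : X}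
    (hx : x ∈ sourceSet A μ ρ) :
    ‖x‖ ≤ ρ ∧ ∀ (p : ℝ[X]) (L M : ℝ), 0 < M →
      (∀ t ∈ Set.Icc (0 : ℝ) 1, |t ^ ((μ + 1) / 2) * p.eval t| ≤ L) →
      (∀ t ∈ Set.Icc (0 : ℝ) 1, |p.eval t| ≤ M) →
      ‖A (opEval (star A * A) p x)‖ ≤ L * ρ ∧
      ‖opEval (star A * A) p x‖ ≤ (M * ρ) ^ (1 / (μ + 1)) *
        ‖A (opEval (star A * A) p x)‖ ^ (μ / (μ + 1)) := by
  obtain ⟨v, hv, rfl⟩ := hx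
  have hμ1 : 0 < μ + 1 := by linarith
  set T := star A * A with hT
  set π : Set.Ioi (0 : ℝ) → (X →L[𝕜] X) := fun t =>
    (ContinuousLinearMap.adjoint A ∘L A
      - (((t : ℝ) ^ 2 : ℝ) : 𝕜) • ContinuousLinearMap.id 𝕜 X).ker.starProjection with hπ
  have habs : absPow A μ v = ∑' t : Set.Ioi (0 : ℝ), (((t : ℝ) ^ μ : ℝ) : 𝕜) • π t v := rfl
  by_cases hsum : Summable fun t : Set.Ioi (0 : ℝ) => (((t : ℝ) ^ μ : ℝ) : 𝕜) • π t v
  swap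
  -- Without summability the sum has the default value 0, for which all claims are trivial.
  · rw [habs, tsum_eq_zero_of_not_summable hsum]
    refine ⟨by simpa using hρ.le, fun p L M hM hL _ => ?_⟩
    rw [map_zero, map_zero, norm_zero]
    have hL0 : 0 ≤ L := (abs_nonneg _).trans (hL 0 ⟨le_rfl, zero_le_one⟩)
    exact ⟨by positivity, by positivity⟩
  set y : Set.Ioi (0 : ℝ) → X := fun t => π t v with hy
  have hTy : ∀ t, T (y t) = (((t : ℝ) ^ 2 : ℝ) : 𝕜) • y t := by
    intro t
    have h : y t ∈ (ContinuousLinearMap.adjoint A ∘L A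
      - (((t : ℝ) ^ 2 : ℝ) : 𝕜) • ContinuousLinearMap.id 𝕜 X).ker :=
      Submodule.starProjection_apply_mem _ v
    rw [LinearMap.mem_ker] at h
    exact sub_eq_zero.1 h
  have hTsymm : ∀ u z, inner 𝕜 (T u) z = inner 𝕜 u (T z) := fun u z => by
    rw [mul_apply_eq_comp, mul_apply_eq_comp, inner_star_left, inner_star_right]
  have horth : ∀ s t, s ≠ t → inner 𝕜 (y s) (y t) = 0 := by
    intro s t hst
    have h := hTsymm (y s) (y t)
    rw [hTy, hTy, inner_smul_left, inner_smul_right, RCLike.conj_ofReal] at h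
    have h2 : (((s : ℝ) ^ 2 : ℝ) : 𝕜) - (((t : ℝ) ^ 2 : ℝ) : 𝕜) ≠ 0 := by
      rw [← RCLike.ofReal_sub, Ne, RCLike.ofReal_eq_zero, sub_eq_zero]
      intro h3
      exact hst (Subtype.ext ((pow_left_inj₀ (le_of_lt s.2) (le_of_lt t.2) two_ne_zero).1 h3))
    exact (mul_eq_zero.1 (by rw [sub_mul, h, sub_self])).resolve_left h2
  have hyv : ∀ t, ‖y t‖ ^ 2 = RCLike.re (inner 𝕜 (y t) v) := fun t =>
    norm_sq_eq_re_inner_of_isStarProjection isStarProjection_starProjection v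
  have hle : ∀ t, y t ≠ 0 → (t : ℝ) ≤ 1 := by
    intro t ht
    have h1 : (t : ℝ) ^ 2 * ‖y t‖ ^ 2 = ‖A (y t)‖ ^ 2 := by
      rw [← re_inner_star_mul_self A (y t), ← hT, hTy, inner_smul_left, inner_self_eq_norm_sq_to_K,
        RCLike.conj_ofReal]
      norm_cast
    have h2 : ‖A (y t)‖ ≤ 1 * ‖y t‖ := ContinuousLinearMap.le_of_opNorm_le _ hA _
    have h3 : (t : ℝ) * ‖y t‖ ≤ 1 * ‖y t‖ := by
      refine le_trans (le_of_eq ?_) h2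
      rw [← mul_pow] at h1
      exact (pow_left_inj₀ (mul_nonneg (le_of_lt t.2) (norm_nonneg _)) (norm_nonneg _)
        two_ne_zero).1 h1
    exact le_of_mul_le_mul_right h3 (norm_pos_iff.2 ht)
  have hbessel : Summable fun t => ‖y t‖ ^ 2 :=
    summable_of_sum_le (fun _ => sq_nonneg _) (sum_norm_sq_le horth hyv)
  have hbessel_le : ∑' t, ‖y t‖ ^ 2 ≤ ρ ^ 2 :=
    (hbessel.tsum_le_of_sum_le (sum_norm_sq_le horth hyv)).trans
      (pow_le_pow_left₀ (norm_nonneg _) hv 2)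
  -- comparison of weighted sums with `ρ`
  have hbound : ∀ (c : Set.Ioi (0 : ℝ) → ℝ) (L : ℝ), (∀ t : Set.Ioi (0 : ℝ), (t : ℝ) ≤ 1 → |c t| ≤ L) →
      (Summable fun t => c t ^ 2 * ‖y t‖ ^ 2) ∧ ∑' t, c t ^ 2 * ‖y t‖ ^ 2 ≤ (L * ρ) ^ 2 := by
    intro c L hc
    have hterm : ∀ t, c t ^ 2 * ‖y t‖ ^ 2 ≤ L ^ 2 * ‖y t‖ ^ 2 := by
      intro t
      by_cases h0 : y t = 0
      · simp [h0]
      · refine mul_le_mul_of_nonneg_right ?_ (sq_nonneg _)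
        rw [← sq_abs]
        exact pow_le_pow_left₀ (abs_nonneg _) (hc t (hle t h0)) 2
    have hs : Summable fun t => c t ^ 2 * ‖y t‖ ^ 2 :=
      Summable.of_nonneg_of_le (fun t => by positivity) hterm (hbessel.mul_left _)
    refine ⟨hs, (hs.tsum_le_tsum hterm (hbessel.mul_left _)).trans ?_⟩
    rw [tsum_mul_left, mul_pow]
    exact mul_le_mul_of_nonneg_left hbessel_le (sq_nonneg _)
  have hx := hsum.hasSum
  rw [← habs] at hx
  have hmem : ∀ t : Set.Ioi (0 : ℝ), (t : ℝ) ≤ 1 → (t : ℝ) ^ 2 ∈ Set.Icc (0 : ℝ) 1 := fun t ht =>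
    ⟨sq_nonneg _, pow_le_one₀ (le_of_lt t.2) ht⟩
  refine ⟨?_, fun p L M hM hL hpM => ?_⟩
  · have h1 := hasSum_norm_sq horth hx
    have h2 := (hbound (fun t => (t : ℝ) ^ μ) 1 fun t ht => by
      rw [abs_of_nonneg (Real.rpow_nonneg (le_of_lt t.2) _)]
      exact Real.rpow_le_one (le_of_lt t.2) ht hμ.le).2
    rw [h1.tsum_eq, one_mul] at h2
    exact le_of_sq_le_sq h2 hρ.le
  · set z := opEval T p (absPow A μ v) with hz
    have hzsum : HasSum (fun t : Set.Ioi (0 : ℝ) => (((t : ℝ) ^ μ * p.eval ((t : ℝ) ^ 2) : ℝ) : 𝕜) • y t) z := by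
      have h := hx.mapL (opEval T p)
      convert h using 2 with t
      rw [map_smul, opEval_apply_of_eigenvector (hTy t), smul_smul, RCLike.ofReal_mul]
    have hTz : HasSum (fun t : Set.Ioi (0 : ℝ) => (((t : ℝ) ^ 2 * ((t : ℝ) ^ μ * p.eval ((t : ℝ) ^ 2)) : ℝ) : 𝕜) • y t)
        (T z) := by
      have h := hzsum.mapL T
      convert h using 2 with t
      rw [map_smul, hTy t, smul_smul, mul_comm ((t : ℝ) ^ 2), RCLike.ofReal_mul]
    have hznorm := hasSum_norm_sq horth hzsum
    have hAz : HasSum (fun t : Set.Ioi (0 : ℝ) =>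
        ((t : ℝ) ^ (μ + 1) * p.eval ((t : ℝ) ^ 2)) ^ 2 * ‖y t‖ ^ 2) (‖A z‖ ^ 2) := by
      have h := hasSum_re_inner horth hTz hzsum
      rw [re_inner_star_mul_self] at h
      convert h using 3 with t
      rw [Real.rpow_add t.2, Real.rpow_one]
      ring
    have hAz' := hbound (fun t => (t : ℝ) ^ (μ + 1) * p.eval ((t : ℝ) ^ 2)) L fun t ht => by
      have h := hL _ (hmem t ht)
      have h2 : ((t : ℝ) ^ 2) ^ ((μ + 1) / 2) = (t : ℝ) ^ (μ + 1) := by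
        rw [← Real.rpow_natCast, ← Real.rpow_mul (le_of_lt t.2), Nat.cast_ofNat,
          mul_div_cancel₀ _ two_ne_zero]
      rwa [h2] at h
    have hL0 : 0 ≤ L := (abs_nonneg _).trans (hL 0 ⟨le_rfl, zero_le_one⟩)
    have hb := hbound (fun t => p.eval ((t : ℝ) ^ 2)) M fun t ht => hpM _ (hmem t ht)
    constructor
    · have h2 := hAz'.2
      rw [hAz.tsum_eq] at h2
      exact le_of_sq_le_sq h2 (by positivity)
    · have hsplit : ∀ (ν : ℝ) (t : Set.Ioi (0 : ℝ)),
          ((t : ℝ) ^ ν * p.eval ((t : ℝ) ^ 2)) ^ 2 * ‖y t‖ ^ 2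
            = (t : ℝ) ^ (2 * ν) * (p.eval ((t : ℝ) ^ 2) ^ 2 * ‖y t‖ ^ 2) := by
        intro ν t
        rw [mul_comm 2 ν, Real.rpow_mul (le_of_lt t.2), Real.rpow_ofNat]
        ring
      simp only [hsplit] at hznorm hAz
      -- The weights p(t²)²‖y t‖² are interpolated between the exponents 0, where the sum is at most
      -- (Mρ)², and 2(μ + 1), where it is ‖A z‖².
      have h := tsum_rpow_interpolation (t := fun t : Set.Ioi (0 : ℝ) => (t : ℝ)) hμ (fun t => t.2)
        (fun t => by positivity) hb.1 hAz.summable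
      rw [hznorm.tsum_eq, hAz.tsum_eq] at h
      refine le_of_sq_le_sq (h.trans ?_) (by positivity)
      rw [mul_pow]
      have e1 : ((M * ρ) ^ (1 / (μ + 1))) ^ 2 = ((M * ρ) ^ 2) ^ (1 / (μ + 1)) := by
        rw [← Real.rpow_natCast, ← Real.rpow_natCast, ← Real.rpow_mul (by positivity),
          ← Real.rpow_mul (by positivity), mul_comm (1 / (μ + 1))]
      have e2 : (‖A z‖ ^ (μ / (μ + 1))) ^ 2 = (‖A z‖ ^ 2) ^ (μ / (μ + 1)) := by
        rw [← Real.rpow_natCast, ← Real.rpow_natCast, ← Real.rpow_mul (by positivity),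
          ← Real.rpow_mul (by positivity), mul_comm]
      rw [e1, e2]
      refine mul_le_mul_of_nonneg_right ?_ (by positivity)
      exact Real.rpow_le_rpow (tsum_nonneg fun t => by positivity) hb.2 (by positivity)

end Source

/-! ### The accuracy of the discretization -/

/-- The quantity compared with `γ δ / (2 k ρ)` in the choice of the level. -/
def crossErr (r : ℝ) (n : ℕ) : ℝ := (1 + (2 : ℝ) ^ (r + 3)) * (2 : ℝ) ^ (-(2 * r * n)) * n

lemma crossErr_eq (r : ℝ) (n : ℕ) :
    crossErr r n = (1 + 8 * (2 : ℝ) ^ r) * ((2 : ℝ) ^ (-r)) ^ (2 * n) * n := by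
  have h1 : (2 : ℝ) ^ (r + 3) = 8 * (2 : ℝ) ^ r := by
    rw [Real.rpow_add two_pos, mul_comm]; norm_num
  have h2 : (2 : ℝ) ^ (-(2 * r * n)) = ((2 : ℝ) ^ (-r)) ^ (2 * n) := by
    rw [← Real.rpow_natCast, ← Real.rpow_mul zero_le_two]
    congr 1
    push_cast
    ring
  rw [crossErr, h1, h2]

/-- Everything follows from 2^r ≥ 1 and n ≥ 1; in particular 1 + 8·2^r ≥ 9 gives 9 t^(2n) ≤ η. The
last constant exceeds 13/30 + 1/9 slightly. -/
lemma crossErr_bounds {r : ℝ} (hr : 0 < r) {n : ℕ} (hn : 1 ≤ n) :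
    (n * ((2 : ℝ) ^ r + 1) + 1) * ((2 : ℝ) ^ (-r)) ^ (2 * n) ≤ crossErr r n / 3 ∧
      ((2 : ℝ) ^ (-r)) ^ (2 * n) ≤ crossErr r n / (9 * n) ∧
      13 / 10 * (crossErr r n / 3) + (((2 : ℝ) ^ (-r)) ^ (2 * n)) ^ 2
        ≤ 109 / 200 * crossErr r n := by
  rw [crossErr_eq]
  have hR : 1 ≤ (2 : ℝ) ^ r := Real.one_le_rpow one_le_two hr.le
  have hu0 : 0 < ((2 : ℝ) ^ (-r)) ^ (2 * n) := by positivity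
  have hu1 : ((2 : ℝ) ^ (-r)) ^ (2 * n) ≤ 1 :=
    pow_le_one₀ (by positivity) (Real.rpow_le_one_of_one_le_of_nonpos one_le_two (by linarith))
  have hn' : (1 : ℝ) ≤ n := by exact_mod_cast hn
  generalize (2 : ℝ) ^ r = R at *
  generalize ((2 : ℝ) ^ (-r)) ^ (2 * n) = u at *
  generalize (n : ℝ) = N at *
  have h9 : 9 * u ≤ (1 + 8 * R) * u := mul_le_mul_of_nonneg_right (by linarith) hu0.le
  have h9N : 9 * u ≤ (1 + 8 * R) * u * N := h9.trans (le_mul_of_one_le_right (by positivity) hn')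
  refine ⟨?_, ?_, by nlinarith⟩
  · have h : N * (R + 1) + 1 ≤ (1 + 8 * R) * N / 3 := by nlinarith
    calc _ ≤ (1 + 8 * R) * N / 3 * u := mul_le_mul_of_nonneg_right h hu0.le
      _ = _ := by ring
  · rw [le_div_iff₀ (by linarith)]
    nlinarith

/-- A fine level allows the better factor 1/4, which needs 3n/4 + 1 ≤ n 2^r. This is clear for n ≥
4. For smaller n, the assumption η ≤ 3/4 forces 2^(2rn) ≥ 12n, so 2^r is large. -/
lemma crossErr_bounds_of_le {r : ℝ} (hr : 0 < r) {n : ℕ} (hn : 1 ≤ n)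
    (hη : crossErr r n ≤ 3 / 4) :
    (n * ((2 : ℝ) ^ r + 1) + 1) * ((2 : ℝ) ^ (-r)) ^ (2 * n) ≤ crossErr r n / 4 ∧
      13 / 10 * (crossErr r n / 4) + (((2 : ℝ) ^ (-r)) ^ (2 * n)) ^ 2
        ≤ 67 / 200 * crossErr r n := by
  rw [crossErr_eq] at hη ⊢
  have hR : 1 ≤ (2 : ℝ) ^ r := Real.one_le_rpow one_le_two hr.le
  have hu0 : 0 < ((2 : ℝ) ^ (-r)) ^ (2 * n) := by positivity
  have hRu : ((2 : ℝ) ^ (-r)) ^ (2 * n) * ((2 : ℝ) ^ r) ^ (2 * n) = 1 := by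
    rw [← mul_pow, ← Real.rpow_add two_pos]; simp
  have hn' : (1 : ℝ) ≤ n := by exact_mod_cast hn
  generalize (2 : ℝ) ^ r = R at *
  generalize ((2 : ℝ) ^ (-r)) ^ (2 * n) = u at *
  have hpow : (1 + 8 * R) * n ≤ 3 / 4 * R ^ (2 * n) := by
    have h := mul_le_mul_of_nonneg_right hη (by positivity : 0 ≤ R ^ (2 * n))
    calc (1 + 8 * R) * n = (1 + 8 * R) * n * (u * R ^ (2 * n)) := by rw [hRu, mul_one]
      _ = (1 + 8 * R) * u * n * R ^ (2 * n) := by ring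
      _ ≤ _ := h
  have hmain : 3 / 4 * (n : ℝ) + 1 ≤ n * R := by
    rcases le_or_gt 4 n with h4 | h4
    · have : (4 : ℝ) ≤ n := by exact_mod_cast h4
      nlinarith
    · by_contra! hlt
      interval_cases n
      · norm_num at *
        nlinarith
      · norm_num at *
        have : R ^ 4 ≤ (5 / 4) ^ 4 := pow_le_pow_left₀ (by linarith) (by linarith) 4
        norm_num at this
        linarith
      · norm_num at *
        have : R ^ 6 ≤ (13 / 12) ^ 6 := pow_le_pow_left₀ (by linarith) (by linarith) 6
        norm_num at this
        linarith
  have h9 : 9 * u ≤ (1 + 8 * R) * u := mul_le_mul_of_nonneg_right (by linarith) hu0.le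
  have h9N : 9 * u ≤ (1 + 8 * R) * u * n := h9.trans (le_mul_of_one_le_right (by positivity) hn')
  constructor
  · have h : n * (R + 1) + 1 ≤ (1 + 8 * R) * n / 4 := by linarith
    calc _ ≤ (1 + 8 * R) * n / 4 * u := mul_le_mul_of_nonneg_right h hu0.le
      _ = _ := by ring
  · have hu : u ≤ 1 / 12 := by linarith
    nlinarith

/-! ### Scalar inequalities for the stopping index -/

/-- The bound is just above 1/√2: without excess growth, 2g√(1/2) ≤ 2g√(1/2 + q) < 1. Growth of r_1
beyond 1 requires a large q, which enlarges the square root by more. -/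
lemma le_of_two_mul_sqrt_lt {q g η : ℝ} (hq : 0 ≤ q) (hη : 0 ≤ η) (hg : η < g)
    (h : 2 * g * √(1 / 2 + q) < 1 + 2 * max 0 (min 1 (q / 4) - 1 + (min 1 (q / 4) + 1) * (η / 3))) :
    g ≤ 71 / 100 := by
  have hm0 : 0 ≤ min 1 (q / 4) := le_min zero_le_one (by linarith)
  have hm1 : min 1 (q / 4) ≤ 1 := min_le_left _ _
  have hmq : min 1 (q / 4) ≤ q / 4 := min_le_right _ _
  generalize min 1 (q / 4) = m at *
  have ha : 7 / 10 + 7 / 5 * m ≤ √(1 / 2 + q) := by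
    refine Real.le_sqrt_of_sq_le ?_
    nlinarith [mul_nonneg hm0 (sub_nonneg.2 hm1)]
  have ha2 : √(1 / 2 + q) ^ 2 = 1 / 2 + q := Real.sq_sqrt (by linarith)
  have ha0 := Real.sqrt_nonneg (1 / 2 + q)
  generalize √(1 / 2 + q) = a at *
  by_contra! hlt
  rcases le_total (m - 1 + (m + 1) * (η / 3)) 0 with h0 | h0
  · rw [max_eq_left h0] at h
    have h1 : (2 * g * a) ^ 2 < 1 := by
      have : 0 ≤ 2 * g * a := by positivity
      nlinarith
    have h2 : (2 * g * a) ^ 2 = 4 * g ^ 2 * (1 / 2 + q) := by rw [← ha2]; ring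
    nlinarith
  · rw [max_eq_right h0] at h
    have h1 : 2 * g * (7 / 10 + 7 / 5 * m) ≤ 2 * g * a :=
      mul_le_mul_of_nonneg_left ha (by linarith)
    have h2 : (m + 1) * η ≤ (m + 1) * g := mul_le_mul_of_nonneg_left hg.le (by linarith)
    nlinarith [mul_le_mul_of_nonneg_right hlt.le hm0]

lemma two_mul_lt_one_add {q g η a : ℝ} (hη : 0 ≤ η)
    (h : 2 * g * a < 1 + 2 * max 0 (min 1 (q / 4) - 1 + (min 1 (q / 4) + 1) * (η / 4))) :
    2 * g * a < 1 + η := by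
  have hm1 : min 1 (q / 4) ≤ 1 := min_le_left _ _
  generalize min 1 (q / 4) = m at *
  have : max 0 (m - 1 + (m + 1) * (η / 4)) ≤ η / 2 :=
    max_le (by linarith) (by nlinarith)
  linarith

section Stopping

variable {𝕜 : Type*} [RCLike 𝕜] {X : Type*} [NormedAddCommGroup X] [InnerProductSpace 𝕜 X]
  [CompleteSpace X] {w : ℝ → ℝ} {P : ℕ → ℝ[X]} {μ₀ : ℝ} {κ : ℝ → ℝ} {A B Q : X →L[𝕜] X}
  {s d u g δ ρ η : ℝ} {x fδ : X}

/-! ### Consequences of a failed discrepancy test -/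

/-- A semiiterative method of qualification at least two. -/
structure IsMethod (w : ℝ → ℝ) (P : ℕ → ℝ[X]) (μ₀ : ℝ) (κ : ℝ → ℝ) : Prop where
  isWeight : IsWeight w
  orthogonal : IsMonicOrthogonal w P
  two_le : 2 ≤ μ₀
  qualification : HasQualification P μ₀ κ

/-- Data of noise level `δ` for a solution whose norm is at most `ρ`. -/
structure IsNoisyData (A : X →L[𝕜] X) (x fδ : X) (δ ρ : ℝ) : Prop where
  nonneg : 0 ≤ δ
  le : δ ≤ ρ
  pos : 0 < ρ
  norm_le : ‖x‖ ≤ ρ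
  dist_le : ‖A x - fδ‖ ≤ δ

/-- The coefficient `√(1/2 + κ_2/κ_0)` in the lower bound for the control parameter. -/
def slope (κ : ℝ → ℝ) : ℝ := √(1 / 2 + κ 2 / κ 0)

/-- The smallest admissible threshold `τ_0 δ` of the discrepancy principle, in terms of
`g = γ δ / (2 ρ)`. -/
def threshold (κ : ℝ → ℝ) (g δ ρ : ℝ) : ℝ := κ 0 * (δ + slope κ * (2 * g * ρ))

namespace IsMethod

lemma zero_pos (hm : IsMethod w P μ₀ κ) : 0 < κ 0 := zero_lt_one.trans_le hm.qualification.one_le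

lemma two_pos (hm : IsMethod w P μ₀ κ) : 0 < κ 2 := hm.qualification.pos 2 _root_.two_pos hm.two_le

lemma quotient_pos (hm : IsMethod w P μ₀ κ) : 0 < κ 2 / κ 0 := div_pos hm.two_pos hm.zero_pos

lemma slope_sq (hm : IsMethod w P μ₀ κ) : slope κ ^ 2 = 1 / 2 + κ 2 / κ 0 :=
  Real.sq_sqrt (by linarith [hm.quotient_pos])

lemma slope_pos (hm : IsMethod w P μ₀ κ) : 0 < slope κ :=
  Real.sqrt_pos.2 (by linarith [hm.quotient_pos])

end IsMethod

namespace Approximates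

/-- The first discrepancy is at most sup|r_1| (δ + ρ). Comparing this with the threshold and using δ
≤ ρ bounds g. -/
lemma lt_of_threshold_lt_one (h : Approximates A B Q s d u) (hm : IsMethod w P μ₀ κ)
    (hx : IsNoisyData A x fδ δ ρ)
    (hfail : threshold κ g δ ρ < ‖B (iter w P B fδ 1) - Q fδ‖) :
    2 * g * slope κ < 1 + 2 * max 0 (min 1 (κ 2 / κ 0 / 4) - 1 + (min 1 (κ 2 / κ 0 / 4) + 1) * s) := by
  have hM := hm.qualification.abs_resPoly_one_le hm.two_le hm.isWeight hm.orthogonal h.nonneg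
  have hl0 : 0 ≤ max 0 (min 1 (κ 2 / κ 0 / 4) - 1 + (min 1 (κ 2 / κ 0 / 4) + 1) * s) :=
    le_max_left _ _
  generalize max 0 (min 1 (κ 2 / κ 0 / 4) - 1 + (min 1 (κ 2 / κ 0 / 4) + 1) * s) = l at *
  have hκ := hm.zero_pos
  rw [h.norm_residual_eq hm.isWeight hm.orthogonal] at hfail
  have h1 := h.norm_opEval_proj_le hM (A x) fδ
  have h2 := norm_opEval_apply_le h.formIn_left hM (A x)
  have h3 : ‖A x‖ ≤ ρ := (ContinuousLinearMap.le_of_opNorm_le _ h.norm_le x).trans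
    ((one_mul _).trans_le hx.norm_le)
  have hM0 : 0 ≤ κ 0 * (1 + l) := by positivity
  have h4 := mul_le_mul_of_nonneg_left hx.dist_le hM0
  have h5 := mul_le_mul_of_nonneg_left h3 hM0
  have h6 : κ 0 * (δ + slope κ * (2 * g * ρ)) < κ 0 * ((1 + l) * (δ + ρ)) := by
    unfold threshold at hfail; linarith
  have h7 := lt_of_mul_lt_mul_left h6 hκ.le
  have h8 : l * δ ≤ l * ρ := mul_le_mul_of_nonneg_left hx.le hl0
  have h9 : (2 * g * slope κ) * ρ < (1 + 2 * l) * ρ := by linarith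
  exact lt_of_mul_lt_mul_right h9 hx.pos.le

/-- Here `hsmall` excludes growth of r_k beyond κ 0, so the noise uses up exactly κ 0 * δ of the
threshold. The rest lies below ‖r_k(BB*)Ax‖, which is estimated by `norm_opEval_apply_sq_le`. -/
lemma lt_of_threshold_lt (h : Approximates A B Q s d u) (hm : IsMethod w P μ₀ κ)
    (hx : IsNoisyData A x fδ δ ρ) (hg : 0 ≤ g) {k : ℕ} (hk : 1 ≤ k) {z : ℝ}
    (hz : 4 * ((k : ℝ) + 1) ^ 2 * s ≤ z) (hz' : z ≤ 16 / 5)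
    (hsmall : κ 2 / κ 0 * growth z ≤ ((k : ℝ) + 1) ^ 2)
    (hfail : threshold κ g δ ρ < ‖B (iter w P B fδ k) - Q fδ‖) :
    (2 * g * slope κ) ^ 2 < κ 2 / κ 0 * growth z / ((k : ℝ) + 1) ^ 2 + d := by
  have hκ := hm.zero_pos
  have hM := hm.qualification.abs_resPoly_le_max hm.two_le hm.orthogonal hk h.nonneg hz hz'
  have hM' := hm.qualification.abs_mul_resPoly_le_growth hm.two_le hm.orthogonal hk h.nonneg hz hz'
  have hk2 : 0 < ((k : ℝ) + 1) ^ 2 := by positivity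
  have he : κ 2 / ((k : ℝ) + 1) ^ 2 * growth z = κ 0 * (κ 2 / κ 0 * growth z / ((k : ℝ) + 1) ^ 2) := by
    field_simp
  have hle : κ 2 / κ 0 * growth z / ((k : ℝ) + 1) ^ 2 ≤ 1 := (div_le_one hk2).2 hsmall
  rw [max_eq_left (by rw [he]; exact mul_le_of_le_one_right hκ.le hle)] at hM
  rw [he] at hM'
  generalize κ 2 / κ 0 * growth z / ((k : ℝ) + 1) ^ 2 = c at *
  rw [h.norm_residual_eq hm.isWeight hm.orthogonal] at hfail
  have h1 := h.norm_opEval_proj_le hM (A x) fδ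
  have h2 := h.norm_opEval_apply_sq_le hM hM' x
  have h4 := mul_le_mul_of_nonneg_left hx.dist_le hκ.le
  have h5 : κ 0 * (slope κ * (2 * g * ρ)) < ‖opEval (B * star B) (resPoly P k) (A x)‖ := by
    unfold threshold at hfail; linarith
  have h50 : 0 ≤ κ 0 * (slope κ * (2 * g * ρ)) := by
    have := hm.slope_pos; have := hx.pos; positivity
  have h6 := (pow_lt_pow_left₀ h5 h50 two_ne_zero).trans_le h2
  have h7 : κ 0 ^ 2 * ρ ^ 2 * (2 * g * slope κ) ^ 2 < (κ 0 * (κ 0 * c) + κ 0 ^ 2 * d) * ‖x‖ ^ 2 := by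
    refine lt_of_eq_of_lt ?_ h6
    ring
  have hx0 : ‖x‖ ^ 2 ≤ ρ ^ 2 := pow_le_pow_left₀ (norm_nonneg _) hx.norm_le 2
  have h8 : 0 ≤ κ 0 * (κ 0 * c) + κ 0 ^ 2 * d := by
    by_contra! hneg
    have : (κ 0 * (κ 0 * c) + κ 0 ^ 2 * d) * ‖x‖ ^ 2 ≤ 0 :=
      mul_nonpos_of_nonpos_of_nonneg hneg.le (sq_nonneg _)
    have : 0 ≤ κ 0 ^ 2 * ρ ^ 2 * (2 * g * slope κ) ^ 2 := by positivity
    linarith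
  have h9 := h7.trans_le (mul_le_mul_of_nonneg_left hx0 h8)
  have hpos : 0 < κ 0 ^ 2 * ρ ^ 2 := by have := hx.pos; positivity
  refine lt_of_mul_lt_mul_left (h9.trans_eq ?_) hpos.le
  ring

/-- The origin of the coefficient √(1/2 + κ_2/κ_0) in τ₀: the factors from t r_k and r_k combine to
2κ_2 + κ_0 = 2κ_0 `slope κ`², up to growth factors collected in c. The bound is linear in k. -/
lemma norm_opEval_sub_apply_le (h : Approximates A B Q s d u) (hm : IsMethod w P μ₀ κ) {k : ℕ}
    (hk : 1 ≤ k) {z z' c : ℝ} (hz : 4 * (k : ℝ) ^ 2 * s ≤ z) (hzz : z ≤ z')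
    (hz' : 4 * ((k : ℝ) + 1) ^ 2 * s ≤ z') (hz'' : z' ≤ 16 / 5) (hc0 : 0 ≤ c)
    (hc : growth z * growth z' ≤ c ^ 2) (x : X) :
    ‖opEval (B * star B) (resPoly P k) (A x) - opEval (A * star A) (resPoly P k) (A x)‖
      ≤ 2 * k * d * κ 0 * slope κ * c * ‖x‖ := by
  have hκ := hm.zero_pos
  have hd := h.dist_nonneg
  have ha := hm.slope_pos
  have hs := h.nonneg
  have hz0 : 0 ≤ z := le_trans (by positivity) hz
  have h1 := h.norm_opEval_sub_apply_sq_le hk (hm.orthogonal.natDegree_resPoly_le k)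
    (hm.qualification.abs_resPoly_le_growth hm.orthogonal hk hs hz (hzz.trans hz''))
    (hm.qualification.abs_mul_resPoly_le_growth hm.two_le hm.orthogonal hk hs hz' hz'') x
  refine le_of_sq_le_sq (h1.trans ?_) (by positivity)
  have hθ := growth_mono hz0 hzz
  have hθ1 := one_le_growth hz0
  have h2 : (2 * ((k : ℝ) + 1) ^ 2 * (κ 2 / ((k : ℝ) + 1) ^ 2 * growth z') + κ 0 * growth z) * d
      ≤ 2 * κ 0 * slope κ ^ 2 * growth z' * d := by
    rw [hm.slope_sq]
    refine mul_le_mul_of_nonneg_right ?_ hd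
    have e1 : 2 * ((k : ℝ) + 1) ^ 2 * (κ 2 / ((k : ℝ) + 1) ^ 2 * growth z')
        = 2 * κ 0 * (κ 2 / κ 0) * growth z' := by field_simp
    rw [e1]
    nlinarith
  calc _ ≤ (2 * k ^ 2 * (κ 0 * growth z) * d) * (2 * κ 0 * slope κ ^ 2 * growth z' * d) * ‖x‖ ^ 2 := by
        gcongr
    _ = 4 * k ^ 2 * κ 0 ^ 2 * slope κ ^ 2 * d ^ 2 * ‖x‖ ^ 2 * (growth z * growth z') := by ring
    _ ≤ 4 * k ^ 2 * κ 0 ^ 2 * slope κ ^ 2 * d ^ 2 * ‖x‖ ^ 2 * c ^ 2 := by gcongr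
    _ = _ := by ring

/-- If the discrepancy test fails at `1` and at `k`, then `(k + 1) g` cannot lie between `13 / 20`
and `71 / 50`. -/
lemma mul_le_of_threshold_lt (h : Approximates A B Q (η / 4) (67 / 200 * η) u)
    (hm : IsMethod w P μ₀ κ) (hx : IsNoisyData A x fδ δ ρ) {k : ℕ} (hk : 1 ≤ k)
    (hη : ((k : ℝ) + 1) * η < g) (hg : ((k : ℝ) + 1) * g ≤ 71 / 50)
    (hfail1 : threshold κ g δ ρ < ‖B (iter w P B fδ 1) - Q fδ‖)
    (hfail : threshold κ g δ ρ < ‖B (iter w P B fδ k) - Q fδ‖) :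
    ((k : ℝ) + 1) * g ≤ 13 / 20 := by
  by_contra! hlt
  have hη0 : 0 ≤ η := by linarith [h.nonneg]
  have hk' : (1 : ℝ) ≤ k := by exact_mod_cast hk
  have hg0 : 0 < g := lt_of_le_of_lt (by positivity) hη
  have hq := hm.quotient_pos
  have hsq := hm.slope_sq
  have ha := hm.slope_pos
  set m : ℝ := (k : ℝ) + 1 with hmdef
  have hm2 : 2 ≤ m := by linarith
  have hz : 4 * m ^ 2 * (η / 4) ≤ m * g := by nlinarith
  have hW : (2 * g * slope κ) ^ 2 = 4 * g ^ 2 * (1 / 2 + κ 2 / κ 0) := by rw [← hsq]; ring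
  -- In the first case the failure at k is contradictory, because growth(y) ≤ 4y² for y = mg >
  -- 13/20. In the second case κ_2/κ_0 is so large that already the failure at 1 is contradictory;
  -- there the stronger inequality 5/4 growth(y) ≤ 4y² is needed, and it determines 13/20.
  rcases le_total (κ 2 / κ 0 * growth (m * g)) (m ^ 2) with hcase | hcase
  · have h1 := h.lt_of_threshold_lt hm hx hg0.le hk hz (by linarith) hcase hfail
    rw [← hmdef, hW] at h1
    have hm2' : 0 < m ^ 2 := by positivity
    have h2 := mul_lt_mul_of_pos_left h1 hm2'
    have e1 : m ^ 2 * (κ 2 / κ 0 * growth (m * g) / m ^ 2 + 67 / 200 * η)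
        = κ 2 / κ 0 * growth (m * g) + 67 / 200 * (m * (m * η)) := by field_simp
    have e2 : m ^ 2 * (4 * g ^ 2 * (1 / 2 + κ 2 / κ 0))
        = 2 * (m * g) ^ 2 + 4 * (m * g) ^ 2 * (κ 2 / κ 0) := by ring
    rw [e1, e2] at h2
    have h3 : m * (m * η) ≤ m * g := mul_le_mul_of_nonneg_left hη.le (by linarith)
    have h4 : growth (m * g) ≤ 4 * (m * g) ^ 2 := by unfold growth; nlinarith
    have h5 := mul_le_mul_of_nonneg_left h4 hq.le
    nlinarith
  · have h1 := two_mul_lt_one_add hη0 (h.lt_of_threshold_lt_one hm hx hfail1)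
    have h2 : η ≤ g / 2 := by nlinarith
    have h3 : (2 * g * slope κ) ^ 2 < (1 + g / 2) ^ 2 :=
      pow_lt_pow_left₀ (by linarith) (by positivity) two_ne_zero
    rw [hW] at h3
    have h4 : 5 / 4 * growth (m * g) ≤ 4 * (m * g) ^ 2 := by unfold growth; nlinarith
    have hθ : 0 < growth (m * g) := zero_lt_one.trans_le (one_le_growth (by positivity))
    have h5 : 5 / 4 ≤ 4 * g ^ 2 * (κ 2 / κ 0) := by
      have h6 : 4 * g ^ 2 * m ^ 2 ≤ 4 * g ^ 2 * (κ 2 / κ 0 * growth (m * g)) :=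
        mul_le_mul_of_nonneg_left hcase (by positivity)
      refine le_of_mul_le_mul_right ?_ hθ
      linarith
    nlinarith [sq_nonneg (g - 2 / 7)]

end Approximates

end Stopping

/-! ### Absorbing discretization error and polynomial growth into the threshold -/

section Stopping

variable {𝕜 : Type*} [RCLike 𝕜] {X : Type*} [NormedAddCommGroup X] [InnerProductSpace 𝕜 X]
  [CompleteSpace X] {w : ℝ → ℝ} {P : ℕ → ℝ[X]} {μ₀ : ℝ} {κ : ℝ → ℝ} {A B Q : X →L[𝕜] X}
  {s d u g δ ρ η : ℝ} {x fδ : X}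

namespace Approximates

/-- If (K + 1)² dominates κ_2/κ_0, then r_K is bounded by κ 0 on the whole interval and only the
operator difference has to fit into the threshold. Otherwise κ_2/κ_0, and with it `slope κ`, is
large; `hlarge` states that this pays for the growth factor of r_K times δ ≤ ρ. -/
lemma exists_bound_of_growth (h : Approximates A B Q (η / 4) (67 / 200 * η) u)
    (hm : IsMethod w P μ₀ κ) (hx : IsNoisyData A x fδ δ ρ) {K : ℕ} (hK : 1 ≤ K)
    (hη : (K : ℝ) * η < g) {z z' c : ℝ} (hz : K * g ≤ z) (hzz : z ≤ z')
    (hz' : ((K : ℝ) + 1) ^ 2 * η ≤ z') (hz'' : z' ≤ 16 / 5) (hc0 : 0 ≤ c)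
    (hc : growth z * growth z' ≤ c ^ 2) (hc1 : 67 / 100 * c ≤ 2)
    (hlarge : ((K : ℝ) + 1) ^ 2 ≤ κ 2 / κ 0 * growth z' →
      growth z - 1 ≤ g * slope κ * (2 - 67 / 100 * c)) :
    ∃ N, (∀ t ∈ Set.Icc (0 : ℝ) (1 + η / 4), |(resPoly P K).eval t| ≤ N) ∧
      N * δ + ‖opEval (B * star B) (resPoly P K) (A x) - opEval (A * star A) (resPoly P K) (A x)‖
        ≤ threshold κ g δ ρ := by
  have hη0 : 0 ≤ η := by linarith [h.nonneg]
  have hK' : (1 : ℝ) ≤ K := by exact_mod_cast hK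
  have hg0 : 0 < g := lt_of_le_of_lt (by positivity) hη
  have hκ := hm.zero_pos
  have ha := hm.slope_pos
  have hρ := hx.pos
  have hzK : 4 * (K : ℝ) ^ 2 * (η / 4) ≤ z := by
    refine le_trans ?_ hz
    nlinarith
  have hzK' : 4 * ((K : ℝ) + 1) ^ 2 * (η / 4) ≤ z' := by linarith
  have hD : ‖opEval (B * star B) (resPoly P K) (A x) - opEval (A * star A) (resPoly P K) (A x)‖
      ≤ κ 0 * slope κ * (67 / 100 * c) * (g * ρ) := by
    refine (h.norm_opEval_sub_apply_le hm hK hzK hzz hzK' hz'' hc0 hc x).trans ?_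
    calc _ = κ 0 * slope κ * (67 / 100 * c) * ((K * η) * ‖x‖) := by ring
      _ ≤ κ 0 * slope κ * (67 / 100 * c) * (g * ρ) := by
        gcongr
        exact hx.norm_le
  have hκa : 0 < κ 0 * slope κ * (g * ρ) := by positivity
  rcases le_total (κ 2 / κ 0 * growth z') (((K : ℝ) + 1) ^ 2) with hcase | hcase
  · refine ⟨κ 0, fun t ht => ?_, ?_⟩
    · refine (hm.qualification.abs_resPoly_le_max hm.two_le hm.orthogonal hK h.nonneg hzK' hz''
        t ht).trans (max_le le_rfl ?_)
      have e : κ 2 / ((K : ℝ) + 1) ^ 2 * growth z'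
          = κ 0 * (κ 2 / κ 0 * growth z' / ((K : ℝ) + 1) ^ 2) := by field_simp
      rw [e]
      exact mul_le_of_le_one_right hκ.le ((div_le_one (by positivity)).2 hcase)
    · unfold threshold
      nlinarith
  · refine ⟨κ 0 * growth z, hm.qualification.abs_resPoly_le_growth hm.orthogonal hK h.nonneg hzK
      (hzz.trans hz''), ?_⟩
    have h1 := hlarge hcase
    have h2 : 0 ≤ growth z - 1 := sub_nonneg.2 (one_le_growth (le_trans (by positivity) hzK))
    have h3 : (growth z - 1) * δ ≤ (growth z - 1) * ρ := mul_le_mul_of_nonneg_left hx.le h2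
    have h4 : (growth z - 1) * ρ ≤ g * slope κ * (2 - 67 / 100 * c) * ρ :=
      mul_le_mul_of_nonneg_right h1 hρ.le
    have h5 := mul_le_mul_of_nonneg_left (h3.trans h4) hκ.le
    unfold threshold
    linarith

/-- A continuation argument. Initially 2g ≤ 71/50, and passing from k + 1 to k + 2 enlarges the
product by a factor of at most 3/2, so a value up to 13/20 becomes at most 39/40 and cannot jump
over the forbidden interval. -/
lemma mul_le_of_forall_threshold_lt (h : Approximates A B Q (η / 4) (67 / 200 * η) u)
    (hm : IsMethod w P μ₀ κ) (hx : IsNoisyData A x fδ δ ρ) (hg : g ≤ 71 / 100) {k : ℕ} (hk : 1 ≤ k)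
    (hη : ((k : ℝ) + 1) * η < g)
    (hfail : ∀ j, 1 ≤ j → j ≤ k → threshold κ g δ ρ < ‖B (iter w P B fδ j) - Q fδ‖) :
    ((k : ℝ) + 1) * g ≤ 13 / 20 := by
  have hη0 : 0 ≤ η := by linarith [h.nonneg]
  induction k, hk using Nat.le_induction with
  | base =>
    have hf := hfail 1 le_rfl le_rfl
    exact h.mul_le_of_threshold_lt hm hx le_rfl hη (by norm_num; linarith) hf hf
  | succ k hk ih =>
    push_cast at hη ⊢
    have hk' : (1 : ℝ) ≤ k := by exact_mod_cast hk
    have h1 := ih (by linarith) fun j hj hjk => hfail j hj (by omega)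
    have h2 := h.mul_le_of_threshold_lt hm hx (k := k + 1) (by omega) (by push_cast; exact hη)
      (by push_cast; nlinarith) (hfail 1 le_rfl (by omega)) (hfail (k + 1) (by omega) le_rfl)
    push_cast at h2
    exact h2

/-- If the discrepancy test fails at `1` and before `K`, then the discretization error and the
growth of the residual polynomial outside of `[0, 1]` are absorbed by the threshold. -/
theorem exists_bound (h : Approximates A B Q (η / 4) (67 / 200 * η) u)
    (hm : IsMethod w P μ₀ κ) (hx : IsNoisyData A x fδ δ ρ) (hg : g ≤ 71 / 100) {K : ℕ} (hK : 1 ≤ K)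
    (hη : (K : ℝ) * η < g) (hfail1 : threshold κ g δ ρ < ‖B (iter w P B fδ 1) - Q fδ‖)
    (hfail : ∀ j, 1 ≤ j → j < K → threshold κ g δ ρ < ‖B (iter w P B fδ j) - Q fδ‖) :
    (K : ℝ) * g ≤ 71 / 50 ∧
    ∃ N, (∀ t ∈ Set.Icc (0 : ℝ) (1 + η / 4), |(resPoly P K).eval t| ≤ N) ∧
      N * δ + ‖opEval (B * star B) (resPoly P K) (A x) - opEval (A * star A) (resPoly P K) (A x)‖
        ≤ threshold κ g δ ρ := by
  have hη0 : 0 ≤ η := by linarith [h.nonneg]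
  have hg0 : 0 < g := lt_of_le_of_lt (by positivity) hη
  have ha := hm.slope_pos
  have ha2 := hm.slope_sq
  have hq := hm.quotient_pos
  -- For K ≤ 2 only g ≤ 71/100 is available; for K ≥ 3 the continuation argument bounds Kg. The
  -- limit 16/5 for z' is dictated by K = 2, where (K + 1)²η < 9g/2 ≤ 3.195.
  obtain rfl | rfl | h3 : K = 1 ∨ K = 2 ∨ 3 ≤ K := by omega
  · norm_num at hη
    refine ⟨by norm_num; linarith, h.exists_bound_of_growth hm hx le_rfl (by norm_num; exact hη)
      (z := g) (z' := 71 / 25) (c := 2) (by norm_num) (by linarith) (by norm_num; linarith)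
      (by norm_num) (by norm_num) ?_ (by norm_num) fun hl => ?_⟩
    · have h1 := growth_mono hg0.le hg
      have h2 : growth (71 / 100) ≤ 1381 / 1000 := by unfold growth; norm_num
      have h3 : growth (71 / 25) ≤ 2824 / 1000 := by unfold growth; norm_num
      have h4 : 0 ≤ growth (71 / 25) := by unfold growth; norm_num
      nlinarith
    · have h3 : growth (71 / 25) ≤ 2824 / 1000 := by unfold growth; norm_num
      have h5 : 7 / 5 ≤ κ 2 / κ 0 := by norm_num at hl; nlinarith
      have h6 : 137 / 100 ≤ slope κ := by
        refine le_of_sq_le_sq ?_ ha.le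
        rw [ha2]; norm_num; linarith
      unfold growth
      nlinarith
  · norm_num at hη
    refine ⟨by norm_num; linarith, ?_⟩
    rcases le_or_gt g (8 / 25) with hg' | hg'
    · refine h.exists_bound_of_growth hm hx one_le_two (by norm_num; exact hη)
        (z := 2 * g) (z' := 36 / 25) (c := 157 / 100) (by norm_num) (by linarith)
        (by norm_num; linarith) (by norm_num) (by norm_num) ?_ (by norm_num) fun hl => ?_
      · have h1 := growth_mono (z := 2 * g) (z' := 16 / 25) (by linarith) (by linarith)
        have h2 : growth (16 / 25) ≤ 1341 / 1000 := by unfold growth; norm_num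
        have h3 : growth (36 / 25) ≤ 1824 / 1000 := by unfold growth; norm_num
        have h4 : 0 ≤ growth (36 / 25) := by unfold growth; norm_num
        nlinarith
      · have h3 : growth (36 / 25) ≤ 1824 / 1000 := by unfold growth; norm_num
        have h5 : 4 ≤ κ 2 / κ 0 := by norm_num at hl; nlinarith
        have h6 : 2 ≤ slope κ := by
          refine le_of_sq_le_sq ?_ ha.le
          rw [ha2]; linarith
        unfold growth
        nlinarith
    · refine h.exists_bound_of_growth hm hx one_le_two (by norm_num; exact hη)
        (z := 2 * g) (z' := 16 / 5) (c := 12 / 5) (by norm_num) (by linarith)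
        (by norm_num; linarith) (by norm_num) (by norm_num) ?_ (by norm_num) fun hl => ?_
      · have h1 := growth_mono (z := 2 * g) (z' := 71 / 50) (by linarith) (by linarith)
        have h2 : growth (71 / 50) ≤ 1811 / 1000 := by unfold growth; norm_num
        have h3 : growth (16 / 5) ≤ 3112 / 1000 := by unfold growth; norm_num
        have h4 : 0 ≤ growth (16 / 5) := by unfold growth; norm_num
        nlinarith
      -- The large κ_2/κ_0 of this case makes 2g `slope κ` exceed 1 + g/2 > 1 + η, contrary to the
      -- failure of the first test.
      · exfalso
        have h3 : growth (16 / 5) ≤ 3112 / 1000 := by unfold growth; norm_num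
        have h5 : 289 / 100 ≤ κ 2 / κ 0 := by norm_num at hl; nlinarith
        have h6 : 184 / 100 ≤ slope κ := by
          refine le_of_sq_le_sq ?_ ha.le
          rw [ha2]; norm_num; linarith
        have h7 := two_mul_lt_one_add hη0 (h.lt_of_threshold_lt_one hm hx hfail1)
        nlinarith
  · obtain ⟨k, rfl⟩ : ∃ k, K = k + 2 := ⟨K - 2, by omega⟩
    push_cast at hη ⊢
    have hk : (1 : ℝ) ≤ k := by exact_mod_cast (by omega : 1 ≤ k)
    have h1 := h.mul_le_of_forall_threshold_lt hm hx hg (k := k) (by omega) (by linarith)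
      fun j hj hjk => hfail j hj (by omega)
    -- Uses (k + 2)/(k + 1) ≤ 3/2 and 3/2 · 13/20 = 39/40.
    have hz1 : ((k : ℝ) + 2) * g ≤ 39 / 40 := by nlinarith
    have hz2 : ((k : ℝ) + 2 + 1) ^ 2 * η ≤ 26 / 15 := by
      have h2 : (k : ℝ) + 3 ≤ 4 / 3 * (k + 2) := by linarith
      have h4 : ((k : ℝ) + 2 + 1) ^ 2 * η ≤ 4 / 3 * (k + 3) * ((k + 2) * η) := by
        have := mul_le_mul_of_nonneg_right h2 (by positivity : 0 ≤ ((k : ℝ) + 3) * η)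
        linarith
      have h5 : 4 / 3 * ((k : ℝ) + 3) * ((k + 2) * η) ≤ 4 / 3 * (k + 3) * g :=
        mul_le_mul_of_nonneg_left hη.le (by positivity)
      nlinarith
    refine ⟨by linarith, h.exists_bound_of_growth hm hx hK (by push_cast; exact hη)
      (z := (k + 2) * g) (z' := 26 / 15) (c := 177 / 100) (by push_cast; exact le_rfl)
      (by linarith) (by push_cast; exact hz2)
      (by norm_num) (by norm_num) ?_ (by norm_num) fun hl => ?_⟩
    · have h1 := growth_mono (z := (k + 2) * g) (z' := 39 / 40) (by positivity) hz1
      have h2 : growth (39 / 40) ≤ 1536 / 1000 := by unfold growth; norm_num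
      have h3 : growth (26 / 15) ≤ 2018 / 1000 := by unfold growth; norm_num
      have h4 : 0 ≤ growth (26 / 15) := by unfold growth; norm_num
      nlinarith
    · have h3 : growth (26 / 15) ≤ 2018 / 1000 := by unfold growth; norm_num
      push_cast at hl
      have h5 : ((k : ℝ) + 2 + 1) ^ 2 ≤ 2018 / 1000 * (κ 2 / κ 0) := by nlinarith
      have h6 : 7 / 10 * ((k : ℝ) + 2 + 1) ≤ slope κ := by
        refine le_of_sq_le_sq ?_ ha.le
        rw [ha2]; nlinarith
      have h7 : growth (((k : ℝ) + 2) * g) - 1 ≤ 11 / 20 * (((k : ℝ) + 2) * g) := by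
        have : 0 ≤ ((k : ℝ) + 2) * g := by positivity
        unfold growth; nlinarith
      have h8 : g * (7 / 10 * ((k : ℝ) + 2 + 1)) ≤ g * slope κ := mul_le_mul_of_nonneg_left h6 hg0.le
      nlinarith

end Approximates

end Stopping

/-! ### Exact residual and error at the stopping index -/

section Stopping

variable {𝕜 : Type*} [RCLike 𝕜] {X : Type*} [NormedAddCommGroup X] [InnerProductSpace 𝕜 X]
  [CompleteSpace X] {w : ℝ → ℝ} {P : ℕ → ℝ[X]} {μ₀ : ℝ} {κ : ℝ → ℝ} {A B Q : X →L[𝕜] X}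
  {s d u g δ ρ η : ℝ} {x fδ : X}

omit [CompleteSpace X] in
lemma norm_opEval_resPoly_one_sub (hw : IsWeight w) (hP : IsMonicOrthogonal w P)
    {S T : X →L[𝕜] X} {d : ℝ} (hST : ‖S - T‖ ≤ d) (v : X) :
    ‖opEval S (resPoly P 1) v - opEval T (resPoly P 1) v‖ ≤ |2 * omega w P 0| * (d * ‖v‖) := by
  have h : ∀ Z : X →L[𝕜] X, opEval Z (resPoly P 1) v
      = v - ((2 * omega w P 0 : ℝ) : 𝕜) • Z v := fun Z => by
    rw [hP.resPoly_one hw, map_sub, map_one, map_mul, opEval_C, opEval_X]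
    rfl
  rw [h, h, sub_sub_sub_cancel_left, ← smul_sub, norm_smul, RCLike.norm_ofReal, norm_sub_rev,
    ← sub_apply]
  exact mul_le_mul_of_nonneg_left (ContinuousLinearMap.le_of_opNorm_le _ hST v) (abs_nonneg _)

lemma IsMethod.abs_two_mul_omega_le (hm : IsMethod w P μ₀ κ) :
    |2 * omega w P 0| ≤ κ 0 * (1 + min 1 (κ 2 / κ 0 / 4)) := by
  have h1 := hm.qualification.abs_one_sub_le hm.two_le hm.isWeight hm.orthogonal
  have h2 := abs_sub_abs_le_abs_sub (2 * omega w P 0) 1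
  rw [abs_sub_comm, abs_one] at h2
  have h3 := hm.qualification.one_le
  linarith

lemma le_slope (hm : IsMethod w P μ₀ κ) :
    11 / 25 * (1 + min 1 (κ 2 / κ 0 / 4)) ≤ slope κ := by
  have hq := hm.quotient_pos
  refine le_of_sq_le_sq ?_ hm.slope_pos.le
  rw [hm.slope_sq]
  have hm0 : 0 ≤ min 1 (κ 2 / κ 0 / 4) := le_min zero_le_one (by linarith)
  have hm1 : min 1 (κ 2 / κ 0 / 4) ≤ 1 := min_le_left _ _
  have hmq : min 1 (κ 2 / κ 0 / 4) ≤ κ 2 / κ 0 / 4 := min_le_right _ _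
  nlinarith

namespace Approximates

lemma norm_residual_le (h : Approximates A B Q s d u) (hm : IsMethod w P μ₀ κ)
    (hx : IsNoisyData A x fδ δ ρ) {K : ℕ} {N : ℝ}
    (hN : ∀ t ∈ Set.Icc (0 : ℝ) (1 + s), |(resPoly P K).eval t| ≤ N)
    (hNδ : N * δ + ‖opEval (B * star B) (resPoly P K) (A x)
      - opEval (A * star A) (resPoly P K) (A x)‖ ≤ threshold κ g δ ρ) :
    ‖opEval (A * star A) (resPoly P K) (A x)‖
      ≤ ‖B (iter w P B fδ K) - Q fδ‖ + threshold κ g δ ρ + u * ρ := by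
  rw [h.norm_residual_eq hm.isWeight hm.orthogonal]
  have h1 := h.norm_opEval_le_add (hm.orthogonal.eval_zero_resPoly hm.isWeight K) hN x fδ
  have hN0 : 0 ≤ N := (abs_nonneg _).trans (hN 0 ⟨le_rfl, by linarith [h.nonneg]⟩)
  have hu0 : 0 ≤ u := (norm_nonneg _).trans h.tail
  have h2 := mul_le_mul_of_nonneg_left hx.dist_le hN0
  have h3 := mul_le_mul_of_nonneg_left hx.norm_le hu0
  have h4 := norm_sub_norm_le (opEval (A * star A) (resPoly P K) (A x))
    (opEval (B * star B) (resPoly P K) (A x))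
  rw [norm_sub_rev] at h4
  linarith

lemma norm_discrepancy_le (h : Approximates A B Q s d u) (hm : IsMethod w P μ₀ κ)
    (hx : IsNoisyData A x fδ δ ρ) {K : ℕ} {N : ℝ}
    (hN : ∀ t ∈ Set.Icc (0 : ℝ) (1 + s), |(resPoly P K).eval t| ≤ N)
    (hNδ : N * δ + ‖opEval (B * star B) (resPoly P K) (A x)
      - opEval (A * star A) (resPoly P K) (A x)‖ ≤ threshold κ g δ ρ) :
    ‖B (iter w P B fδ K) - Q fδ‖
      ≤ threshold κ g δ ρ + ‖opEval (A * star A) (resPoly P K) (A x)‖ := by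
  rw [h.norm_residual_eq hm.isWeight hm.orthogonal]
  have h1 := h.norm_opEval_proj_le hN (A x) fδ
  have hN0 : 0 ≤ N := (abs_nonneg _).trans (hN 0 ⟨le_rfl, by linarith [h.nonneg]⟩)
  have h2 := mul_le_mul_of_nonneg_left hx.dist_le hN0
  have h4 := norm_sub_norm_le (opEval (B * star B) (resPoly P K) (A x))
    (opEval (A * star A) (resPoly P K) (A x))
  linarith

/-- The residual for exact data and the error, if the method stops with the first iterate. -/
lemma bounds_of_stop_one (h : Approximates A B Q (η / 3) (109 / 200 * η) u)
    (hm : IsMethod w P μ₀ κ) (hx : IsNoisyData A x fδ δ ρ) (hη : η < g) :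
    ‖opEval (A * star A) (resPoly P 1) (A x)‖
        ≤ ‖B (iter w P B fδ 1) - Q fδ‖ + threshold κ g δ ρ + u * ρ ∧
      ‖x - iter w P B fδ 1‖
        ≤ ‖opEval (star A * A) (resPoly P 1) x‖ + 2 * κ 0 * (δ + 2 * g * ρ) := by
  have hη0 : 0 ≤ η := by linarith [h.nonneg]
  have hκ := hm.zero_pos
  have hρ := hx.pos
  have hδ := hx.nonneg
  have hc := hm.abs_two_mul_omega_le
  have hM := hm.qualification.abs_resPoly_one_le hm.two_le hm.isWeight hm.orthogonal h.nonneg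
  have hsl := le_slope hm
  have hm0 : 0 ≤ min 1 (κ 2 / κ 0 / 4) := le_min zero_le_one (by linarith [hm.quotient_pos])
  have hm1 : min 1 (κ 2 / κ 0 / 4) ≤ 1 := min_le_left _ _
  generalize min 1 (κ 2 / κ 0 / 4) = m at *
  have hAx : ‖A x‖ ≤ ρ := (ContinuousLinearMap.le_of_opNorm_le _ h.norm_le x).trans
    ((one_mul _).trans_le hx.norm_le)
  have hηρ : η * ρ ≤ g * ρ := mul_le_mul_of_nonneg_right hη.le hρ.le
  have hηρ0 : 0 ≤ η * ρ := mul_nonneg hη0 hρ.le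
  have hηδ : η * δ ≤ η * ρ := mul_le_mul_of_nonneg_left hx.le hη0
  have hD : ∀ {S T : X →L[𝕜] X}, ‖S - T‖ ≤ 109 / 200 * η → ∀ v : X, ‖v‖ ≤ ρ →
      ‖opEval S (resPoly P 1) v - opEval T (resPoly P 1) v‖
        ≤ κ 0 * (1 + m) * (109 / 200 * (η * ρ)) := fun hST v hv => by
    refine (norm_opEval_resPoly_one_sub hm.isWeight hm.orthogonal hST v).trans ?_
    have h2 : 109 / 200 * η * ‖v‖ ≤ 109 / 200 * (η * ρ) := by
      rw [mul_assoc]; gcongr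
    exact mul_le_mul hc h2 (by positivity) (by positivity)
  constructor
  · refine h.norm_residual_le hm hx hM ?_
    have h1 := hD h.left_dist (A x) hAx
    have h2 : max 0 (m - 1 + (m + 1) * (η / 3)) ≤ (1 + m) * (η / 3) :=
      max_le (by positivity) (by linarith)
    have h3 : max 0 (m - 1 + (m + 1) * (η / 3)) * δ ≤ (1 + m) * (g * ρ / 3) := by
      refine (mul_le_mul_of_nonneg_right h2 hδ).trans ?_
      rw [mul_assoc]
      refine mul_le_mul_of_nonneg_left ?_ (by linarith)
      linarith
    have h4 : κ 0 * (1 + m) * (109 / 200 * (η * ρ)) ≤ κ 0 * (1 + m) * (109 / 200 * (g * ρ)) := by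
      gcongr
    have h5 : (11 / 25 * (1 + m)) * (2 * (g * ρ)) ≤ slope κ * (2 * (g * ρ)) :=
      mul_le_mul_of_nonneg_right hsl (by linarith)
    have h6 : 0 ≤ (1 + m) * (g * ρ) := mul_nonneg (by linarith) (by linarith)
    have h8 := mul_le_mul_of_nonneg_left h3 hκ.le
    have h9 := mul_le_mul_of_nonneg_left h5 hκ.le
    unfold threshold
    have h10 := mul_nonneg hκ.le h6
    linarith
  · have hcle : |2 * omega w P 0| ≤ 2 * κ 0 := by
      refine hc.trans ?_
      have := mul_le_mul_of_nonneg_left hm1 hκ.le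
      linarith
    have hsol : ∀ t : ℝ, (solPoly P 1).eval t = 2 * omega w P 0 := fun t => by
      rw [hm.orthogonal.solPoly_one hm.isWeight, eval_C]
    have h1 := h.norm_sub_iter_le hm.isWeight hm.orthogonal 1 (a := 2 * κ 0)
      (c := 2 * κ 0 * (1 + η / 6)) (by positivity) (fun t _ => by rw [hsol]; exact hcle)
      (fun t ht => by
        rw [hsol, ← sq_abs (2 * omega w P 0), mul_pow, mul_comm]
        have e : 1 + η / 3 ≤ (1 + η / 6) ^ 2 := by nlinarith
        exact mul_le_mul (pow_le_pow_left₀ (abs_nonneg _) hcle 2) (ht.2.trans e) ht.1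
          (by positivity)) x fδ (hD h.right_dist x hx.norm_le)
    have h2 : κ 0 * (1 + m) * (109 / 200 * (η * ρ)) ≤ κ 0 * 2 * (109 / 200 * (η * ρ)) := by
      gcongr; linarith
    have h3 : 2 * κ 0 * (η / 3 * ‖x‖) ≤ 2 * κ 0 * (η / 3 * ρ) := by
      gcongr; exact hx.norm_le
    have h4 : 2 * κ 0 * (1 + η / 6) * ‖A x - fδ‖ ≤ 2 * κ 0 * (1 + η / 6) * δ := by
      gcongr; exact hx.dist_le
    have h5 := mul_le_mul_of_nonneg_left hηρ hκ.le
    have h6 := mul_le_mul_of_nonneg_left hηδ hκ.le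
    have h7 := mul_nonneg hκ.le hηρ0
    linarith

/-- The error after `K` iterations, if the discrepancy test has failed before. -/
lemma norm_sub_iter_le_of_mul_le (h : Approximates A B Q (η / 4) (67 / 200 * η) u)
    (hm : IsMethod w P μ₀ κ) (hx : IsNoisyData A x fδ δ ρ) {K : ℕ} (hK : 2 ≤ K)
    (hη : (K : ℝ) * η < g) (hg : (K : ℝ) * g ≤ 71 / 50) :
    ‖x - iter w P B fδ K‖
      ≤ ‖opEval (star A * A) (resPoly P K) x‖ + 2 * κ 0 * (K * (δ + 2 * g * ρ)) := by
  have hη0 : 0 ≤ η := by linarith [h.nonneg]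
  have hκ := hm.zero_pos
  have hκ1 := hm.qualification.one_le
  have hρ := hx.pos
  have hK' : (2 : ℝ) ≤ K := by exact_mod_cast hK
  have hg0 : 0 < g := lt_of_le_of_lt (by positivity) hη
  have hθ : growth (71 / 50) ≤ 182 / 100 := by unfold growth; norm_num
  have hr := hm.qualification.abs_resPoly_le_growth hm.orthogonal (by omega : 1 ≤ K) h.nonneg
    (z := 71 / 50) (by nlinarith) (by norm_num)
  have hr' : ∀ t ∈ Set.Icc (0 : ℝ) (1 + η / 4), |(resPoly P K).eval t| ≤ κ 0 * (182 / 100) :=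
    fun t ht => (hr t ht).trans (mul_le_mul_of_nonneg_left hθ hκ.le)
  have hr1 := hm.qualification.abs_resPoly_le (by omega : 1 ≤ K)
  have hsol1 : ∀ t ∈ Set.Icc (0 : ℝ) 1, |(solPoly P K).eval t| ≤ 2 * K ^ 2 * κ 0 := fun t ht =>
    hm.orthogonal.abs_eval_solPoly_le hm.isWeight (by omega) hr1 ht
  have hsol2 : ∀ t ∈ Set.Icc (0 : ℝ) (1 + η / 4), 1 ≤ t →
      |t * (solPoly P K).eval t| ≤ 3 * κ 0 := fun t ht h1 => by
    rw [hm.orthogonal.mul_eval_solPoly hm.isWeight]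
    refine (abs_sub _ _).trans ?_
    rw [abs_one]
    linarith [hr' t ht]
  have hle : ∀ t : ℝ, 1 ≤ t → |(solPoly P K).eval t| ≤ |t * (solPoly P K).eval t| := fun t h1 => by
    rw [abs_mul, abs_of_nonneg (by linarith : 0 ≤ t)]
    exact le_mul_of_one_le_left (abs_nonneg _) h1
  have hE := h.norm_opEval_sub_le h.formIn_right h.formIn_limit_right h.right_dist
    (by omega : 1 ≤ K) (hm.orthogonal.natDegree_resPoly_le K) hr' x
  -- On [0, 1], t g_K² = (1 - r_K) g_K is at most 2κ_0 · 2K²κ_0 = (2κ_0 K)². Beyond 1 the quantity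
  -- |t g_K| = |1 - r_K| is at most 3κ_0, which is below 2κ_0 K because K ≥ 2.
  have hfin := h.norm_sub_iter_le hm.isWeight hm.orthogonal K (a := 2 * K ^ 2 * κ 0)
    (c := 2 * κ 0 * K) (by positivity)
    (fun t ht => by
      rcases le_total t 1 with h1 | h1
      · exact hsol1 t ⟨ht.1, h1⟩
      · refine (hle t h1).trans ((hsol2 t ht h1).trans ?_)
        have : 3 ≤ 2 * (K : ℝ) ^ 2 := by nlinarith
        exact mul_le_mul_of_nonneg_right this hκ.le)
    (fun t ht => by
      have hnn : 0 ≤ t * (solPoly P K).eval t ^ 2 := mul_nonneg ht.1 (sq_nonneg _)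
      rcases le_total t 1 with h1 | h1
      · have h2 : t * (solPoly P K).eval t ^ 2
            = |1 - (resPoly P K).eval t| * |(solPoly P K).eval t| := by
          rw [← hm.orthogonal.mul_eval_solPoly hm.isWeight, ← abs_mul, ← abs_of_nonneg hnn]
          congr 1; ring
        have h3 : |1 - (resPoly P K).eval t| ≤ 2 * κ 0 := by
          refine (abs_sub _ _).trans ?_
          rw [abs_one]
          linarith [hr1 t ⟨ht.1, h1⟩]
        rw [h2]
        refine (mul_le_mul h3 (hsol1 t ⟨ht.1, h1⟩) (abs_nonneg _) (by positivity)).trans_eq ?_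
        ring
      · have h2 : t * (solPoly P K).eval t ^ 2
            ≤ |t * (solPoly P K).eval t| * |t * (solPoly P K).eval t| := by
          rw [abs_mul_abs_self]
          nlinarith [sq_nonneg ((solPoly P K).eval t), mul_nonneg ht.1 (sub_nonneg.2 h1)]
        have h3 := (hsol2 t ht h1).trans (by nlinarith : 3 * κ 0 ≤ 2 * κ 0 * K)
        refine h2.trans ((mul_le_mul h3 h3 (abs_nonneg _) (by positivity)).trans_eq ?_)
        ring) x fδ hE
  have hKηρ : (K : ℝ) * η * ρ ≤ g * ρ := mul_le_mul_of_nonneg_right hη.le hρ.le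
  have h1 : 2 * (K : ℝ) ^ 2 * (κ 0 * (182 / 100)) * (67 / 200 * η) * ‖x‖
      ≤ 2 * (K : ℝ) ^ 2 * (κ 0 * (182 / 100)) * (67 / 200 * η) * ρ := by
    gcongr; exact hx.norm_le
  have h2 : 2 * (K : ℝ) ^ 2 * κ 0 * (η / 4 * ‖x‖) ≤ 2 * (K : ℝ) ^ 2 * κ 0 * (η / 4 * ρ) := by
    gcongr; exact hx.norm_le
  have h3 : 2 * κ 0 * K * ‖A x - fδ‖ ≤ 2 * κ 0 * K * δ := by
    gcongr; exact hx.dist_le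
  have h4 := mul_le_mul_of_nonneg_left hKηρ (by positivity : 0 ≤ κ 0 * (K : ℝ))
  have h5 : 0 ≤ κ 0 * (K : ℝ) * (g * ρ) := by positivity
  linarith

end Approximates

end Stopping

/-! ### The number of iterations permitted at a level -/

section Levels

variable {r γ δ ρ : ℝ} {n k : ℕ}

lemma crossErr_pos (r : ℝ) (hn : 1 ≤ n) : 0 < crossErr r n := by
  have : (0 : ℝ) < n := by exact_mod_cast hn
  unfold crossErr
  positivity

lemma levelCond_iff (hk : 1 ≤ k) :
    LevelCond r γ δ ρ n k ↔ k * crossErr r n < γ * δ / (2 * ρ) := by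
  have hk' : (0 : ℝ) < k := by exact_mod_cast hk
  rw [show k * crossErr r n < γ * δ / (2 * ρ) ↔ crossErr r n < γ * δ / (2 * ρ) / k by
    rw [lt_div_iff₀ hk', mul_comm], div_div, mul_right_comm]
  rfl

/-- As η > 0, the admissible indices are bounded, and they form an initial segment; so membership up
to the supremum is the inequality kη < g. -/
lemma le_maxIter_iff (hn : 1 ≤ n) (hk : 1 ≤ k) :
    k ≤ maxIter r γ δ ρ n ↔ k * crossErr r n < γ * δ / (2 * ρ) := by
  have hη := crossErr_pos r hn
  have hbdd : BddAbove {k : ℕ | 1 ≤ k ∧ LevelCond r γ δ ρ n k} := by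
    obtain ⟨N, hN⟩ := exists_nat_gt (γ * δ / (2 * ρ) / crossErr r n)
    refine ⟨N, fun j hj => ?_⟩
    have h1 := (levelCond_iff hj.1).1 hj.2
    rw [← lt_div_iff₀ hη] at h1
    exact_mod_cast (h1.trans hN).le
  constructor
  · intro h
    have hne : {k : ℕ | 1 ≤ k ∧ LevelCond r γ δ ρ n k}.Nonempty := by
      rw [Set.nonempty_iff_ne_empty]
      intro h0
      -- The supremum of the empty set is 0, which is excluded by 1 ≤ k.
      rw [maxIter, h0, csSup_empty] at h
      exact absurd h (by simp; omega)
    have hmem := Nat.sSup_mem hne hbdd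
    refine lt_of_le_of_lt ?_ ((levelCond_iff hmem.1).1 hmem.2)
    refine mul_le_mul_of_nonneg_right ?_ hη.le
    exact_mod_cast h
  · intro h
    exact le_csSup hbdd ⟨hk, (levelCond_iff hk).2 h⟩

lemma tendsto_crossErr (hr : 0 < r) :
    Filter.Tendsto (crossErr r) Filter.atTop (nhds 0) := by
  have ht : ((2 : ℝ) ^ (-r)) ^ 2 < 1 :=
    pow_lt_one₀ (by positivity) (Real.rpow_lt_one_of_one_lt_of_neg one_lt_two (by linarith))
      two_ne_zero
  have h := (tendsto_self_mul_const_pow_of_lt_one (sq_nonneg ((2 : ℝ) ^ (-r))) ht).const_mul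
    (1 + 8 * (2 : ℝ) ^ r)
  rw [mul_zero] at h
  refine h.congr fun n => ?_
  rw [crossErr_eq, ← pow_mul]
  ring

end Levels

/-! ### Termination and error bounds for the algorithm -/

section Algorithm

variable {𝕜 : Type*} [RCLike 𝕜] {X : Type*} [NormedAddCommGroup X] [InnerProductSpace 𝕜 X]
  [CompleteSpace X] {e : HilbertBasis ℕ 𝕜 X} {w : ℝ → ℝ} {P : ℕ → ℝ[X]} {μ₀ : ℝ} {κ : ℝ → ℝ}
  {A : X →L[𝕜] X} {r γ τ μ δ ρ : ℝ} {n K : ℕ} {x fδ : X}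

lemma threshold_eq (κ : ℝ → ℝ) (γ δ : ℝ) {ρ : ℝ} (hρ : 0 < ρ) :
    threshold κ (γ * δ / (2 * ρ)) δ ρ = tauMin κ γ * δ := by
  unfold threshold tauMin slope
  field_simp

lemma IsMethod.sqrt_eq (hm : IsMethod w P μ₀ κ) :
    √(κ 0 * (κ 0 / 2 + κ 2)) = κ 0 * slope κ := by
  have hκ := hm.zero_pos
  rw [show κ 0 * (κ 0 / 2 + κ 2) = (κ 0 * slope κ) ^ 2 by
    rw [mul_pow, hm.slope_sq]; field_simp, Real.sqrt_sq (mul_nonneg hκ.le hm.slope_pos.le)]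

namespace Decay

lemma approximates_cross (hA : Decay e r A) (hr : 0 < r) (hn : 1 ≤ n) :
    Approximates A (cross e A n) (proj e (2 ^ (2 * n))) (crossErr r n / 3)
      (109 / 200 * crossErr r n) (crossErr r n / (9 * n)) := by
  obtain ⟨h1, h2, h3⟩ := crossErr_bounds hr hn
  have h := hA.approximates hr n h1 le_rfl h3
  exact { h with tail := h.tail.trans h2 }

lemma approximates_cross_of_le (hA : Decay e r A) (hr : 0 < r) (hn : 1 ≤ n)
    (hη : crossErr r n ≤ 3 / 4) :
    Approximates A (cross e A n) (proj e (2 ^ (2 * n))) (crossErr r n / 4)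
      (67 / 200 * crossErr r n) (crossErr r n / (9 * n)) := by
  obtain ⟨h1, h3⟩ := crossErr_bounds_of_le hr hn hη
  have h := hA.approximates hr n h1 le_rfl h3
  exact { h with tail := h.tail.trans (crossErr_bounds hr hn).2.1 }

/-- If the first discrepancy test fails, then the level is fine enough. -/
lemma fine_of_threshold_lt (hA : Decay e r A) (hr : 0 < r) (hn : 1 ≤ n) (hm : IsMethod w P μ₀ κ)
    (hx : IsNoisyData A x fδ δ ρ) {g : ℝ} (hη : crossErr r n < g)
    (hfail : threshold κ g δ ρ < discrepancy e w P A fδ n 1) :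
    g ≤ 71 / 100 ∧ Approximates A (cross e A n) (proj e (2 ^ (2 * n))) (crossErr r n / 4)
      (67 / 200 * crossErr r n) (crossErr r n / (9 * n)) := by
  have hg := le_of_two_mul_sqrt_lt hm.quotient_pos.le (crossErr_pos r hn).le hη
    ((hA.approximates_cross hr hn).lt_of_threshold_lt_one hm hx hfail)
  exact ⟨hg, hA.approximates_cross_of_le hr hn (by linarith)⟩

end Decay

/-- The exact residual is A r_K(A*A)x by intertwining. The decay uses the qualification bound with
exponent μ + 1, which is why μ ≤ μ₀ - 1 is required. -/
lemma HasQualification.norm_residual_le (hκ : HasQualification P μ₀ κ) (hA : ‖A‖ ≤ 1) (hμ : 0 < μ)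
    (hμμ₀ : μ ≤ μ₀ - 1) (hρ : 0 < ρ) (hx : x ∈ sourceSet A μ ρ) (hK : 1 ≤ K) :
    ‖opEval (A * star A) (resPoly P K) (A x)‖ ≤ κ (μ + 1) / ((K : ℝ) + 1) ^ (μ + 1) * ρ ∧
      ‖opEval (star A * A) (resPoly P K) x‖ ≤ (κ 0 * ρ) ^ (1 / (μ + 1)) *
        ‖opEval (A * star A) (resPoly P K) (A x)‖ ^ (μ / (μ + 1)) := by
  have h1 : opEval (A * star A) (resPoly P K) (A x) = A (opEval (star A * A) (resPoly P K) x) := by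
    rw [← mul_apply_eq_comp, ← mul_apply_eq_comp,
      comp_opEval (mul_assoc A (star A) A).symm (resPoly P K)]
  rw [h1]
  exact (sourceSet_bounds hA hμ hρ hx).2 (resPoly P K) _ (κ 0) (zero_lt_one.trans_le hκ.one_le)
    (fun t ht => by
      rw [eval_resPoly]; exact hκ.bound (μ + 1) (by linarith) (by linarith) K hK t ht)
    (hκ.abs_resPoly_le hK)

/-- The number of iterations is bounded, as long as the discrepancy test fails. -/
theorem mul_le_of_forall_lt_discrepancy (hA : Decay e r A) (hr : 0 < r) (hn : 1 ≤ n)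
    (hm : IsMethod w P μ₀ κ) (hμ : 0 < μ) (hμμ₀ : μ ≤ μ₀ - 1) (hτ : tauMin κ γ < τ)
    (hsrc : x ∈ sourceSet A μ ρ) (hx : IsNoisyData A x fδ δ ρ) (hK : 1 ≤ K)
    (hη : K * crossErr r n < γ * δ / (2 * ρ))
    (hfail : ∀ j, 1 ≤ j → j ≤ K → τ * δ < discrepancy e w P A fδ n j) :
    (τ - tauMin κ γ) * δ ≤ κ (μ + 1) / ((K : ℝ) + 1) ^ (μ + 1) * ρ := by
  have hη1 : crossErr r n < γ * δ / (2 * ρ) := by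
    refine lt_of_le_of_lt (le_mul_of_one_le_left (crossErr_pos r hn).le ?_) hη
    exact_mod_cast hK
  have hthr : ∀ j, 1 ≤ j → j ≤ K →
      threshold κ (γ * δ / (2 * ρ)) δ ρ < discrepancy e w P A fδ n j := fun j hj hjK => by
    rw [threshold_eq κ γ δ hx.pos]
    exact (mul_le_mul_of_nonneg_right hτ.le hx.nonneg).trans_lt (hfail j hj hjK)
  obtain ⟨hg, h⟩ := hA.fine_of_threshold_lt hr hn hm hx hη1 (hthr 1 le_rfl hK)
  obtain ⟨-, N, hN, hNδ⟩ := h.exists_bound hm hx hg hK hη (hthr 1 le_rfl hK)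
    fun j hj hjK => hthr j hj hjK.le
  have h1 := h.norm_discrepancy_le hm hx hN hNδ
  have h2 : τ * δ < threshold κ (γ * δ / (2 * ρ)) δ ρ
      + ‖opEval (A * star A) (resPoly P K) (A x)‖ := (hfail K hK le_rfl).trans_le h1
  rw [threshold_eq κ γ δ hx.pos] at h2
  have h3 := (hm.qualification.norm_residual_le hA.norm_le hμ hμμ₀ hx.pos hsrc hK).1
  linarith

/-- The residual for exact data and the error after the stopping of the iteration. -/
theorem bounds_of_discrepancy_le (hA : Decay e r A) (hr : 0 < r) (hn : 1 ≤ n)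
    (hm : IsMethod w P μ₀ κ) (hγ : 0 < γ) (hτ : tauMin κ γ < τ)
    (hx : IsNoisyData A x fδ δ ρ) (hK : 1 ≤ K)
    (hη : K * crossErr r n < γ * δ / (2 * ρ))
    (hfail : ∀ j, 1 ≤ j → j < K → τ * δ < discrepancy e w P A fδ n j)
    (htest : discrepancy e w P A fδ n K ≤ τ * δ) :
    ‖opEval (A * star A) (resPoly P K) (A x)‖ ≤ (τ + c₁ κ γ n) * δ ∧
      ‖x - approx e w P A fδ n K‖
        ≤ ‖opEval (star A * A) (resPoly P K) x‖ + 2 * κ 0 * (1 + γ) * (K * δ) := by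
  have hη1 : crossErr r n < γ * δ / (2 * ρ) := by
    refine lt_of_le_of_lt (le_mul_of_one_le_left (crossErr_pos r hn).le ?_) hη
    exact_mod_cast hK
  have hρ := hx.pos
  have hδ := hx.nonneg
  have hn' : (0 : ℝ) < n := by exact_mod_cast hn
  have hthr : ∀ j, 1 ≤ j → j < K →
      threshold κ (γ * δ / (2 * ρ)) δ ρ < discrepancy e w P A fδ n j := fun j hj hjK => by
    rw [threshold_eq κ γ δ hx.pos]
    exact (mul_le_mul_of_nonneg_right hτ.le hx.nonneg).trans_lt (hfail j hj hjK)
  have hg2 : 2 * (γ * δ / (2 * ρ)) * ρ = γ * δ := by field_simp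
  have hc₁ : discrepancy e w P A fδ n K + threshold κ (γ * δ / (2 * ρ)) δ ρ
      + crossErr r n / (9 * n) * ρ ≤ (τ + c₁ κ γ n) * δ := by
    have h1 : crossErr r n / (9 * n) * ρ ≤ 1 / (2 * n) * (γ * δ) := by
      have h2 : crossErr r n * ρ ≤ γ * δ / (2 * ρ) * ρ := mul_le_mul_of_nonneg_right hη1.le hρ.le
      have h3 : 0 ≤ γ * δ := by positivity
      rw [div_mul_eq_mul_div, one_div_mul_eq_div, div_le_div_iff₀ (by positivity) (by positivity)]
      nlinarith
    rw [threshold_eq κ γ δ hρ]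
    have h4 : tauMin κ γ = κ 0 * (1 + slope κ * γ) := rfl
    rw [c₁, hm.sqrt_eq, h4]
    linarith
  -- If K = 1, no test has failed and nothing is known about the fineness of the level; the coarse
  -- constants and the explicit r_1 are used instead.
  obtain rfl | hK2 : K = 1 ∨ 2 ≤ K := by omega
  · obtain ⟨h1, h2⟩ := (hA.approximates_cross hr hn).bounds_of_stop_one hm hx hη1
    rw [hg2] at h2
    refine ⟨h1.trans hc₁, h2.trans (le_of_eq ?_)⟩
    push_cast
    ring
  · obtain ⟨hg, h⟩ := hA.fine_of_threshold_lt hr hn hm hx hη1 (hthr 1 le_rfl (by omega))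
    obtain ⟨hKg, N, hN, hNδ⟩ := h.exists_bound hm hx hg hK hη (hthr 1 le_rfl (by omega)) hthr
    have h2 := h.norm_sub_iter_le_of_mul_le hm hx hK2 hη hKg
    rw [hg2] at h2
    refine ⟨(h.norm_residual_le hm hx hN hNδ).trans hc₁, h2.trans (le_of_eq ?_)⟩
    ring

/-- The order optimal error bound. -/
theorem norm_sub_approx_le (hA : Decay e r A) (hr : 0 < r) (hn : 1 ≤ n)
    (hm : IsMethod w P μ₀ κ) (hμ : 0 < μ) (hμμ₀ : μ ≤ μ₀ - 1) (hγ : 0 < γ) (hτ : tauMin κ γ < τ)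
    (hsrc : x ∈ sourceSet A μ ρ) (hx : IsNoisyData A x fδ δ ρ) (hδ : 0 < δ) (hK : 1 ≤ K)
    (hη : K * crossErr r n < γ * δ / (2 * ρ))
    (hfail : ∀ j, 1 ≤ j → j < K → τ * δ < discrepancy e w P A fδ n j)
    (htest : discrepancy e w P A fδ n K ≤ τ * δ) :
    ‖x - approx e w P A fδ n K‖
      ≤ errConst κ γ τ μ n * ρ ^ (1 / (μ + 1)) * δ ^ (μ / (μ + 1)) := by
  have hρ := hx.pos
  have hκ := hm.zero_pos
  have hμ1 : 0 < μ + 1 := by linarith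
  have hK0 : (0 : ℝ) < K := by exact_mod_cast hK
  obtain ⟨h1, h2⟩ := bounds_of_discrepancy_le hA hr hn hm hγ hτ hx hK hη hfail htest
  have h3 := (hm.qualification.norm_residual_le hA.norm_le hμ hμμ₀ hρ hsrc hK).2
  have hnn : 0 ≤ τ + c₁ κ γ n := by
    have := (norm_nonneg _).trans h1
    exact nonneg_of_mul_nonneg_left this hδ
  have h4 : ‖opEval (star A * A) (resPoly P K) x‖
      ≤ κ 0 ^ (1 / (μ + 1)) * (τ + c₁ κ γ n) ^ (μ / (μ + 1)) * ρ ^ (1 / (μ + 1))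
        * δ ^ (μ / (μ + 1)) := by
    refine h3.trans ((mul_le_mul_of_nonneg_left (Real.rpow_le_rpow (norm_nonneg _) h1
      (by positivity)) (by positivity)).trans_eq ?_)
    rw [Real.mul_rpow hκ.le hρ.le, Real.mul_rpow hnn hδ.le]
    ring
  have hτ0 : 0 < τ - tauMin κ γ := sub_pos.2 hτ
  have hκμ : 0 < κ (μ + 1) := hm.qualification.pos _ hμ1 (by linarith)
  have hKle : (K : ℝ) ≤ c₂ κ γ τ μ * (ρ / δ) ^ (1 / (μ + 1)) := by
    have hρδ : 1 ≤ (ρ / δ) ^ (1 / (μ + 1)) :=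
      Real.one_le_rpow ((one_le_div hδ).2 hx.le) (by positivity)
    -- The decay estimate is used at the last failed index k = K - 1, where its denominator is
    -- exactly K^(μ+1). For K = 1 the alternative 1 in c₂ and δ ≤ ρ suffice.
    obtain rfl | hK2 : K = 1 ∨ 2 ≤ K := by omega
    · rw [Nat.cast_one]
      exact one_le_mul_of_one_le_of_one_le (le_max_right _ _) hρδ
    · obtain ⟨k, rfl⟩ : ∃ k, K = k + 1 := ⟨K - 1, by omega⟩
      have h5 := mul_le_of_forall_lt_discrepancy hA hr hn hm hμ hμμ₀ hτ hsrc hx (K := k)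
        (by omega) (lt_of_le_of_lt (mul_le_mul_of_nonneg_right (by push_cast; linarith)
          (crossErr_pos r hn).le) hη) fun j hj hjk => hfail j hj (by omega)
      have h6 : ((k : ℝ) + 1) ^ (μ + 1) ≤ κ (μ + 1) / (τ - tauMin κ γ) * (ρ / δ) := by
        rw [div_mul_div_comm, le_div_iff₀ (by positivity)]
        rw [div_mul_eq_mul_div, le_div_iff₀ (by positivity)] at h5
        linarith
      have h7 := Real.rpow_le_rpow (by positivity) h6 (by positivity : 0 ≤ 1 / (μ + 1))
      rw [← Real.rpow_mul (by positivity), mul_one_div_cancel hμ1.ne', Real.rpow_one,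
        Real.mul_rpow (by positivity) (by positivity)] at h7
      push_cast
      exact h7.trans (mul_le_mul_of_nonneg_right (le_max_left _ _) (by positivity))
  have hKδ : (K : ℝ) * δ ≤ c₂ κ γ τ μ * (ρ ^ (1 / (μ + 1)) * δ ^ (μ / (μ + 1))) := by
    have e1 : δ = δ ^ (1 / (μ + 1)) * δ ^ (μ / (μ + 1)) := by
      rw [← Real.rpow_add hδ, ← add_div, add_comm 1 μ, div_self hμ1.ne', Real.rpow_one]
    have h8 := mul_le_mul_of_nonneg_right hKle hδ.le
    rw [Real.div_rpow hρ.le hδ.le] at h8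
    have h10 : 0 < δ ^ (1 / (μ + 1)) := Real.rpow_pos_of_pos hδ _
    refine h8.trans_eq ?_
    generalize δ ^ (1 / (μ + 1)) = y at *
    generalize δ ^ (μ / (μ + 1)) = y' at *
    rw [e1]
    field_simp
  have h9 := mul_le_mul_of_nonneg_left hKδ (by positivity : 0 ≤ 2 * κ 0 * (1 + γ))
  refine h2.trans ((add_le_add h4 h9).trans_eq ?_)
  unfold errConst
  ring

/-- Otherwise all tests fail. Choose k so large that the decaying exact residual is below (τ - τ₀)δ,
then a level so fine that k iterations are permitted; this contradicts
`mul_le_of_forall_lt_discrepancy`. -/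
lemma exists_stopsAt (hA : Decay e r A) (hr : 0 < r) {n₀ : ℕ} (hn₀ : 1 ≤ n₀)
    (hm : IsMethod w P μ₀ κ) (hμ : 0 < μ) (hμμ₀ : μ ≤ μ₀ - 1) (hγ : 0 < γ) (hτ : tauMin κ γ < τ)
    (hsrc : x ∈ sourceSet A μ ρ) (hx : IsNoisyData A x fδ δ ρ) (hδ : 0 < δ) :
    ∃ n K, StopsAt e r w P A ρ γ τ δ fδ n₀ n K := by
  have hρ := hx.pos
  have hex : ∃ n, n₀ ≤ n ∧ ∃ j, 1 ≤ j ∧ j ≤ maxIter r γ δ ρ n ∧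
      discrepancy e w P A fδ n j ≤ τ * δ := by
    by_contra! hcon
    have hτ0 : 0 < (τ - tauMin κ γ) * δ := mul_pos (sub_pos.2 hτ) hδ
    have hlim : Filter.Tendsto (fun k : ℕ => κ (μ + 1) / ((k : ℝ) + 1) ^ (μ + 1) * ρ)
        Filter.atTop (nhds 0) := by
      have h1 : Filter.Tendsto (fun k : ℕ => ((k : ℝ) + 1) ^ (μ + 1)) Filter.atTop Filter.atTop :=
        (tendsto_rpow_atTop (by linarith)).comp
          (Filter.tendsto_atTop_add_const_right _ _ tendsto_natCast_atTop_atTop)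
      simpa using (h1.const_div_atTop (κ (μ + 1))).mul_const ρ
    obtain ⟨k, hk, hk1⟩ := ((hlim.eventually_lt_const hτ0).and
      (Filter.eventually_ge_atTop 1)).exists
    have hg : 0 < γ * δ / (2 * ρ) := by positivity
    have hlim2 : Filter.Tendsto (fun n : ℕ => (k : ℝ) * crossErr r n) Filter.atTop (nhds 0) := by
      simpa using (tendsto_crossErr hr).const_mul (k : ℝ)
    obtain ⟨n, hn, hnn⟩ := ((hlim2.eventually_lt_const hg).and
      (Filter.eventually_ge_atTop n₀)).exists
    have hmax := (le_maxIter_iff (hn₀.trans hnn) hk1).2 hn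
    have := mul_le_of_forall_lt_discrepancy hA hr (hn₀.trans hnn) hm hμ hμμ₀ hτ hsrc hx hk1 hn
      fun j hj hjk => hcon n hnn j hj (hjk.trans hmax)
    linarith
  classical
  obtain ⟨hn, hj⟩ := Nat.find_spec hex
  obtain ⟨h1, h2, h3⟩ := Nat.find_spec hj
  refine ⟨Nat.find hex, Nat.find hj, hn, fun m hm1 hm2 j hj1 hj2 => ?_, h1, h2,
    fun j hj1 hj2 => ?_, h3⟩
  · by_contra! hle
    exact Nat.find_min hex hm2 ⟨hm1, j, hj1, hj2, hle⟩
  · by_contra! hle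
    exact Nat.find_min hj hj2 ⟨hj1, (hj2.le.trans h2), hle⟩

lemma StopsAt.level_le {n₀ n' K' : ℕ} (h : StopsAt e r w P A ρ γ τ δ fδ n₀ n K)
    (h' : StopsAt e r w P A ρ γ τ δ fδ n₀ n' K') : n ≤ n' := by
  by_contra! hlt
  exact absurd h'.test (not_le.2 (h.earlier_levels n' h'.le_level hlt K' h'.one_le h'.le_maxIter))

lemma StopsAt.index_le {n₀ K' : ℕ} (h : StopsAt e r w P A ρ γ τ δ fδ n₀ n K)
    (h' : StopsAt e r w P A ρ γ τ δ fδ n₀ n K') : K ≤ K' := by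
  by_contra! hlt
  exact absurd h'.test (not_le.2 (h.earlier_iterates K' h'.one_le hlt))

lemma StopsAt.norm_sub_le (hA : Decay e r A) (hr : 0 < r) {n₀ : ℕ} (hn₀ : 1 ≤ n₀)
    (hm : IsMethod w P μ₀ κ) (hμ : 0 < μ) (hμμ₀ : μ ≤ μ₀ - 1) (hγ : 0 < γ) (hτ : tauMin κ γ < τ)
    (hsrc : x ∈ sourceSet A μ ρ) (hx : IsNoisyData A x fδ δ ρ) (hδ : 0 < δ)
    (h : StopsAt e r w P A ρ γ τ δ fδ n₀ n K) :
    ‖x - approx e w P A fδ n K‖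
      ≤ errConst κ γ τ μ n * ρ ^ (1 / (μ + 1)) * δ ^ (μ / (μ + 1)) :=
  norm_sub_approx_le hA hr (hn₀.trans h.le_level) hm hμ hμμ₀ hγ hτ hsrc hx hδ h.one_le
    ((le_maxIter_iff (hn₀.trans h.le_level) h.one_le).1 h.le_maxIter)
    h.earlier_iterates h.test

/-- The final level enters the constant only through 1/(2n). The bound by the value at level 1 makes
the convergence uniform in the starting level and the data. -/
lemma errConst_le (hm : IsMethod w P μ₀ κ) (hμ : 0 < μ) (hγ : 0 < γ) (hτ : tauMin κ γ < τ)
    (hn : 1 ≤ n) : errConst κ γ τ μ n ≤ errConst κ γ τ μ 1 := by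
  have hκ := hm.zero_pos
  have hn' : (1 : ℝ) ≤ n := by exact_mod_cast hn
  have hτ0 : 0 < τ := by
    refine lt_trans ?_ hτ
    unfold tauMin
    positivity
  have h0 : 0 ≤ τ + c₁ κ γ n := by unfold c₁; positivity
  have h1 : τ + c₁ κ γ n ≤ τ + c₁ κ γ 1 := by
    unfold c₁
    gcongr
  unfold errConst
  gcongr

end Algorithm

end AdaptiveCross

end

/-! ### The main theorem -/

open AdaptiveCross in
theorem theorem1 {𝕜 : Type*} [RCLike 𝕜] {H : Type*} [NormedAddCommGroup H]
    [InnerProductSpace 𝕜 H] [CompleteSpace H]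
    (e : HilbertBasis ℕ 𝕜 H) (r : ℝ) (hr : 0 < r) (A : H →L[𝕜] H) (hA : MemH e r A)
    (w : ℝ → ℝ) (hw : IsWeight w) (P : ℕ → Polynomial ℝ) (hP : IsMonicOrthogonal w P)
    (μ₀ : ℝ) (hμ₀ : 2 ≤ μ₀) (κ : ℝ → ℝ) (hκ : HasQualification P μ₀ κ)
    (ρ γ τ : ℝ) (hρ : 0 < ρ) (hγ : 0 < γ) (hτ : tauMin κ γ < τ)
    (μ : ℝ) (hμ : 0 < μ) (hμμ₀ : μ ≤ μ₀ - 1) :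
    -- the algorithm terminates, and its result satisfies the order-optimal error estimate
    (∀ (f x : H), IsMinNormSol A f x → x ∈ sourceSet A μ ρ →
      ∀ (δ : ℝ), 0 < δ → δ < ‖f‖ → ∀ (fδ : H), ‖f - fδ‖ ≤ δ →
      ∀ (n₀ : ℕ), IsStartLevel r γ δ ρ n₀ →
        (∃! p : ℕ × ℕ, StopsAt e r w P A ρ γ τ δ fδ n₀ p.1 p.2) ∧
        ∀ (n K : ℕ), StopsAt e r w P A ρ γ τ δ fδ n₀ n K →
          ‖x - approx e w P A fδ n K‖ ≤
            errConst κ γ τ μ n * ρ ^ (1 / (μ + 1)) * δ ^ (μ / (μ + 1))) ∧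
    -- the algorithm is a regularization method
    (∀ (f x : H), f ≠ 0 → IsMinNormSol A f x → x ∈ sourceSet A μ ρ →
      ∀ (ε : ℝ), 0 < ε → ∃ (δ₁ : ℝ), 0 < δ₁ ∧
        ∀ (δ : ℝ), 0 < δ → δ < δ₁ → ∀ (fδ : H), ‖f - fδ‖ ≤ δ →
        ∀ (n₀ : ℕ), IsStartLevel r γ δ ρ n₀ →
        ∀ (n K : ℕ), StopsAt e r w P A ρ γ τ δ fδ n₀ n K →
          ‖x - approx e w P A fδ n K‖ < ε) := by
  have hm : IsMethod w P μ₀ κ := ⟨hw, hP, hμ₀, hκ⟩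
  have hdata : ∀ (f x : H), IsMinNormSol A f x → x ∈ sourceSet A μ ρ → ∀ (δ : ℝ), 0 < δ →
      δ < ‖f‖ → ∀ (fδ : H), ‖f - fδ‖ ≤ δ → IsNoisyData A x fδ δ ρ := by
    intro f x hfx hx δ hδ hδf fδ hfδ
    have hxρ := (sourceSet_bounds hA.norm_le hμ hρ hx).1
    have hf : ‖f‖ ≤ ρ := by
      rw [← hfx.1]
      exact (ContinuousLinearMap.le_of_opNorm_le _ hA.norm_le x).trans
        ((one_mul _).trans_le hxρ)
    exact ⟨hδ.le, hδf.le.trans hf, hρ, hxρ, by rw [hfx.1]; exact hfδ⟩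
  constructor
  · intro f x hfx hx δ hδ hδf fδ hfδ n₀ hn₀
    have hd := hdata f x hfx hx δ hδ hδf fδ hfδ
    refine ⟨?_, fun n K h => h.norm_sub_le hA.decay hr hn₀.1 hm hμ hμμ₀ hγ hτ hx hd hδ⟩
    obtain ⟨n, K, h⟩ := exists_stopsAt hA.decay hr hn₀.1 hm hμ hμμ₀ hγ hτ hx hd hδ
    refine ⟨(n, K), h, ?_⟩
    rintro ⟨n', K'⟩ h'
    obtain rfl : n' = n := le_antisymm (h'.level_le h) (h.level_le h')
    obtain rfl : K' = K := le_antisymm (h'.index_le h) (h.index_le h')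
    rfl
  · intro f x hf hfx hx ε hε
    have hp : 0 < μ / (μ + 1) := by positivity
    have hlim : Filter.Tendsto (fun δ : ℝ => errConst κ γ τ μ 1 * ρ ^ (1 / (μ + 1))
        * δ ^ (μ / (μ + 1))) (nhds 0) (nhds 0) := by
      have h := ((Real.continuousAt_rpow_const 0 (μ / (μ + 1)) (Or.inr hp.le)).tendsto).const_mul
        (errConst κ γ τ μ 1 * ρ ^ (1 / (μ + 1)))
      rwa [Real.zero_rpow hp.ne', mul_zero] at h
    obtain ⟨δ₁, hδ₁, hball⟩ := Metric.eventually_nhds_iff.1 (hlim.eventually_lt_const hε)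
    -- The minimum with ‖f‖ keeps δ < ‖f‖ ≤ ρ, which the error estimate needs.
    refine ⟨min δ₁ ‖f‖, lt_min hδ₁ (norm_pos_iff.2 hf), fun δ hδ hδδ₁ fδ hfδ n₀ hn₀ n K h => ?_⟩
    have hd := hdata f x hfx hx δ hδ (hδδ₁.trans_le (min_le_right _ _)) fδ hfδ
    refine (h.norm_sub_le hA.decay hr hn₀.1 hm hμ hμμ₀ hγ hτ hx hd hδ).trans_lt
      (lt_of_le_of_lt ?_ (hball (y := δ) ?_))
    · gcongr
      exact errConst_le hm hμ hγ hτ (hn₀.1.trans h.le_level)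
    · rw [Real.dist_eq, sub_zero, abs_of_pos hδ]
      exact hδδ₁.trans_le (min_le_left _ _)
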